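/- **Theorem 3.1.** Let $Y_1,\dots,Y_n$ be independent random vectors, $Y_i\in\mathbb R^{q_i}$ ($q_i\ge 1$), where for each $\theta$ in an open set $\Theta\subseteq\mathbb R^p$ the vector $Y_i\sim El_{q_i}(\mu_i(\theta),\Sigma_i(\theta))$ has density $|\Sigma_i|^{-1/2}g_i\bigl((y-\mu_i)^\top\Sigma_i^{-1}(y-\mu_i)\bigr)$. Here $g_i:[0,\infty)\to(0,\infty)$ is a known density generating function, differentiable on $(0,\infty)$, with $\int_{\mathbb R^{q_i}}g_i(\|x\|^2)\,dx=1$; $\mu_i(\theta)\in\mathbb R^{q_i}$ and the positive definite matrix $\Sigma_i(\theta)$ are twice differentiable in $\theta\in\Theta$. Let $u_i=(y_i-\mu_i)^\top\Sigma_i^{-1}(y_i-\mu_i)$ and let $\ell(\theta)=\sum_{i=1}^n\{-\tfrac12\log|\Sigma_i|+\log g_i(u_i)\}$ be the log-likelihood. *Cumulants and bias.* Put $U_r=\partial\ell/\partial\theta_r$, $\kappa_{r,s}=E_\theta(U_rU_s)$, $\kappa_{rst}=E_\theta(\partial^2U_r/\partial\theta_s\partial\theta_t)$, $\kappa_{rs,t}=E_\theta\bigl((\partial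 U_r/\partial\theta_s)\,U_t\bigr)$, $K(\theta)=(\kappa_{r,s})$ and $K(\theta)^{-1}=(\kappa^{r,s})$. The Cox–Snell second-order bias of the maximum likelihood estimator is the vector $B(\theta)$ with $$B_j(\theta)=\sum_{r,s,t=1}^p\kappa^{j,r}\kappa^{s,t}\Bigl\{\tfrac12\kappa_{rst}+\kappa_{rs,t}\Bigr\},\qquad j=1,\dots,p.$$ *Matrices.* Let $W_{g}(u)=d\log g(u)/du$ and $\psi_{i(l,k)}=E\bigl(W_{g_i}(r_i)^l\,r_i^k\bigr)$, where $r_i=\|L_i\|^2$ and $L_i\sim El_{q_i}(0,I_{q_i})$ with generator $g_i$. Put $$k_i=\frac{4\psi_{i(2,1)}}{q_i},\quad c_i=\frac{4\psi_{i(2,2)}}{q_i(q_i+2)},\quad c_i^*=\frac{8\psi_{i(3,2)}}{q_i(q_i+2)},\quad \widetilde\omega_i=\frac{\psi_{i(3,3)}}{q_i(q_i+2)(q_i+4)},\quad \eta_{1i}=c_i^*+k_i,\quad \eta_{2i}=c_i^*-k_i.$$ Let $a_{i(r)}=\partial\mu_i/\partial\theta_r$, $C_{i(r)}=\partial\Sigma_i/\partial\theta_r$,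 $\tau_{i(r)}=\mathrm{tr}\{C_{i(r)}\Sigma_i^{-1}\}$, let $\mathrm{vec}$ denote column stacking, and let $$F_i=\begin{pmatrix}a_{i(1)}&\cdots&a_{i(p)}\\ \mathrm{vec}(C_{i(1)})&\cdots&\mathrm{vec}(C_{i(p)})\end{pmatrix},\qquad H_i=\begin{pmatrix}\Sigma_i&0\\0&2\Sigma_i\otimes\Sigma_i\end{pmatrix}^{-1},$$ $$M_i=\begin{pmatrix}k_i\Sigma_i&0\\0&2c_i\Sigma_i\otimes\Sigma_i+(c_i-1)\mathrm{vec}(\Sigma_i)\mathrm{vec}(\Sigma_i)^\top\end{pmatrix},$$ $F=(F_1^\top,\dots,F_n^\top)^\top$, $H=\mathrm{diag}(H_1,\dots,H_n)$ and $M=\mathrm{diag}(M_1^\top,\dots,M_n^\top)$ (block-diagonal), $\widetilde H=HMH$. Further let $$S_{1i(r)}=\mathrm{vec}(\Sigma_i)\mathrm{vec}(C_{i(r)})^\top+\tfrac12\tau_{i(r)}\mathrm{vec}(\Sigma_i)\mathrm{vec}(\Sigma_i)^\top,$$ $$S_{2i(r)}=\mathrm{vec}(C_{i(r)})\mathrm{vec}(\Sigma_i)^\top+\mathrm{vec}(\Sigma_i)\mathrm{vec}(C_{i(r)})^\top+4\,\Sigma_i\otimes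 C_{i(r)}+\tau_{i(r)}\bigl[\Sigma_i\otimes\Sigma_i+\tfrac12\mathrm{vec}(\Sigma_i)\mathrm{vec}(\Sigma_i)^\top\bigr],$$ $$B_{i(r)}=-\frac12\begin{pmatrix}\eta_{1i}C_{i(r)}&2\eta_{1i}\Sigma_i\otimes a_{i(r)}^\top\\2\eta_{2i}\Sigma_i\otimes a_{i(r)}&2(c_i-1)S_{1i(r)}\end{pmatrix}-\frac14\begin{pmatrix}\eta_{1i}\tau_{i(r)}\Sigma_i&2\eta_{1i}a_{i(r)}\mathrm{vec}(\Sigma_i)^\top\\2\eta_{1i}\mathrm{vec}(\Sigma_i)a_{i(r)}^\top&2(c_i+8\widetilde\omega_i)S_{2i(r)}\end{pmatrix},$$ $$\Phi_{i(r)}=-\frac12\Bigl(H_i^{-1}M_i^{-1}B_{i(r)}H_iF_i+\frac{\partial F_i}{\partial\theta_r}\Bigr),\qquad \Phi_r=(\Phi_{1(r)}^\top,\dots,\Phi_{n(r)}^\top)^\top,$$ $$\xi=(\Phi_1,\dots,\Phi_p)\,\mathrm{vec}\bigl((F^\top\widetilde HF)^{-1}\bigr).$$ *Assumptions.* $\theta\in\Theta$;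 $\psi_{i(2,1)},\psi_{i(2,2)},\psi_{i(3,2)},\psi_{i(3,3)}$ exist and are finite for all $i$; $F$ has rank $p$ at $\theta$; and $\ell$ is a regular log-likelihood at $\theta$: there are a neighbourhood $N$ of $\theta$ and a Lebesgue-integrable function $G$ such that, for almost every $y$ and all $\vartheta\in N$, $\ell(\cdot\,;y)$ is three times continuously differentiable at $\vartheta$ and, for all $r,s,t$, the absolute values of $U_r$, $\partial U_r/\partial\theta_s$, $U_rU_s$, $\partial^2U_r/\partial\theta_s\partial\theta_t$, $(\partial U_r/\partial\theta_s)U_t$ and $U_rU_sU_t$ at $(\vartheta,y)$, each multiplied by the likelihood $e^{\ell(\vartheta;y)}$, are at most $G(y)$. *Conclusion.* At $\theta$, every $M_i$ is invertible, $\widetilde H$ and $F^\top\widetilde HF$ are positive definite, and $$B(\theta)=(F^\top\widetilde HF)^{-1}F^\top\widetilde H\,\xi .$$ Thus $B(\theta)$ is the result of a weighted least-squares regression of $\xi$ on $F$ with weights $\widetilde H$: it is the unique minimizer of $b\mapsto(\xi-Fb)^\top\widetilde H(\xi-Fb)$ over $b\in\mathbb R^p$. -/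

import Mathlib

open MeasureTheory Matrix Topology
open scoped Kronecker

noncomputable section

namespace Elliptical

/-- The partial derivative `∂f/∂θ_r` at `θ`. -/
def pderiv {p : ℕ} (r : Fin p) (f : (Fin p → ℝ) → ℝ) (θ : Fin p → ℝ) : ℝ :=
  lineDeriv ℝ f θ (Pi.single r 1)

/-- The density of `El_q(mu, S, g)`: `|S|^{-1/2} g((y - mu)ᵀ S⁻¹ (y - mu))`. -/
def density {q : ℕ} (mu : Fin q → ℝ) (S : Matrix (Fin q) (Fin q) ℝ) (g : ℝ → ℝ)
    (y : Fin q → ℝ) : ℝ :=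
  (Real.sqrt S.det)⁻¹ * g ((y - mu) ⬝ᵥ (S⁻¹ *ᵥ (y - mu)))

/-- The elliptical law `El_q(mu, S, g)` on `ℝ^q`. -/
def law {q : ℕ} (mu : Fin q → ℝ) (S : Matrix (Fin q) (Fin q) ℝ) (g : ℝ → ℝ) :
    Measure (Fin q → ℝ) :=
  volume.withDensity fun y => ENNReal.ofReal (density mu S g y)

/-- `W_g(u) = d log g(u) / du`. -/
def W (g : ℝ → ℝ) (u : ℝ) : ℝ := deriv (fun v => Real.log (g v)) u

/-- `ψ_{(l,k)} = E(W_g(r)^l r^k)` with `r = ‖L‖²` and `L ∼ El_q(0, I_q, g)`. -/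
def psi (q : ℕ) (g : ℝ → ℝ) (l k : ℕ) : ℝ :=
  ∫ x : Fin q → ℝ, W g (x ⬝ᵥ x) ^ l * (x ⬝ᵥ x) ^ k ∂(law 0 1 g)

/-- `ψ_{(l,k)}` exists and is finite. -/
def PsiFinite (q : ℕ) (g : ℝ → ℝ) (l k : ℕ) : Prop :=
  Integrable (fun x : Fin q → ℝ => W g (x ⬝ᵥ x) ^ l * (x ⬝ᵥ x) ^ k) (law 0 1 g)

/-- The general multivariate elliptical model: independent `Y_i ∼ El_{q_i}(μ_i(θ), Σ_i(θ), g_i)`,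
`i = 1, …, n`, with `p` unknown parameters `θ ∈ Θ`.  The nonstochastic covariates are absorbed in
the functions `μ_i` (`loc i`) and `Σ_i` (`scale i`), which are twice differentiable in `θ`. -/
structure Model (n p : ℕ) where
  /-- the dimensions `q_i` of the observations -/
  q : Fin n → ℕ
  q_pos : ∀ i, 0 < q i
  /-- the density generating functions -/
  g : Fin n → ℝ → ℝ
  g_pos : ∀ i, ∀ u, 0 ≤ u → 0 < g i u
  g_diff : ∀ i, DifferentiableOn ℝ (g i) (Set.Ioi 0)
  g_normalized : ∀ i, ∫ x : Fin (q i) → ℝ, g i (x ⬝ᵥ x) = 1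
  /-- the parameter space -/
  Θ : Set (Fin p → ℝ)
  isOpen_Θ : IsOpen Θ
  /-- the location vectors `μ_i(θ)` -/
  loc : ∀ i, (Fin p → ℝ) → Fin (q i) → ℝ
  loc_diff : ∀ i a, DifferentiableOn ℝ (fun θ => loc i θ a) Θ
  loc_diff₂ : ∀ i a r, DifferentiableOn ℝ (pderiv r fun θ => loc i θ a) Θ
  /-- the scale matrices `Σ_i(θ)` -/
  scale : ∀ i, (Fin p → ℝ) → Matrix (Fin (q i)) (Fin (q i)) ℝ
  scale_diff : ∀ i a b, DifferentiableOn ℝ (fun θ => scale i θ a b) Θ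
  scale_diff₂ : ∀ i a b r, DifferentiableOn ℝ (pderiv r fun θ => scale i θ a b) Θ
  scale_posDef : ∀ i, ∀ θ ∈ Θ, (scale i θ).PosDef

namespace Model

variable {n p : ℕ} (m : Model n p)

/-- The sample space: an observation is `y = (y_1, …, y_n)` with `y_i ∈ ℝ^{q_i}`. -/
abbrev Sample : Type := ∀ i : Fin n, Fin (m.q i) → ℝ

/-- The joint law of the independent `Y_1, …, Y_n` under `θ`. -/
def jointLaw (θ : Fin p → ℝ) : Measure m.Sample :=
  Measure.pi fun i => law (m.loc i θ) (m.scale i θ) (m.g i)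

/-- The log-likelihood `ℓ(θ) = ∑_i {-½ log|Σ_i| + log g_i(u_i)}`, with
`u_i = (y_i - μ_i)ᵀ Σ_i⁻¹ (y_i - μ_i)`. -/
def logLik (θ : Fin p → ℝ) (y : m.Sample) : ℝ :=
  ∑ i, (-(1 / 2) * Real.log (m.scale i θ).det +
    Real.log (m.g i ((y i - m.loc i θ) ⬝ᵥ ((m.scale i θ)⁻¹ *ᵥ (y i - m.loc i θ)))))

/-- The score `U_r = ∂ℓ/∂θ_r`. -/
def U (r : Fin p) (θ : Fin p → ℝ) (y : m.Sample) : ℝ :=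
  pderiv r (fun ϑ => m.logLik ϑ y) θ

/-- `∂U_r/∂θ_s`. -/
def U₂ (r s : Fin p) (θ : Fin p → ℝ) (y : m.Sample) : ℝ :=
  pderiv s (fun ϑ => m.U r ϑ y) θ

/-- `∂²U_r/∂θ_s∂θ_t`. -/
def U₃ (r s t : Fin p) (θ : Fin p → ℝ) (y : m.Sample) : ℝ :=
  pderiv s (fun ϑ => m.U₂ r t ϑ y) θ

/-- The log-likelihood is regular at `θ₀`: in a neighbourhood of `θ₀` its first three derivatives
exist and are continuous for almost every `y`, and these derivatives and their products of total
order at most three, times the likelihood `exp ℓ(θ)`, are bounded by one integrable function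
of `y`. -/
def IsRegularAt (θ₀ : Fin p → ℝ) : Prop :=
  ∃ N ∈ 𝓝 θ₀, ∃ G : m.Sample → ℝ, Integrable G volume ∧
    ∀ᵐ y ∂(volume : Measure m.Sample), ∀ θ ∈ N,
      ContDiffAt ℝ 3 (fun ϑ => m.logLik ϑ y) θ ∧
      ∀ r s t : Fin p,
        |m.U r θ y| * Real.exp (m.logLik θ y) ≤ G y ∧
        |m.U₂ r s θ y| * Real.exp (m.logLik θ y) ≤ G y ∧
        |m.U r θ y * m.U s θ y| * Real.exp (m.logLik θ y) ≤ G y ∧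
        |m.U₃ r s t θ y| * Real.exp (m.logLik θ y) ≤ G y ∧
        |m.U₂ r s θ y * m.U t θ y| * Real.exp (m.logLik θ y) ≤ G y ∧
        |m.U r θ y * m.U s θ y * m.U t θ y| * Real.exp (m.logLik θ y) ≤ G y

/-- The Fisher information matrix `K(θ)`, with entries `κ_{r,s} = E(U_r U_s)`. -/
def fisher (θ : Fin p → ℝ) : Matrix (Fin p) (Fin p) ℝ :=
  Matrix.of fun r s => ∫ y, m.U r θ y * m.U s θ y ∂(m.jointLaw θ)

/-- `κ_{rst} = E(∂²U_r/∂θ_s∂θ_t)`. -/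
def kappa₃ (r s t : Fin p) (θ : Fin p → ℝ) : ℝ :=
  ∫ y, m.U₃ r s t θ y ∂(m.jointLaw θ)

/-- `κ_{rs,t} = E(∂U_r/∂θ_s U_t)`. -/
def kappa₂₁ (r s t : Fin p) (θ : Fin p → ℝ) : ℝ :=
  ∫ y, m.U₂ r s θ y * m.U t θ y ∂(m.jointLaw θ)

/-- The Cox–Snell second-order bias of the maximum likelihood estimator:
`B_j(θ) = ∑_{r,s,t} κ^{j,r} κ^{s,t} {½ κ_{rst} + κ_{rs,t}}`, where `(κ^{r,s}) = K(θ)⁻¹`. -/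
def bias (θ : Fin p → ℝ) : Fin p → ℝ := fun j =>
  ∑ r, ∑ s, ∑ t, (m.fisher θ)⁻¹ j r * (m.fisher θ)⁻¹ s t *
    ((1 / 2) * m.kappa₃ r s t θ + m.kappa₂₁ r s t θ)

/-- The rows belonging to an observation of dimension `q`: `q` rows for the location and `q²` rows
for the vectorized scale matrix. -/
abbrev Row (q : ℕ) : Type := Fin q ⊕ (Fin q × Fin q)

/-- `a_{i(r)} = ∂μ_i/∂θ_r`. -/
def a (i : Fin n) (r : Fin p) (θ : Fin p → ℝ) : Fin (m.q i) → ℝ := fun k =>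
  pderiv r (fun ϑ => m.loc i ϑ k) θ

/-- `C_{i(r)} = ∂Σ_i/∂θ_r`. -/
def C (i : Fin n) (r : Fin p) (θ : Fin p → ℝ) : Matrix (Fin (m.q i)) (Fin (m.q i)) ℝ :=
  Matrix.of fun k l => pderiv r (fun ϑ => m.scale i ϑ k l) θ

/-- `F_i`, which stacks `D_i = (a_{i(1)}, …, a_{i(p)})` on
`V_i = (vec C_{i(1)}, …, vec C_{i(p)})`. -/
def Fblock (i : Fin n) (θ : Fin p → ℝ) : Matrix (Row (m.q i)) (Fin p) ℝ :=
  Matrix.of fun k r => Sum.elim (m.a i r θ) (vec (m.C i r θ)) k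

/-- `∂F_i/∂θ_r`, entrywise. -/
def dFblock (i : Fin n) (r : Fin p) (θ : Fin p → ℝ) : Matrix (Row (m.q i)) (Fin p) ℝ :=
  Matrix.of fun k s => pderiv r (fun ϑ => m.Fblock i ϑ k s) θ

/-- `H_i`. -/
def Hblock (i : Fin n) (θ : Fin p → ℝ) : Matrix (Row (m.q i)) (Row (m.q i)) ℝ :=
  (fromBlocks (m.scale i θ) 0 0 ((2 : ℝ) • (m.scale i θ ⊗ₖ m.scale i θ)))⁻¹

/-- `4ψ_{i(2,1)}/q_i`. -/
def k₁ (i : Fin n) : ℝ := 4 * psi (m.q i) (m.g i) 2 1 / m.q i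

/-- `c_i = 4ψ_{i(2,2)}/{q_i(q_i+2)}`. -/
def c (i : Fin n) : ℝ := 4 * psi (m.q i) (m.g i) 2 2 / (m.q i * (m.q i + 2))

/-- `c_i^* = 8ψ_{i(3,2)}/{q_i(q_i+2)}`. -/
def cStar (i : Fin n) : ℝ := 8 * psi (m.q i) (m.g i) 3 2 / (m.q i * (m.q i + 2))

/-- `ω̃_i = ψ_{i(3,3)}/{q_i(q_i+2)(q_i+4)}`. -/
def omega (i : Fin n) : ℝ :=
  psi (m.q i) (m.g i) 3 3 / (m.q i * (m.q i + 2) * (m.q i + 4))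

/-- `η_{1i}`. -/
def eta₁ (i : Fin n) : ℝ := m.cStar i + m.k₁ i

/-- `η_{2i}`. -/
def eta₂ (i : Fin n) : ℝ := m.cStar i - m.k₁ i

/-- `M_i`. -/
def Mblock (i : Fin n) (θ : Fin p → ℝ) : Matrix (Row (m.q i)) (Row (m.q i)) ℝ :=
  fromBlocks (m.k₁ i • m.scale i θ) 0 0 ((2 * m.c i) • (m.scale i θ ⊗ₖ m.scale i θ)) +
  (m.c i - 1) • fromBlocks 0 0 0 (vecMulVec (vec (m.scale i θ)) (vec (m.scale i θ)))

/-- `tr{C_{i(r)} Σ_i⁻¹}`. -/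
def tr (i : Fin n) (r : Fin p) (θ : Fin p → ℝ) : ℝ := (m.C i r θ * (m.scale i θ)⁻¹).trace

/-- `S_{1i(r)}`. -/
def S₁ (i : Fin n) (r : Fin p) (θ : Fin p → ℝ) :
    Matrix (Fin (m.q i) × Fin (m.q i)) (Fin (m.q i) × Fin (m.q i)) ℝ :=
  vecMulVec (vec (m.scale i θ)) (vec (m.C i r θ)) +
  ((1 / 2) * m.tr i r θ) • vecMulVec (vec (m.scale i θ)) (vec (m.scale i θ))

/-- `S_{2i(r)}`. -/
def S₂ (i : Fin n) (r : Fin p) (θ : Fin p → ℝ) :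
    Matrix (Fin (m.q i) × Fin (m.q i)) (Fin (m.q i) × Fin (m.q i)) ℝ :=
  vecMulVec (vec (m.C i r θ)) (vec (m.scale i θ)) +
  vecMulVec (vec (m.scale i θ)) (vec (m.C i r θ)) +
  (4 : ℝ) • (m.scale i θ ⊗ₖ m.C i r θ) +
  m.tr i r θ • (m.scale i θ ⊗ₖ m.scale i θ +
    (1 / 2 : ℝ) • vecMulVec (vec (m.scale i θ)) (vec (m.scale i θ)))

/-- The Kronecker product `A ⊗ v` of a matrix and a column vector, of size `q² × q`. -/
def kronCol {q : ℕ} (A : Matrix (Fin q) (Fin q) ℝ) (v : Fin q → ℝ) :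
    Matrix (Fin q × Fin q) (Fin q) ℝ :=
  Matrix.of fun jk l => A jk.1 l * v jk.2

/-- The Kronecker product `A ⊗ vᵀ` of a matrix and a row vector, of size `q × q²`. -/
def kronRow {q : ℕ} (A : Matrix (Fin q) (Fin q) ℝ) (v : Fin q → ℝ) :
    Matrix (Fin q) (Fin q × Fin q) ℝ :=
  Matrix.of fun l jk => A l jk.1 * v jk.2

/-- `B_{i(r)}`. -/
def Bblock (i : Fin n) (r : Fin p) (θ : Fin p → ℝ) : Matrix (Row (m.q i)) (Row (m.q i)) ℝ :=
  -((1 / 2 : ℝ) • fromBlocks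
      (m.eta₁ i • m.C i r θ)
      ((2 * m.eta₁ i) • kronRow (m.scale i θ) (m.a i r θ))
      ((2 * m.eta₂ i) • kronCol (m.scale i θ) (m.a i r θ))
      ((2 * (m.c i - 1)) • m.S₁ i r θ)) -
  (1 / 4 : ℝ) • fromBlocks
      ((m.eta₁ i * m.tr i r θ) • m.scale i θ)
      ((2 * m.eta₁ i) • vecMulVec (m.a i r θ) (vec (m.scale i θ)))
      ((2 * m.eta₁ i) • vecMulVec (vec (m.scale i θ)) (m.a i r θ))
      ((2 * (m.c i + 8 * m.omega i)) • m.S₂ i r θ)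

/-- `Φ_{i(r)} = -½ (H_i⁻¹ M_i⁻¹ B_{i(r)} H_i F_i + ∂F_i/∂θ_r)`. -/
def PhiBlock (i : Fin n) (r : Fin p) (θ : Fin p → ℝ) : Matrix (Row (m.q i)) (Fin p) ℝ :=
  -((1 / 2 : ℝ) • ((m.Hblock i θ)⁻¹ * (m.Mblock i θ)⁻¹ * m.Bblock i r θ * m.Hblock i θ *
    m.Fblock i θ + m.dFblock i r θ))

/-- The rows of the stacked regression. -/
abbrev Rows : Type := Σ i : Fin n, Row (m.q i)

/-- `F = (F_1ᵀ, …, F_nᵀ)ᵀ`. -/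
def F (θ : Fin p → ℝ) : Matrix m.Rows (Fin p) ℝ :=
  Matrix.of fun k r => m.Fblock k.1 θ k.2 r

/-- `H = block-diag{H_1, …, H_n}`. -/
def H (θ : Fin p → ℝ) : Matrix m.Rows m.Rows ℝ := blockDiagonal' fun i => m.Hblock i θ

/-- `M = block-diag{M_1ᵀ, …, M_nᵀ}`. -/
def M (θ : Fin p → ℝ) : Matrix m.Rows m.Rows ℝ := blockDiagonal' fun i => (m.Mblock i θ)ᵀ

/-- `H̃ = H M H`. -/
def Htilde (θ : Fin p → ℝ) : Matrix m.Rows m.Rows ℝ := m.H θ * m.M θ * m.H θ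

/-- `(Φ_1, …, Φ_p)` with `Φ_r = (Φ_{1(r)}ᵀ, …, Φ_{n(r)}ᵀ)ᵀ`; the column `(r, s)` is the column `s`
of `Φ_r`. -/
def Phi (θ : Fin p → ℝ) : Matrix m.Rows (Fin p × Fin p) ℝ :=
  Matrix.of fun k rs => m.PhiBlock k.1 rs.1 θ k.2 rs.2

/-- `ξ = (Φ_1, …, Φ_p) vec((Fᵀ H̃ F)⁻¹)`. -/
def xi (θ : Fin p → ℝ) : m.Rows → ℝ :=
  m.Phi θ *ᵥ vec (((m.F θ)ᵀ * m.Htilde θ * m.F θ)⁻¹)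

/-- The weighted sum of squares `(ξ - F b)ᵀ H̃ (ξ - F b)` of the regression of `ξ` on `F` with
weights `H̃`. -/
def wss (θ : Fin p → ℝ) (b : Fin p → ℝ) : ℝ :=
  (m.xi θ - m.F θ *ᵥ b) ⬝ᵥ (m.Htilde θ *ᵥ (m.xi θ - m.F θ *ᵥ b))

end Model

end Elliptical

end

/-! Since `K⁻¹` is symmetric, the bias sees the Cox–Snell coefficients `½κ_{jst} + κ_{js,t}` only
through their symmetrization in `(s, t)`. Differentiating `∫ U_j U_t e^ℓ` and the second Bartlett
identity under the integral sign (`regular_identities`) turns that symmetrization into `-½(∂_s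
κ_{j,t} + ∂_t κ_{j,s} - ∂_j κ_{s,t} + E(U_j U_s U_t))`. Hence no expectation of a second or third
derivative of `ℓ` is ever computed: the information near `θ` and the third moment of the score
suffice, and in these `g` enters only through `W_g`.

Both are computed in whitened coordinates `y_i = μ_i + A_i x_i`, `A_i A_iᵀ = Σ_i`, where `x_i` has a
rotation-invariant law. The score of one observation becomes an odd part, linear in `x` up to the
weight `W`, plus an even part containing a quadratic form. Rotation invariance gives Wick-type
formulas for weighted moments of products of up to three quadratic forms (`integral_qf_mul_rec`,
`integral_qf_qf_qf`), odd products integrate to zero, and independence with zero means leaves only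
diagonal sums over observations. This yields `fisher_eq` and `integral_U_mul_U_mul_U`.

Positivity rests on `ψ_(1,1) = -q/2`, an integration by parts in the logarithm of the radius, and on
the strict inequality `ψ_(2,2) > q²/4`. The latter is Cauchy–Schwarz; equality would make `r^{q/2}
g(r)` constant, and then `g(‖x‖²)` would not be integrable. It says `c(q+2) > q`, exactly what makes
`M_i` positive definite despite the possibly negative coefficient `c - 1`
(`posDef_fromBlocks_kronecker`).

The rest is algebra. `Fᵀ H̃ F` is the Fisher information. In `Fᵀ H̃ Φ` the factor `H⁻¹M⁻¹` of `Φ`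
cancels against the weights, leaving `B_{i(r)}` between two copies of `H_i F_i` and an information
form in the second derivatives of `μ_i`, `Σ_i`. `scoreForm_add_comm` shows that the symmetrization
of these entries agrees with the Cox–Snell one. So the bias solves the normal equations, and
positive definiteness gives the unique minimizer. -/

noncomputable section

namespace Elliptical

/-! ### Quadratic forms and their bounds by the squared norm. -/

section QuadraticForms

variable {q : ℕ}

/-- The quadratic form `xᵀ A x`. -/
def qf (A : Matrix (Fin q) (Fin q) ℝ) (x : Fin q → ℝ) : ℝ := x ⬝ᵥ (A *ᵥ x)

theorem qf_eq_sum (A : Matrix (Fin q) (Fin q) ℝ) (x : Fin q → ℝ) :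
    qf A x = ∑ i, ∑ j, A i j * (x i * x j) := by
  simp only [qf, dotProduct, mulVec, Finset.mul_sum]
  exact Finset.sum_congr rfl fun i _ => Finset.sum_congr rfl fun j _ => by ring

theorem qf_one (x : Fin q → ℝ) : qf 1 x = x ⬝ᵥ x := by simp [qf]

theorem qf_transpose (A : Matrix (Fin q) (Fin q) ℝ) (x : Fin q → ℝ) : qf Aᵀ x = qf A x := by
  rw [qf, qf, dotProduct_mulVec, vecMul_transpose, dotProduct_comm]

theorem qf_vecMulVec (u v x : Fin q → ℝ) : qf (vecMulVec u v) x = (u ⬝ᵥ x) * (v ⬝ᵥ x) := by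
  simp [qf, vecMulVec_mulVec, dotProduct_comm x u]
  ring

theorem qf_neg_arg (A : Matrix (Fin q) (Fin q) ℝ) (x : Fin q → ℝ) : qf A (-x) = qf A x := by
  simp [qf, mulVec_neg]

theorem continuous_qf (A : Matrix (Fin q) (Fin q) ℝ) : Continuous (qf A) := by
  unfold qf; fun_prop

theorem abs_mul_le_dotProduct_self (x : Fin q → ℝ) (i j : Fin q) : |x i * x j| ≤ x ⬝ᵥ x := by
  have h : ∀ k, x k ^ 2 ≤ x ⬝ᵥ x := fun k => by
    rw [dotProduct, pow_two]
    exact Finset.single_le_sum (f := fun k => x k * x k)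
      (fun l _ => mul_self_nonneg _) (Finset.mem_univ k)
  rw [abs_mul]
  nlinarith [h i, h j, sq_abs (x i), sq_abs (x j), sq_nonneg (|x i| - |x j|)]

theorem dotProduct_self_nonneg' (x : Fin q → ℝ) : 0 ≤ x ⬝ᵥ x :=
  Finset.sum_nonneg fun _ _ => mul_self_nonneg _

theorem abs_qf_le (A : Matrix (Fin q) (Fin q) ℝ) (x : Fin q → ℝ) :
    |qf A x| ≤ (∑ i, ∑ j, |A i j|) * (x ⬝ᵥ x) := by
  rw [qf_eq_sum, Finset.sum_mul]
  refine (Finset.abs_sum_le_sum_abs _ _).trans (Finset.sum_le_sum fun i _ => ?_)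
  rw [Finset.sum_mul]
  refine (Finset.abs_sum_le_sum_abs _ _).trans (Finset.sum_le_sum fun j _ => ?_)
  rw [abs_mul]
  exact mul_le_mul_of_nonneg_left (abs_mul_le_dotProduct_self x i j) (abs_nonneg _)

theorem hasDerivAt_qf (A : Matrix (Fin q) (Fin q) ℝ) {y : ℝ → Fin q → ℝ} {y' : Fin q → ℝ} {t : ℝ}
    (hy : ∀ i, HasDerivAt (fun s => y s i) (y' i) t) :
    HasDerivAt (fun s => qf A (y s)) (y' ⬝ᵥ (A *ᵥ y t) + y t ⬝ᵥ (A *ᵥ y')) t := by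
  simp only [qf, dotProduct, mulVec]
  rw [← Finset.sum_add_distrib]
  exact HasDerivAt.fun_sum fun i _ =>
    (hy i).mul (HasDerivAt.fun_sum fun j _ => (hy j).const_mul (A i j))

end QuadraticForms

/-! ### Integration by parts along rotations. -/

section Rotations

variable {q : ℕ}

/-- Invariance of a measure on `ℝ^q` under the orthogonal group. -/
def RotationInvariant (ν : Measure (Fin q → ℝ)) : Prop :=
  ∀ R : Matrix (Fin q) (Fin q) ℝ, Rᵀ * R = 1 → MeasurePreserving (fun x => R *ᵥ x) ν ν

/-- The one-parameter group generated by a matrix `J` with `J³ = -J`. -/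
def rot (J : Matrix (Fin q) (Fin q) ℝ) (t : ℝ) : Matrix (Fin q) (Fin q) ℝ :=
  1 + Real.sin t • J + (1 - Real.cos t) • (J * J)

/-- When `J³ = -J` the exponential series of `tJ` collapses to `rot J t`. In the product every power
of `J` reduces to `J` or `J²`; the `J` terms cancel and the coefficient of `J²` vanishes because
`sin² + cos² = 1`. -/
theorem rot_transpose_mul_self {J : Matrix (Fin q) (Fin q) ℝ} (hT : Jᵀ = -J)
    (hJ : J * J * J = -J) (t : ℝ) : (rot J t)ᵀ * rot J t = 1 := by
  have h4 : J * J * (J * J) = -(J * J) := by rw [← Matrix.mul_assoc, hJ, Matrix.neg_mul]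
  have h3 : J * (J * J) = -J := by rw [← Matrix.mul_assoc, hJ]
  simp only [rot, transpose_add, transpose_smul, transpose_mul, transpose_one, hT, Matrix.add_mul,
    Matrix.mul_add, Matrix.smul_mul, Matrix.mul_smul, Matrix.neg_mul, Matrix.mul_neg, neg_neg,
    Matrix.one_mul, Matrix.mul_one, hJ, h3, h4]
  have := Real.sin_sq_add_cos_sq t
  ext a b
  simp only [Matrix.add_apply, Matrix.smul_apply, Matrix.neg_apply, smul_eq_mul]
  linear_combination -(J * J) a b * this

theorem hasDerivAt_rot_mulVec {J : Matrix (Fin q) (Fin q) ℝ}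
    (hJ : J * J * J = -J) (x : Fin q → ℝ) (t : ℝ) (i : Fin q) :
    HasDerivAt (fun s => (rot J s *ᵥ x) i) ((J *ᵥ (rot J t *ᵥ x)) i) t := by
  have h3 : J * (J * J) = -J := by rw [← Matrix.mul_assoc, hJ]
  have e : ∀ s, (rot J s *ᵥ x) i
      = x i + Real.sin s * (J *ᵥ x) i + (1 - Real.cos s) * ((J * J) *ᵥ x) i := fun s => by
    simp [rot, add_mulVec, smul_mulVec]
  have e' : (J *ᵥ (rot J t *ᵥ x)) i
      = Real.cos t * (J *ᵥ x) i + Real.sin t * ((J * J) *ᵥ x) i := by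
    rw [mulVec_mulVec, rot]
    simp only [Matrix.mul_add, Matrix.mul_smul, h3, Matrix.mul_one, add_mulVec, smul_mulVec,
      neg_mulVec, Pi.add_apply, Pi.smul_apply, Pi.neg_apply, smul_eq_mul]
    ring
  simp only [e, e']
  have h := (((Real.hasDerivAt_sin t).mul_const ((J *ᵥ x) i)).const_add (x i)).add
    (((Real.hasDerivAt_cos t).const_sub 1).mul_const (((J * J) *ᵥ x) i))
  exact h.congr_deriv (by ring)

/-- The infinitesimal action of `J` on a quadratic form. -/
def rotDeriv (J A : Matrix (Fin q) (Fin q) ℝ) : Matrix (Fin q) (Fin q) ℝ := Jᵀ * A + A * J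

theorem qf_rotDeriv (J A : Matrix (Fin q) (Fin q) ℝ) (x : Fin q → ℝ) :
    qf (rotDeriv J A) x = (J *ᵥ x) ⬝ᵥ (A *ᵥ x) + x ⬝ᵥ (A *ᵥ (J *ᵥ x)) := by
  simp only [qf, rotDeriv, add_mulVec, dotProduct_add, ← mulVec_mulVec]
  congr 1
  rw [dotProduct_mulVec, vecMul_transpose]

/-- Each form is at most a constant times `r = x ⬝ᵥ x`, so the moment of order `r³` dominates. -/
theorem integrable_qf_mul (ν : Measure (Fin q → ℝ)) {w : ℝ → ℝ} (hw : Measurable w)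
    (hi : Integrable (fun x : Fin q → ℝ => w (x ⬝ᵥ x) * (x ⬝ᵥ x) ^ 3) ν)
    (A B C : Matrix (Fin q) (Fin q) ℝ) :
    Integrable (fun x : Fin q → ℝ => w (x ⬝ᵥ x) * (qf A x * qf B x * qf C x)) ν := by
  set a := ∑ i, ∑ j, |A i j|
  set b := ∑ i, ∑ j, |B i j|
  set c := ∑ i, ∑ j, |C i j|
  refine (hi.norm.const_mul (a * b * c)).mono' ?_ (Filter.Eventually.of_forall fun x => ?_)
  · refine AEStronglyMeasurable.mul ?_ ?_
    · exact (hw.comp (by unfold dotProduct; fun_prop)).aestronglyMeasurable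
    · exact (((continuous_qf A).mul (continuous_qf B)).mul (continuous_qf C)).aestronglyMeasurable
  · have hr := dotProduct_self_nonneg' x
    have hA := abs_qf_le A x
    have hB := abs_qf_le B x
    have hC := abs_qf_le C x
    simp only [Real.norm_eq_abs, abs_mul, abs_pow, abs_of_nonneg hr]
    have : |qf A x| * |qf B x| * |qf C x| ≤ (a * (x ⬝ᵥ x)) * (b * (x ⬝ᵥ x)) * (c * (x ⬝ᵥ x)) := by
      gcongr
    calc |w (x ⬝ᵥ x)| * (|qf A x| * |qf B x| * |qf C x|)
        ≤ |w (x ⬝ᵥ x)| * ((a * (x ⬝ᵥ x)) * (b * (x ⬝ᵥ x)) * (c * (x ⬝ᵥ x))) := by gcongr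
      _ = _ := by ring

/-- Invariance makes `t ↦ ∫ f(rot J t x) dν` constant. Its derivative at `0` is the integral of the
product rule for the three forms; the weight is not differentiated because it depends only on the
invariant `x ⬝ᵥ x`, so no regularity of `w` beyond measurability is needed. -/
theorem integral_rotDeriv_eq_zero {ν : Measure (Fin q → ℝ)} (hν : RotationInvariant ν) {w : ℝ → ℝ}
    (hw : Measurable w)
    (hi : Integrable (fun x : Fin q → ℝ => w (x ⬝ᵥ x) * (x ⬝ᵥ x) ^ 3) ν)
    {J : Matrix (Fin q) (Fin q) ℝ} (hT : Jᵀ = -J) (hJ : J * J * J = -J)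
    (A B C : Matrix (Fin q) (Fin q) ℝ) :
    ∫ x, w (x ⬝ᵥ x) * (qf (rotDeriv J A) x * qf B x * qf C x) + w (x ⬝ᵥ x) * (qf A x * qf (rotDeriv J B) x
      * qf C x) + w (x ⬝ᵥ x) * (qf A x * qf B x * qf (rotDeriv J C) x) ∂ν = 0 := by
  set f : (Fin q → ℝ) → ℝ := fun x => w (x ⬝ᵥ x) * (qf A x * qf B x * qf C x) with hf
  set f' : (Fin q → ℝ) → ℝ := fun x =>
    w (x ⬝ᵥ x) * (qf (rotDeriv J A) x * qf B x * qf C x) + w (x ⬝ᵥ x) * (qf A x * qf (rotDeriv J B) x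
      * qf C x) + w (x ⬝ᵥ x) * (qf A x * qf B x * qf (rotDeriv J C) x) with hf'
  have hrr : ∀ t x, (rot J t *ᵥ x) ⬝ᵥ (rot J t *ᵥ x) = x ⬝ᵥ x := fun t x => by
    rw [dotProduct_mulVec, ← mulVec_transpose, mulVec_mulVec, rot_transpose_mul_self hT hJ,
      one_mulVec]
  have hmp : ∀ t, MeasurePreserving (fun x => rot J t *ᵥ x) ν ν := fun t =>
    hν _ (rot_transpose_mul_self hT hJ t)
  have hfi : Integrable f ν := integrable_qf_mul ν hw hi A B C
  have hfi' : Integrable f' ν := ((integrable_qf_mul ν hw hi _ B C).add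
    (integrable_qf_mul ν hw hi A _ C)).add (integrable_qf_mul ν hw hi A B _)
  have hconst : ∀ t, ∫ x, f (rot J t *ᵥ x) ∂ν = ∫ x, f x ∂ν := fun t => by
    have h1 := integral_map (hmp t).measurable.aemeasurable
      (f := f) (by rw [(hmp t).map_eq]; exact hfi.aestronglyMeasurable)
    rw [(hmp t).map_eq] at h1
    exact h1.symm
  -- The derivative is again a sum of weighted products of three forms. The bound depends on `x`
  -- only through `x ⬝ᵥ x`, so it holds along a whole rotation orbit with one dominating function.
  obtain ⟨K, hK⟩ : ∃ K : ℝ, ∀ x, |f' x| ≤ K * |w (x ⬝ᵥ x) * (x ⬝ᵥ x) ^ 3| := by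
    have key : ∀ A B C : Matrix (Fin q) (Fin q) ℝ, ∃ K : ℝ, ∀ x,
        |w (x ⬝ᵥ x) * (qf A x * qf B x * qf C x)| ≤ K * |w (x ⬝ᵥ x) * (x ⬝ᵥ x) ^ 3| := by
      intro A B C
      refine ⟨(∑ i, ∑ j, |A i j|) * (∑ i, ∑ j, |B i j|) * (∑ i, ∑ j, |C i j|), fun x => ?_⟩
      have hr := dotProduct_self_nonneg' x
      have hA := abs_qf_le A x
      have hB := abs_qf_le B x
      have hC := abs_qf_le C x
      set a := ∑ i, ∑ j, |A i j|
      set b := ∑ i, ∑ j, |B i j|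
      set c := ∑ i, ∑ j, |C i j|
      simp only [abs_mul, abs_pow, abs_of_nonneg hr]
      calc |w (x ⬝ᵥ x)| * (|qf A x| * |qf B x| * |qf C x|)
          ≤ |w (x ⬝ᵥ x)| * ((a * (x ⬝ᵥ x)) * (b * (x ⬝ᵥ x)) * (c * (x ⬝ᵥ x))) := by gcongr
        _ = _ := by ring
    obtain ⟨K₁, h₁⟩ := key (rotDeriv J A) B C
    obtain ⟨K₂, h₂⟩ := key A (rotDeriv J B) C
    obtain ⟨K₃, h₃⟩ := key A B (rotDeriv J C)
    refine ⟨K₁ + K₂ + K₃, fun x => ?_⟩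
    rw [add_mul, add_mul]
    exact (abs_add_le _ _).trans (add_le_add ((abs_add_le _ _).trans (add_le_add (h₁ x) (h₂ x)))
      (h₃ x))
  have hD := (hasDerivAt_integral_of_dominated_loc_of_deriv_le (μ := ν) (x₀ := (0 : ℝ))
    (s := Set.univ) (F := fun t x => f (rot J t *ᵥ x)) (F' := fun t x => f' (rot J t *ᵥ x))
    (bound := fun x => K * |w (x ⬝ᵥ x) * (x ⬝ᵥ x) ^ 3|) Filter.univ_mem
    (Filter.Eventually.of_forall fun t =>
      ((hmp t).integrable_comp hfi.aestronglyMeasurable).2 hfi |>.aestronglyMeasurable)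
    (((hmp 0).integrable_comp hfi.aestronglyMeasurable).2 hfi)
    (((hmp 0).integrable_comp hfi'.aestronglyMeasurable).2 hfi' |>.aestronglyMeasurable)
    (Filter.Eventually.of_forall fun x t _ => by
      have := hK (rot J t *ᵥ x)
      rwa [hrr] at this)
    (hi.abs.const_mul K)
    (Filter.Eventually.of_forall fun x t _ => by
      have hd : ∀ A, HasDerivAt (fun s => qf A (rot J s *ᵥ x)) (qf (rotDeriv J A) (rot J t *ᵥ x)) t :=
        fun A => by
          rw [qf_rotDeriv]; exact hasDerivAt_qf A fun i => hasDerivAt_rot_mulVec hJ x t i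
      simp only [hf, hf', hrr]
      refine ((((hd A).mul (hd B)).mul (hd C)).const_mul (w (x ⬝ᵥ x))).congr_deriv ?_
      simp only [Pi.mul_apply]; ring)).2
  simp only [hconst] at hD
  have h0 := hD.unique (hasDerivAt_const _ _)
  simpa [rot] using h0

/-- The generator of the rotations in the plane of `e_i` and `e_j`. -/
def planeGen (i j : Fin q) : Matrix (Fin q) (Fin q) ℝ :=
  vecMulVec (Pi.single j 1) (Pi.single i 1) - vecMulVec (Pi.single i 1) (Pi.single j 1)

theorem planeGen_mulVec (i j : Fin q) (x : Fin q → ℝ) :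
    planeGen i j *ᵥ x = x i • Pi.single j 1 - x j • Pi.single i 1 := by
  simp [planeGen, sub_mulVec, vecMulVec_mulVec]

theorem planeGen_transpose (i j : Fin q) : (planeGen i j)ᵀ = -planeGen i j := by
  simp [planeGen, transpose_vecMulVec]

theorem planeGen_cube (i j : Fin q) :
    planeGen i j * planeGen i j * planeGen i j = -planeGen i j := by
  by_cases h : i = j
  · subst h; simp [planeGen]
  · refine Matrix.ext_iff_mulVec.2 fun x => ?_
    simp only [← mulVec_mulVec, neg_mulVec, planeGen_mulVec]
    simp [h, Ne.symm h]
    abel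

/-- The forms `x_j (Γx)_i` are chosen so that, when each is differentiated along the rotation of the
plane `(i, j)` and all are summed, `Γ` comes back together with its trace. -/
theorem sum_qf_rotDeriv_self (Γ : Matrix (Fin q) (Fin q) ℝ) (x : Fin q → ℝ) :
    ∑ i, ∑ j, qf (rotDeriv (planeGen i j) (vecMulVec (Pi.single j 1) (Γ i))) x
      = q * qf Γ x - Γ.trace * (x ⬝ᵥ x) := by
  have h : ∀ i j, qf (rotDeriv (planeGen i j) (vecMulVec (Pi.single j 1) (Γ i))) x
      = x i * (Γ *ᵥ x) i - (if i = j then x j * (Γ *ᵥ x) i else 0) + x i * (Γ i j * x j)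
        - Γ i i * (x j * x j) := fun i j => by
    rw [qf_rotDeriv, planeGen_mulVec, vecMulVec_mulVec, vecMulVec_mulVec]
    have : Γ i ⬝ᵥ x = (Γ *ᵥ x) i := rfl
    simp only [this, dotProduct_sub, dotProduct_smul, dotProduct_single, Pi.smul_apply,
      smul_eq_mul, Pi.sub_apply, Pi.single_eq_same, mul_one]
    by_cases hij : i = j
    · subst hij; simp; ring
    · simp [hij, Ne.symm hij]; ring
  simp only [h, Finset.sum_sub_distrib, Finset.sum_add_distrib, Finset.sum_const, Finset.card_univ,
    Fintype.card_fin, Finset.sum_ite_eq, Finset.mem_univ, if_true, ← Finset.mul_sum,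
    ← Finset.sum_mul, nsmul_eq_mul]
  simp only [qf, dotProduct, mulVec, trace, diag_apply]
  ring

/-- For symmetric `B`, the rotation of the plane `(i, j)` differentiates `xᵀBx` into `2(x_i (Bx)_j -
x_j (Bx)_i)`. Multiplying by `x_j (Γx)_i` and summing contracts the indices. -/
theorem sum_qf_rotDeriv_other (Γ : Matrix (Fin q) (Fin q) ℝ) {B : Matrix (Fin q) (Fin q) ℝ}
    (hB : B.IsSymm) (x : Fin q → ℝ) :
    ∑ i, ∑ j, qf (vecMulVec (Pi.single j 1) (Γ i)) x * qf (rotDeriv (planeGen i j) B) x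
      = 2 * (qf Γ x * qf B x - (x ⬝ᵥ x) * qf (Γᵀ * B) x) := by
  have h : ∀ i j, qf (vecMulVec (Pi.single j 1) (Γ i)) x * qf (rotDeriv (planeGen i j) B) x
      = 2 * ((x i * (Γ *ᵥ x) i) * (x j * (B *ᵥ x) j)
        - ((Γ *ᵥ x) i * (B *ᵥ x) i) * (x j * x j)) := fun i j => by
    rw [qf_rotDeriv, planeGen_mulVec, qf_vecMulVec, dotProduct_mulVec x B, ← mulVec_transpose, hB.eq]
    have : Γ i ⬝ᵥ x = (Γ *ᵥ x) i := rfl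
    simp only [this, sub_dotProduct, smul_dotProduct, dotProduct_sub, dotProduct_smul,
      single_dotProduct, dotProduct_single, smul_eq_mul]
    ring
  have e : qf (Γᵀ * B) x = (Γ *ᵥ x) ⬝ᵥ (B *ᵥ x) := by
    rw [qf, ← mulVec_mulVec, dotProduct_mulVec, vecMul_transpose]
  rw [e]
  simp only [h, ← Finset.mul_sum, Finset.sum_sub_distrib, ← Finset.sum_mul]
  simp only [qf, dotProduct]
  ring

/-- The Wick recursion on spheres: `Γ` is replaced either by its trace or by a contraction with one
of the other forms, and a factor `qf 1` takes its place. It is the sum over all coordinate planes of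
`integral_rotDeriv_eq_zero`. In the constant `q + 4`, `q` comes from `Γ` itself and `2` from each
other form. -/
theorem integral_qf_mul_rec {ν : Measure (Fin q → ℝ)} (hν : RotationInvariant ν) {w : ℝ → ℝ}
    (hw : Measurable w)
    (hi : Integrable (fun x : Fin q → ℝ => w (x ⬝ᵥ x) * (x ⬝ᵥ x) ^ 3) ν)
    (Γ : Matrix (Fin q) (Fin q) ℝ) {B C : Matrix (Fin q) (Fin q) ℝ}
    (hB : B.IsSymm) (hC : C.IsSymm) :
    (q + 4) * ∫ x, w (x ⬝ᵥ x) * (qf Γ x * qf B x * qf C x) ∂ν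
      = Γ.trace * ∫ x, w (x ⬝ᵥ x) * (qf 1 x * qf B x * qf C x) ∂ν
        + 2 * ∫ x, w (x ⬝ᵥ x) * (qf 1 x * qf (Γᵀ * B) x * qf C x) ∂ν
        + 2 * ∫ x, w (x ⬝ᵥ x) * (qf 1 x * qf B x * qf (Γᵀ * C) x) ∂ν := by
  have hI := integrable_qf_mul ν hw hi
  have h0 : ∑ i, ∑ j, ∫ x, w (x ⬝ᵥ x) *
        (qf (rotDeriv (planeGen i j) (vecMulVec (Pi.single j 1) (Γ i))) x * qf B x * qf C x)
      + w (x ⬝ᵥ x) * (qf (vecMulVec (Pi.single j 1) (Γ i)) x * qf (rotDeriv (planeGen i j) B) x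
        * qf C x)
      + w (x ⬝ᵥ x) * (qf (vecMulVec (Pi.single j 1) (Γ i)) x * qf B x
        * qf (rotDeriv (planeGen i j) C) x) ∂ν = 0 :=
    Finset.sum_eq_zero fun i _ => Finset.sum_eq_zero fun j _ =>
      integral_rotDeriv_eq_zero hν hw hi (planeGen_transpose i j) (planeGen_cube i j) _ B C
  have hJ : ∀ i j, Integrable (fun x => w (x ⬝ᵥ x) *
        (qf (rotDeriv (planeGen i j) (vecMulVec (Pi.single j 1) (Γ i))) x * qf B x * qf C x)
      + w (x ⬝ᵥ x) * (qf (vecMulVec (Pi.single j 1) (Γ i)) x * qf (rotDeriv (planeGen i j) B) x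
        * qf C x)
      + w (x ⬝ᵥ x) * (qf (vecMulVec (Pi.single j 1) (Γ i)) x * qf B x
        * qf (rotDeriv (planeGen i j) C) x)) ν := fun i j =>
    ((hI _ _ _).add (hI _ _ _)).add (hI _ _ _)
  simp_rw [← integral_finsetSum _ fun j _ => hJ _ j] at h0
  rw [← integral_finsetSum _ fun i _ => integrable_finsetSum _ fun j _ => hJ i j] at h0
  have key : ∫ x, ((q + 4) * (w (x ⬝ᵥ x) * (qf Γ x * qf B x * qf C x))
      + -Γ.trace * (w (x ⬝ᵥ x) * (qf 1 x * qf B x * qf C x)))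
      + ((-2) * (w (x ⬝ᵥ x) * (qf 1 x * qf (Γᵀ * B) x * qf C x))
      + (-2) * (w (x ⬝ᵥ x) * (qf 1 x * qf B x * qf (Γᵀ * C) x))) ∂ν = 0 := by
    rw [← h0]
    refine integral_congr_ae (Filter.Eventually.of_forall fun x => ?_)
    have h1 := sum_qf_rotDeriv_self Γ x
    have h2 := sum_qf_rotDeriv_other Γ hB x
    have h3 := sum_qf_rotDeriv_other Γ hC x
    have e : ∀ i j, w (x ⬝ᵥ x) *
          (qf (rotDeriv (planeGen i j) (vecMulVec (Pi.single j 1) (Γ i))) x * qf B x * qf C x)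
        + w (x ⬝ᵥ x) * (qf (vecMulVec (Pi.single j 1) (Γ i)) x * qf (rotDeriv (planeGen i j) B) x
          * qf C x)
        + w (x ⬝ᵥ x) * (qf (vecMulVec (Pi.single j 1) (Γ i)) x * qf B x
          * qf (rotDeriv (planeGen i j) C) x)
        = w (x ⬝ᵥ x) * qf B x * qf C x *
            qf (rotDeriv (planeGen i j) (vecMulVec (Pi.single j 1) (Γ i))) x
          + w (x ⬝ᵥ x) * qf C x * (qf (vecMulVec (Pi.single j 1) (Γ i)) x *
            qf (rotDeriv (planeGen i j) B) x)
          + w (x ⬝ᵥ x) * qf B x * (qf (vecMulVec (Pi.single j 1) (Γ i)) x *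
            qf (rotDeriv (planeGen i j) C) x) := fun i j => by ring
    simp only [e, Finset.sum_add_distrib, ← Finset.mul_sum, h1, h2, h3, qf_one]
    ring
  rw [integral_add (by exact ((hI _ _ _).const_mul _).add ((hI _ _ _).const_mul _))
      (by exact ((hI _ _ _).const_mul _).add ((hI _ _ _).const_mul _)),
    integral_add ((hI _ _ _).const_mul _) ((hI _ _ _).const_mul _),
    integral_add ((hI _ _ _).const_mul _) ((hI _ _ _).const_mul _)] at key
  simp only [integral_const_mul] at key
  linarith

/-! ### Weighted moments of one, two and three quadratic forms. -/

section Moments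

variable {ν : Measure (Fin q → ℝ)} {w : ℝ → ℝ}

/-- Lets one form be traded for a factor `1/r` in the weight, so that moments of fewer forms are
instances of the three-form case. At `x = 0` the convention for division by zero is harmless because
both sides vanish. -/
theorem div_mul_qf_one (w : ℝ → ℝ) (A : Matrix (Fin q) (Fin q) ℝ) (x : Fin q → ℝ) :
    w (x ⬝ᵥ x) / (x ⬝ᵥ x) * (qf 1 x * qf A x) = w (x ⬝ᵥ x) * qf A x := by
  rw [qf_one]
  by_cases h : x ⬝ᵥ x = 0
  · have : x = 0 := dotProduct_self_eq_zero.1 h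
    simp [this, qf]
  · field_simp

theorem integrable_qf_qf (hw : Measurable w)
    (hi : Integrable (fun x : Fin q → ℝ => w (x ⬝ᵥ x) * (x ⬝ᵥ x) ^ 2) ν)
    (A B : Matrix (Fin q) (Fin q) ℝ) :
    Integrable (fun x : Fin q → ℝ => w (x ⬝ᵥ x) * (qf A x * qf B x)) ν := by
  have h := integrable_qf_mul ν (w := fun r => w r / r) (hw.div measurable_id)
    (hi.congr (Filter.Eventually.of_forall fun x => by
      by_cases h : x ⬝ᵥ x = 0
      · simp [h]
      · field_simp)) 1 A B
  refine h.congr (Filter.Eventually.of_forall fun x => ?_)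
  have := div_mul_qf_one w A x
  calc _ = w (x ⬝ᵥ x) / (x ⬝ᵥ x) * (qf 1 x * qf A x) * qf B x := by ring
    _ = _ := by rw [this]; ring

theorem integrable_qf (hw : Measurable w)
    (hi : Integrable (fun x : Fin q → ℝ => w (x ⬝ᵥ x) * (x ⬝ᵥ x)) ν)
    (A : Matrix (Fin q) (Fin q) ℝ) :
    Integrable (fun x : Fin q → ℝ => w (x ⬝ᵥ x) * qf A x) ν := by
  have h := integrable_qf_qf (w := fun r => w r / r) (ν := ν) (hw.div measurable_id)
    (hi.congr (Filter.Eventually.of_forall fun x => by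
      by_cases h : x ⬝ᵥ x = 0
      · simp [h]
      · field_simp)) 1 A
  exact h.congr (Filter.Eventually.of_forall fun x => div_mul_qf_one w A x)

/-- The recursion with two identity forms: both contractions return the integral on the left, which
lowers `q + 4` to `q`. -/
theorem integral_qf_one_one (hν : RotationInvariant ν) (hw : Measurable w)
    (hi : Integrable (fun x : Fin q → ℝ => w (x ⬝ᵥ x) * (x ⬝ᵥ x) ^ 3) ν)
    (A : Matrix (Fin q) (Fin q) ℝ) :
    q * ∫ x, w (x ⬝ᵥ x) * (qf 1 x * qf 1 x * qf A x) ∂ν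
      = A.trace * ∫ x, w (x ⬝ᵥ x) * (x ⬝ᵥ x) ^ 3 ∂ν := by
  have h := integral_qf_mul_rec hν hw hi A (B := 1) (C := 1) isSymm_one isSymm_one
  have e1 : ∀ x, qf A x * qf 1 x * qf 1 x = qf 1 x * qf 1 x * qf A x := fun x => by ring
  have e2 : ∀ x : Fin q → ℝ, qf 1 x * qf 1 x * qf 1 x = (x ⬝ᵥ x) ^ 3 :=
    fun x => by rw [qf_one]; ring
  have e3 : ∀ x, qf 1 x * qf A x * qf 1 x = qf 1 x * qf 1 x * qf A x := fun x => by ring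
  simp only [Matrix.mul_one, e1, e2, qf_transpose, e3] at h
  linarith

theorem integral_qf_one (hν : RotationInvariant ν) (hw : Measurable w)
    (hi : Integrable (fun x : Fin q → ℝ => w (x ⬝ᵥ x) * (x ⬝ᵥ x) ^ 3) ν)
    (A : Matrix (Fin q) (Fin q) ℝ) {B : Matrix (Fin q) (Fin q) ℝ} (hB : B.IsSymm) :
    q * (q + 2) * ∫ x, w (x ⬝ᵥ x) * (qf 1 x * qf A x * qf B x) ∂ν
      = (A.trace * B.trace + 2 * (Aᵀ * B).trace) * ∫ x, w (x ⬝ᵥ x) * (x ⬝ᵥ x) ^ 3 ∂ν := by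
  have h := integral_qf_mul_rec hν hw hi A (B := 1) (C := B) isSymm_one hB
  have e1 : ∀ x, qf A x * qf 1 x * qf B x = qf 1 x * qf A x * qf B x := fun x => by ring
  simp only [Matrix.mul_one, e1, qf_transpose] at h
  have h1 := integral_qf_one_one hν hw hi B
  have h2 := integral_qf_one_one hν hw hi (Aᵀ * B)
  linear_combination q * h + A.trace * h1 + 2 * h2

/-- Three applications of the recursion, with denominators `q + 4`, `q + 2` and `q`. The
coefficients `1`, `2`, `8` count the fifteen pairings of six indices according to the trace pattern
they produce: `1 + 3·2 + 8`. -/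
theorem integral_qf_qf_qf (hν : RotationInvariant ν) (hw : Measurable w)
    (hi : Integrable (fun x : Fin q → ℝ => w (x ⬝ᵥ x) * (x ⬝ᵥ x) ^ 3) ν)
    {A B C : Matrix (Fin q) (Fin q) ℝ} (hA : A.IsSymm) (hB : B.IsSymm) (hC : C.IsSymm) :
    q * (q + 2) * (q + 4) * ∫ x, w (x ⬝ᵥ x) * (qf A x * qf B x * qf C x) ∂ν
      = (A.trace * B.trace * C.trace + 2 * (A.trace * (B * C).trace + B.trace * (A * C).trace
        + C.trace * (A * B).trace) + 8 * (A * B * C).trace) *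
        ∫ x, w (x ⬝ᵥ x) * (x ⬝ᵥ x) ^ 3 ∂ν := by
  have h := integral_qf_mul_rec hν hw hi A hB hC
  have h1 := integral_qf_one hν hw hi B hC
  have h2 := integral_qf_one hν hw hi (Aᵀ * B) hC
  have h3 := integral_qf_one hν hw hi (Aᵀ * C) hB
  have e : ∀ x, qf 1 x * qf (Aᵀ * C) x * qf B x = qf 1 x * qf B x * qf (Aᵀ * C) x :=
    fun x => by ring
  have t1 : ((Aᵀ * B)ᵀ * C).trace = (A * B * C).trace := by
    rw [← trace_transpose, transpose_mul, transpose_transpose, hA.eq, hC.eq, trace_mul_comm]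
  have t2 : ((Aᵀ * C)ᵀ * B).trace = (A * B * C).trace := by
    rw [transpose_mul, transpose_transpose, hC.eq, trace_mul_cycle A B C]
  simp only [e] at h3
  rw [t2, hA.eq] at h3
  rw [t1, hA.eq] at h2
  rw [hB.eq] at h1
  rw [hA.eq] at h
  linear_combination q * (q + 2) * h + A.trace * h1 + 2 * h2 + 2 * h3

theorem integral_qf_qf (hν : RotationInvariant ν) (hw : Measurable w)
    (hi : Integrable (fun x : Fin q → ℝ => w (x ⬝ᵥ x) * (x ⬝ᵥ x) ^ 2) ν)
    (A : Matrix (Fin q) (Fin q) ℝ) {B : Matrix (Fin q) (Fin q) ℝ} (hB : B.IsSymm) :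
    q * (q + 2) * ∫ x, w (x ⬝ᵥ x) * (qf A x * qf B x) ∂ν
      = (A.trace * B.trace + 2 * (Aᵀ * B).trace) * ∫ x, w (x ⬝ᵥ x) * (x ⬝ᵥ x) ^ 2 ∂ν := by
  have e : ∀ x : Fin q → ℝ, w (x ⬝ᵥ x) / (x ⬝ᵥ x) * (x ⬝ᵥ x) ^ 3
      = w (x ⬝ᵥ x) * (x ⬝ᵥ x) ^ 2 := fun x => by
    by_cases h : x ⬝ᵥ x = 0
    · simp [h]
    · field_simp
  have e' : ∀ x : Fin q → ℝ, w (x ⬝ᵥ x) / (x ⬝ᵥ x) * (qf 1 x * qf A x * qf B x)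
      = w (x ⬝ᵥ x) * (qf A x * qf B x) := fun x => by
    rw [← mul_assoc, div_mul_qf_one, mul_assoc]
  have h := integral_qf_one hν (w := fun r => w r / r) (hw.div measurable_id)
    (by simpa only [e] using hi) A hB
  simpa only [e, e'] using h

theorem integral_qf (hν : RotationInvariant ν) (hw : Measurable w)
    (hi : Integrable (fun x : Fin q → ℝ => w (x ⬝ᵥ x) * (x ⬝ᵥ x)) ν)
    (A : Matrix (Fin q) (Fin q) ℝ) :
    q * ∫ x, w (x ⬝ᵥ x) * qf A x ∂ν = A.trace * ∫ x, w (x ⬝ᵥ x) * (x ⬝ᵥ x) ∂ν := by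
  have e : ∀ x : Fin q → ℝ, w (x ⬝ᵥ x) / (x ⬝ᵥ x) ^ 2 * (x ⬝ᵥ x) ^ 3
      = w (x ⬝ᵥ x) * (x ⬝ᵥ x) := fun x => by
    by_cases h : x ⬝ᵥ x = 0
    · simp [h]
    · field_simp
  have e' : ∀ x : Fin q → ℝ, w (x ⬝ᵥ x) / (x ⬝ᵥ x) ^ 2 * (qf 1 x * qf 1 x * qf A x)
      = w (x ⬝ᵥ x) * qf A x := fun x => by
    by_cases h : x ⬝ᵥ x = 0
    · have : x = 0 := dotProduct_self_eq_zero.1 h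
      simp [this, qf]
    · rw [qf_one]; field_simp
  have h := integral_qf_one_one hν (w := fun r => w r / r ^ 2)
    (hw.div (measurable_id.pow_const 2)) (by simpa only [e] using hi) A
  simpa only [e, e'] using h

end Moments

end Rotations

end Elliptical

end

noncomputable section

namespace Elliptical

/-! ### Polar coordinates in the logarithm of the radius. -/

section Radial

variable {q : ℕ}

theorem dotProduct_self_eq_norm_sq (x : Fin q → ℝ) : x ⬝ᵥ x = ‖WithLp.toLp 2 x‖ ^ 2 := by
  rw [EuclideanSpace.real_norm_sq_eq]
  simp [dotProduct, pow_two]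

theorem exp_mul_pow_pred (hq : 0 < q) (φ : ℝ → ℝ) (s : ℝ) :
    |Real.exp s| • (Real.exp s ^ (q - 1) • φ (Real.exp s ^ 2))
      = Real.exp (q * s) * φ (Real.exp (2 * s)) := by
  rw [Real.abs_exp, smul_eq_mul, smul_eq_mul, ← mul_assoc, ← pow_succ', Nat.sub_add_cancel hq,
    ← Real.exp_nat_mul, ← Real.exp_nat_mul]
  norm_num

/-- Polar coordinates followed by radius `= e^s`, so that `t^{q-1} dt` becomes `e^{qs} ds`. Working
on all of `ℝ` later allows integration by parts without boundary terms at the origin or at infinity.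
-/
theorem integrable_radial (hq : 0 < q) (φ : ℝ → ℝ) :
    Integrable (fun x : Fin q → ℝ => φ (x ⬝ᵥ x)) ↔
      Integrable fun s : ℝ => Real.exp (q * s) * φ (Real.exp (2 * s)) := by
  have : Nonempty (Fin q) := ⟨⟨0, hq⟩⟩
  have h1 := (PiLp.volume_preserving_toLp (Fin q)).integrable_comp_emb
    (MeasurableEquiv.toLp 2 (Fin q → ℝ)).measurableEmbedding
    (g := fun y : EuclideanSpace ℝ (Fin q) => φ (‖y‖ ^ 2))
  have h2 := integrable_fun_norm_addHaar (volume : Measure (EuclideanSpace ℝ (Fin q)))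
    (f := fun t => φ (t ^ 2))
  have h3 := integrableOn_image_iff_integrableOn_abs_deriv_smul (s := Set.univ) (f := Real.exp)
    (f' := Real.exp) MeasurableSet.univ (fun x _ => (Real.hasDerivAt_exp x).hasDerivWithinAt)
    Real.exp_injective.injOn (fun y => y ^ (q - 1) • φ (y ^ 2))
  rw [Set.image_univ, Real.range_exp, integrableOn_univ] at h3
  simp only [exp_mul_pow_pred hq] at h3
  rw [finrank_euclideanSpace_fin] at h2
  rw [← h3, ← h2, ← h1]
  simp only [dotProduct_self_eq_norm_sq, Function.comp_def]

/-- The constant is left unspecified: only its independence of `φ` matters, the normalization of `g`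
fixing it whenever it is needed. -/
theorem exists_integral_radial (hq : 0 < q) : ∃ K : ℝ, ∀ φ : ℝ → ℝ,
    ∫ x : Fin q → ℝ, φ (x ⬝ᵥ x) = K * ∫ s : ℝ, Real.exp (q * s) * φ (Real.exp (2 * s)) := by
  have : Nonempty (Fin q) := ⟨⟨0, hq⟩⟩
  refine ⟨q * volume.real (Metric.ball (0 : EuclideanSpace ℝ (Fin q)) 1), fun φ => ?_⟩
  have h1 := (PiLp.volume_preserving_toLp (Fin q)).integral_comp
    (MeasurableEquiv.toLp 2 (Fin q → ℝ)).measurableEmbedding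
    (fun y : EuclideanSpace ℝ (Fin q) => φ (‖y‖ ^ 2))
  have h2 := integral_fun_norm_addHaar (volume : Measure (EuclideanSpace ℝ (Fin q)))
    (fun t => φ (t ^ 2))
  have h3 := integral_image_eq_integral_abs_deriv_smul (s := Set.univ) (f := Real.exp)
    (f' := Real.exp) MeasurableSet.univ (fun x _ => (Real.hasDerivAt_exp x).hasDerivWithinAt)
    Real.exp_injective.injOn (fun y => y ^ (q - 1) • φ (y ^ 2))
  rw [Set.image_univ, Real.range_exp, setIntegral_univ] at h3
  simp only [exp_mul_pow_pred hq] at h3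
  rw [finrank_euclideanSpace_fin] at h2
  simp only [← dotProduct_self_eq_norm_sq] at h1
  rw [h1, h2, h3]
  simp [mul_assoc]

end Radial

/-- The properties of a density generating function. -/
structure IsGenerator (q : ℕ) (g : ℝ → ℝ) : Prop where
  q_pos : 0 < q
  pos : ∀ u, 0 ≤ u → 0 < g u
  diff : DifferentiableOn ℝ g (Set.Ioi 0)
  normalized : ∫ x : Fin q → ℝ, g (x ⬝ᵥ x) = 1

/-- The standard law `El_q(0, I, g)`. -/
abbrev stdLaw (q : ℕ) (g : ℝ → ℝ) : Measure (Fin q → ℝ) := law 0 1 g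

/-! ### The standard elliptical law and the inequalities for its coefficients. -/

section Standard

variable {q : ℕ} {g : ℝ → ℝ}

theorem density_std (x : Fin q → ℝ) : density 0 1 g x = g (x ⬝ᵥ x) := by
  simp [density]

namespace IsGenerator

variable (h : IsGenerator q g)
include h

/-- `g` is controlled only on `[0, ∞)`, with continuity only on `(0, ∞)`. Along a nonnegative
function it agrees with a measurable piecewise function taking the value `g 0` off the open
half-line. -/
theorem measurable_comp_dotProduct_self {α : Type*} [MeasurableSpace α] {f : α → ℝ}
    (hf : Measurable f) (h0 : ∀ a, 0 ≤ f a) : Measurable fun a => g (f a) := by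
  classical
  have hm : Measurable ((Set.Ioi (0 : ℝ)).piecewise g fun _ => g 0) :=
    h.diff.continuousOn.measurable_piecewise continuousOn_const measurableSet_Ioi
  have e : (fun a => g (f a)) = fun a => (Set.Ioi (0 : ℝ)).piecewise g (fun _ => g 0) (f a) := by
    funext a
    rcases (h0 a).eq_or_lt with ha | ha
    · rw [Set.piecewise_eq_of_notMem _ _ _ (by simp [← ha]), ← ha]
    · rw [Set.piecewise_eq_of_mem _ _ _ (Set.mem_Ioi.2 ha)]
  rw [e]
  exact hm.comp hf

theorem measurable_gen : Measurable fun x : Fin q → ℝ => g (x ⬝ᵥ x) :=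
  h.measurable_comp_dotProduct_self (by unfold dotProduct; fun_prop) dotProduct_self_nonneg'

/-- A non-integrable function has Bochner integral `0`, so the normalization to `1` already contains
integrability. -/
theorem integrable_gen : Integrable fun x : Fin q → ℝ => g (x ⬝ᵥ x) := by
  by_contra hn
  have := h.normalized
  rw [integral_undef hn] at this
  exact zero_ne_one this

theorem gen_pos (x : Fin q → ℝ) : 0 < g (x ⬝ᵥ x) := h.pos _ (dotProduct_self_nonneg' x)

theorem isProbabilityMeasure : IsProbabilityMeasure (stdLaw q g) := by
  refine ⟨?_⟩
  simp only [stdLaw, law, density_std]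
  rw [withDensity_apply _ MeasurableSet.univ, Measure.restrict_univ,
    ← ofReal_integral_eq_lintegral_ofReal h.integrable_gen
      (Filter.Eventually.of_forall fun x => (h.gen_pos x).le), h.normalized, ENNReal.ofReal_one]

theorem integrable_std_iff {f : (Fin q → ℝ) → ℝ} :
    Integrable f (stdLaw q g) ↔ Integrable fun x => g (x ⬝ᵥ x) * f x := by
  simp only [stdLaw, law, density_std]
  rw [integrable_withDensity_iff_integrable_smul' h.measurable_gen.ennreal_ofReal
    (Filter.Eventually.of_forall fun x => ENNReal.ofReal_lt_top)]
  simp only [ENNReal.toReal_ofReal (h.gen_pos _).le, smul_eq_mul]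

theorem integral_std (f : (Fin q → ℝ) → ℝ) :
    ∫ x, f x ∂(stdLaw q g) = ∫ x, g (x ⬝ᵥ x) * f x := by
  simp only [stdLaw, law, density_std]
  rw [integral_withDensity_eq_integral_toReal_smul h.measurable_gen.ennreal_ofReal
    (Filter.Eventually.of_forall fun x => ENNReal.ofReal_lt_top)]
  simp only [ENNReal.toReal_ofReal (h.gen_pos _).le, smul_eq_mul]

/-- An orthogonal matrix has determinant `±1`, so it preserves Lebesgue measure, and the density
depends only on `x ⬝ᵥ x`. -/
theorem rotationInvariant : RotationInvariant (stdLaw q g) := by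
  intro R hR
  have hdet : R.det * R.det = 1 := by
    have := congrArg det hR
    rwa [det_mul, det_transpose, det_one] at this
  have hmp : MeasurePreserving (fun x : Fin q → ℝ => R *ᵥ x) := by
    refine ⟨by fun_prop, ?_⟩
    have h1 := Real.map_matrix_volume_pi_eq_smul_volume_pi (M := R)
      (fun h0 => by rw [h0] at hdet; simp at hdet)
    have : |R.det⁻¹| = 1 := by
      rcases mul_self_eq_one_iff.1 hdet with h' | h' <;> simp [h']
    rw [this, ENNReal.ofReal_one, one_smul] at h1
    exact h1
  have hinv : ∀ x : Fin q → ℝ, (R *ᵥ x) ⬝ᵥ (R *ᵥ x) = x ⬝ᵥ x := fun x => by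
    rw [dotProduct_mulVec, ← mulVec_transpose, mulVec_mulVec, hR, one_mulVec]
  refine ⟨hmp.measurable, ?_⟩
  ext s hs
  simp only [stdLaw, law, density_std]
  rw [Measure.map_apply hmp.measurable hs, withDensity_apply _ (hmp.measurable hs),
    withDensity_apply _ hs, ← hmp.setLIntegral_comp_preimage hs h.measurable_gen.ennreal_ofReal]
  simp only [hinv]

theorem measurePreserving_neg : MeasurePreserving (fun x : Fin q → ℝ => -x) (stdLaw q g)
    (stdLaw q g) := by
  have := h.rotationInvariant (-1) (by simp)
  simpa [neg_mulVec] using this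

theorem hasDerivAt {u : ℝ} (hu : 0 < u) : HasDerivAt g (W g u * g u) u := by
  have hd := (h.diff.differentiableAt (Ioi_mem_nhds hu)).hasDerivAt
  have hl := (hd.log (h.pos u hu.le).ne').deriv
  rw [W, hl, div_mul_cancel₀ _ (h.pos u hu.le).ne']
  exact hd

end IsGenerator

theorem measurable_W (g : ℝ → ℝ) : Measurable (W g) := measurable_deriv _

namespace IsGenerator

variable (h : IsGenerator q g)
include h

theorem hasDerivAt_exp (s : ℝ) :
    HasDerivAt (fun s => Real.exp (q * s) * g (Real.exp (2 * s)))
      (Real.exp (q * s) * (g (Real.exp (2 * s)) *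
        (q + 2 * (W g (Real.exp (2 * s)) * Real.exp (2 * s))))) s := by
  have h1 : HasDerivAt (fun s : ℝ => Real.exp (q * s)) (Real.exp (q * s) * q) s := by
    simpa using ((hasDerivAt_id s).const_mul (q : ℝ)).exp
  have h2 : HasDerivAt (fun s : ℝ => Real.exp (2 * s)) (Real.exp (2 * s) * 2) s := by
    simpa using ((hasDerivAt_id s).const_mul (2 : ℝ)).exp
  have h3 := (h.hasDerivAt (Real.exp_pos (2 * s))).comp s h2
  refine (h1.mul h3).congr_deriv ?_
  simp only [Function.comp_apply]; ring

omit h in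
theorem memLp_two (h22 : PsiFinite q g 2 2) :
    MemLp (fun x : Fin q → ℝ => W g (x ⬝ᵥ x) * (x ⬝ᵥ x)) 2 (stdLaw q g) := by
  have hm : Measurable fun x : Fin q → ℝ => W g (x ⬝ᵥ x) * (x ⬝ᵥ x) :=
    ((measurable_W g).comp (by unfold dotProduct; fun_prop)).mul (by unfold dotProduct; fun_prop)
  rw [memLp_two_iff_integrable_sq hm.aestronglyMeasurable]
  simp only [mul_pow]
  exact h22

theorem psiFinite_one_one (h22 : PsiFinite q g 2 2) : PsiFinite q g 1 1 := by
  have := h.isProbabilityMeasure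
  simpa [PsiFinite] using (memLp_two h22).integrable one_le_two

/-- The derivative of `e^{qs} g(e^{2s})` is `e^{qs} g(e^{2s}) (q + 2 W r)` with `r = e^{2s}`.
Function and derivative are both integrable over `ℝ`, so the derivative integrates to zero: `q +
2ψ_(1,1) = 0`. -/
theorem psi_one_one (h22 : PsiFinite q g 2 2) : psi q g 1 1 = -(q / 2) := by
  obtain ⟨K, hK⟩ := exists_integral_radial h.q_pos
  have h11 := h.psiFinite_one_one h22
  simp only [PsiFinite, pow_one] at h11
  have i1 := (integrable_radial h.q_pos g).1 h.integrable_gen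
  have i2 := (integrable_radial h.q_pos (fun r => g r * (W g r * r))).1
    ((h.integrable_std_iff).1 h11)
  have e := hK (fun r => g r * (W g r * r))
  have e1 := hK g
  rw [h.normalized] at e1
  have z := integral_eq_zero_of_hasDerivAt_of_integrable h.hasDerivAt_exp
    (((i1.const_mul (q : ℝ)).add (i2.const_mul 2)).congr (Filter.Eventually.of_forall fun s => by
      simp only [Pi.add_apply]; ring)) i1
  have z' : ∫ s, (q * (Real.exp (q * s) * g (Real.exp (2 * s))) + 2 * (Real.exp (q * s) *
      (g (Real.exp (2 * s)) * (W g (Real.exp (2 * s)) * Real.exp (2 * s))))) = 0 := by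
    rw [← z]
    exact integral_congr_ae (Filter.Eventually.of_forall fun s => by ring)
  rw [integral_add (i1.const_mul _) (i2.const_mul _), integral_const_mul, integral_const_mul] at z'
  rw [psi, h.integral_std]
  simp only [pow_one]
  rw [e]
  linear_combination K / 2 * z' + q / 2 * e1

/-- By `psi_one_one`, the second moment of `q + 2 W r` is `4ψ_(2,2) - q²`. Were it zero, `q + 2 W r`
would vanish almost everywhere and `e^{qs} g(e^{2s})` would be a positive constant, which is not
integrable over `ℝ`. -/
theorem psi_two_two_gt (h22 : PsiFinite q g 2 2) : (q : ℝ) ^ 2 / 4 < psi q g 2 2 := by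
  have := h.isProbabilityMeasure
  obtain ⟨K, hK⟩ := exists_integral_radial h.q_pos
  have h11 := h.psiFinite_one_one h22
  have hpsi := h.psi_one_one h22
  have e : ∫ x : Fin q → ℝ, (q + 2 * (W g (x ⬝ᵥ x) * (x ⬝ᵥ x))) ^ 2 ∂(stdLaw q g)
      = 4 * psi q g 2 2 - q ^ 2 := by
    have : ∀ x : Fin q → ℝ, (q + 2 * (W g (x ⬝ᵥ x) * (x ⬝ᵥ x))) ^ 2
      = (q : ℝ) ^ 2 + ((4 * q) * (W g (x ⬝ᵥ x) ^ 1 * (x ⬝ᵥ x) ^ 1)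
        + 4 * (W g (x ⬝ᵥ x) ^ 2 * (x ⬝ᵥ x) ^ 2)) := fun x => by ring
    simp only [this]
    rw [integral_add (integrable_const _) (by exact (h11.const_mul _).add (h22.const_mul _)),
      integral_add (h11.const_mul _) (h22.const_mul _), integral_const_mul, integral_const_mul]
    change _ + (_ * psi q g 1 1 + _ * psi q g 2 2) = _
    rw [hpsi]
    simp
    ring
  have hi : Integrable (fun x : Fin q → ℝ => (q + 2 * (W g (x ⬝ᵥ x) * (x ⬝ᵥ x))) ^ 2)
      (stdLaw q g) :=
    ((memLp_const (q : ℝ)).add ((memLp_two h22).const_mul 2)).integrable_sq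
  have hnn : 0 ≤ ∫ x : Fin q → ℝ, (q + 2 * (W g (x ⬝ᵥ x) * (x ⬝ᵥ x))) ^ 2 ∂(stdLaw q g) :=
    integral_nonneg fun x => sq_nonneg _
  rcases hnn.eq_or_lt with h0 | h0
  · exfalso
    rw [h.integral_std, hK (fun r => g r * (q + 2 * (W g r * r)) ^ 2)] at h0
    have hK0 : K ≠ 0 := fun hK0 => by
      have := hK g
      rw [h.normalized, hK0, zero_mul] at this
      exact one_ne_zero this
    have h1 : ∫ s : ℝ, Real.exp (q * s) * (g (Real.exp (2 * s)) *
        (q + 2 * (W g (Real.exp (2 * s)) * Real.exp (2 * s))) ^ 2) = 0 := by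
      rcases mul_eq_zero.1 h0.symm with h' | h'
      · exact absurd h' hK0
      · exact h'
    have hgp : ∀ s : ℝ, 0 < g (Real.exp (2 * s)) := fun s => h.pos _ (Real.exp_pos _).le
    rw [integral_eq_zero_iff_of_nonneg (fun s => mul_nonneg (Real.exp_pos _).le
      (mul_nonneg (hgp s).le (sq_nonneg _)))
      ((integrable_radial h.q_pos (fun r => g r * (q + 2 * (W g r * r)) ^ 2)).1
        (h.integrable_std_iff.1 hi))] at h1
    have h2 : (fun s : ℝ => Real.exp (q * s) * (g (Real.exp (2 * s)) *
        (q + 2 * (W g (Real.exp (2 * s)) * Real.exp (2 * s))))) =ᵐ[volume] 0 := by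
      filter_upwards [h1] with s hs
      simpa [(Real.exp_pos _).ne', (hgp s).ne'] using hs
    -- An almost everywhere vanishing derivative suffices here, since the function is differentiable
    -- at every point with interval integrable derivative and so is the integral of that derivative.
    have h3 : ∀ t : ℝ, Real.exp (q * t) * g (Real.exp (2 * t))
        = Real.exp (q * 0) * g (Real.exp (2 * 0)) := fun t => by
      have := intervalIntegral.integral_eq_sub_of_hasDerivAt (a := 0) (b := t)
        (fun s _ => h.hasDerivAt_exp s)
        (((integrable_zero ℝ ℝ volume).congr h2.symm).intervalIntegrable)
      rw [intervalIntegral.integral_congr_ae (g := 0) (h2.mono fun s hs _ => hs)] at this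
      simp only [Pi.zero_apply, intervalIntegral.integral_zero] at this
      linarith
    have i1 := (integrable_radial h.q_pos g).1 h.integrable_gen
    simp only [h3] at i1
    rcases integrable_const_iff.1 i1 with h4 | h4
    · exact (mul_pos (Real.exp_pos _) (hgp 0)).ne' h4
    · have := h4.measure_univ_lt_top
      simp at this
  · rw [e] at h0
    linarith

/-- If `W² r` vanished almost everywhere, so would `W r`, contradicting `ψ_(1,1) = -q/2 ≠ 0`. -/
theorem psi_two_one_pos (h22 : PsiFinite q g 2 2) (h21 : PsiFinite q g 2 1) :
    0 < psi q g 2 1 := by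
  have hnn : ∀ x : Fin q → ℝ, 0 ≤ W g (x ⬝ᵥ x) ^ 2 * (x ⬝ᵥ x) ^ 1 := fun x => by
    have := dotProduct_self_nonneg' x
    positivity
  have h0 : 0 ≤ psi q g 2 1 := integral_nonneg hnn
  rcases h0.eq_or_lt with h0 | h0
  · exfalso
    rw [psi, eq_comm, integral_eq_zero_iff_of_nonneg hnn h21] at h0
    have h1 := h.psi_one_one h22
    have : psi q g 1 1 = 0 := by
      rw [psi]
      refine integral_eq_zero_of_ae ?_
      filter_upwards [h0] with x hx
      simpa using hx
    rw [this] at h1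
    have : (0 : ℝ) < q := Nat.cast_pos.2 h.q_pos
    linarith
  · exact h0

end IsGenerator

end Standard

end Elliptical

end

noncomputable section

namespace Elliptical

/-! ### Second and third moments of sums of independent centred terms. -/

section Independence

variable {ι : Type*} [Fintype ι] {Ω : ι → Type*} [∀ i, MeasurableSpace (Ω i)]
  {P : ∀ i, Measure (Ω i)} [∀ i, IsProbabilityMeasure (P i)]

theorem integral_mul_mul_pi [DecidableEq ι] {X Y Z : ∀ i, Ω i → ℝ}
    (hX : ∀ i, Integrable (X i) (P i)) (hY : ∀ i, Integrable (Y i) (P i))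
    (hZ : ∀ i, Integrable (Z i) (P i))
    (hXY : ∀ i, Integrable (fun x => X i x * Y i x) (P i))
    (hXZ : ∀ i, Integrable (fun x => X i x * Z i x) (P i))
    (hYZ : ∀ i, Integrable (fun x => Y i x * Z i x) (P i))
    (hXYZ : ∀ i, Integrable (fun x => X i x * Y i x * Z i x) (P i))
    (hX0 : ∀ i, ∫ x, X i x ∂(P i) = 0) (hY0 : ∀ i, ∫ x, Y i x ∂(P i) = 0)
    (hZ0 : ∀ i, ∫ x, Z i x ∂(P i) = 0) (i k l : ι) :
    Integrable (fun ω : ∀ i, Ω i => X i (ω i) * Y k (ω k) * Z l (ω l)) (Measure.pi P) ∧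
    ∫ ω, X i (ω i) * Y k (ω k) * Z l (ω l) ∂(Measure.pi P)
      = if i = k ∧ i = l then ∫ x, X i x * Y i x * Z i x ∂(P i) else 0 := by
  -- A product over coordinates, with the constant `1` where no factor sits, handles all
  -- coincidences among `i`, `k`, `l` at once. A coordinate carrying exactly one factor contributes
  -- a zero mean and kills the product.
  set φ : ∀ m, Ω m → ℝ := fun m x => (if m = i then X m x else 1) * (if m = k then Y m x else 1)
    * (if m = l then Z m x else 1) with hφ
  have e : (fun ω : ∀ i, Ω i => X i (ω i) * Y k (ω k) * Z l (ω l))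
      = fun ω => ∏ m, φ m (ω m) := by
    funext ω
    simp only [hφ, Finset.prod_mul_distrib, Finset.prod_ite_eq', Finset.mem_univ, if_true]
  have hi : ∀ m, Integrable (φ m) (P m) := fun m => by
    simp only [hφ]
    split_ifs <;> (try simp only [one_mul, mul_one]) <;>
      first
      | exact integrable_const _
      | exact hX m
      | exact hY m
      | exact hZ m
      | exact hXY m
      | exact hXZ m
      | exact hYZ m
      | exact hXYZ m
  rw [e]
  refine ⟨Integrable.fintype_prod_dep hi, ?_⟩
  rw [integral_fintype_prod_eq_prod]
  have hz : ∀ m, ∫ x, φ m x ∂(P m) = 0 → ∏ m, ∫ x, φ m x ∂(P m) = 0 := fun m hm =>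
    Finset.prod_eq_zero (Finset.mem_univ m) hm
  split_ifs with h
  · obtain ⟨rfl, rfl⟩ := h
    rw [Finset.prod_eq_single i]
    · simp [hφ]
    · intro m _ hm
      simp [hφ, hm]
    · simp
  · by_cases h1 : i = k
    · subst h1
      refine hz l ?_
      have : l ≠ i := fun hl => h ⟨rfl, hl.symm⟩
      simpa [hφ, this] using hZ0 l
    · by_cases h2 : i = l
      · subst h2
        refine hz k ?_
        simpa [hφ, Ne.symm h1] using hY0 k
      · refine hz i ?_
        simpa [hφ, h1, h2] using hX0 i

theorem integral_mul_pi [DecidableEq ι] {X Y : ∀ i, Ω i → ℝ}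
    (hX : ∀ i, Integrable (X i) (P i)) (hY : ∀ i, Integrable (Y i) (P i))
    (hXY : ∀ i, Integrable (fun x => X i x * Y i x) (P i))
    (hX0 : ∀ i, ∫ x, X i x ∂(P i) = 0) (i k : ι) :
    Integrable (fun ω : ∀ i, Ω i => X i (ω i) * Y k (ω k)) (Measure.pi P) ∧
    ∫ ω, X i (ω i) * Y k (ω k) ∂(Measure.pi P)
      = if i = k then ∫ x, X i x * Y i x ∂(P i) else 0 := by
  set φ : ∀ m, Ω m → ℝ := fun m x => (if m = i then X m x else 1) * (if m = k then Y m x else 1)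
    with hφ
  have e : (fun ω : ∀ i, Ω i => X i (ω i) * Y k (ω k)) = fun ω => ∏ m, φ m (ω m) := by
    funext ω
    simp only [hφ, Finset.prod_mul_distrib, Finset.prod_ite_eq', Finset.mem_univ, if_true]
  have hi : ∀ m, Integrable (φ m) (P m) := fun m => by
    simp only [hφ]
    split_ifs <;> (try simp only [one_mul, mul_one]) <;>
      first
      | exact integrable_const _
      | exact hX m
      | exact hY m
      | exact hXY m
  rw [e]
  refine ⟨Integrable.fintype_prod_dep hi, ?_⟩
  rw [integral_fintype_prod_eq_prod]
  split_ifs with h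
  · subst h
    rw [Finset.prod_eq_single i]
    · simp [hφ]
    · intro m _ hm
      simp [hφ, hm]
    · simp
  · refine Finset.prod_eq_zero (Finset.mem_univ i) ?_
    simpa [hφ, h] using hX0 i

theorem integral_sum_mul_sum_mul_sum {X Y Z : ∀ i, Ω i → ℝ}
    (hX : ∀ i, Integrable (X i) (P i)) (hY : ∀ i, Integrable (Y i) (P i))
    (hZ : ∀ i, Integrable (Z i) (P i))
    (hXY : ∀ i, Integrable (fun x => X i x * Y i x) (P i))
    (hXZ : ∀ i, Integrable (fun x => X i x * Z i x) (P i))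
    (hYZ : ∀ i, Integrable (fun x => Y i x * Z i x) (P i))
    (hXYZ : ∀ i, Integrable (fun x => X i x * Y i x * Z i x) (P i))
    (hX0 : ∀ i, ∫ x, X i x ∂(P i) = 0) (hY0 : ∀ i, ∫ x, Y i x ∂(P i) = 0)
    (hZ0 : ∀ i, ∫ x, Z i x ∂(P i) = 0) :
    Integrable (fun ω : ∀ i, Ω i => (∑ i, X i (ω i)) * (∑ i, Y i (ω i)) * ∑ i, Z i (ω i))
      (Measure.pi P) ∧
    ∫ ω, (∑ i, X i (ω i)) * (∑ i, Y i (ω i)) * ∑ i, Z i (ω i) ∂(Measure.pi P)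
      = ∑ i, ∫ x, X i x * Y i x * Z i x ∂(P i) := by
  classical
  have h := integral_mul_mul_pi hX hY hZ hXY hXZ hYZ hXYZ hX0 hY0 hZ0
  have e : ∀ ω : ∀ i, Ω i, (∑ i, X i (ω i)) * (∑ i, Y i (ω i)) * ∑ i, Z i (ω i)
      = ∑ i, ∑ k, ∑ l, X i (ω i) * Y k (ω k) * Z l (ω l) := fun ω => by
    rw [Finset.sum_mul_sum, Finset.sum_mul]
    simp_rw [Finset.sum_mul_sum]
  simp only [e]
  refine ⟨integrable_finsetSum _ fun i _ => integrable_finsetSum _ fun k _ =>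
    integrable_finsetSum _ fun l _ => (h i k l).1, ?_⟩
  rw [integral_finsetSum _ fun i _ => integrable_finsetSum _ fun k _ =>
    integrable_finsetSum _ fun l _ => (h i k l).1]
  refine Finset.sum_congr rfl fun i _ => ?_
  rw [integral_finsetSum _ fun k _ => integrable_finsetSum _ fun l _ => (h i k l).1,
    Finset.sum_eq_single i, integral_finsetSum _ fun l _ => (h i i l).1, Finset.sum_eq_single i,
    (h i i i).2]
  · simp
  · intro l _ hl
    rw [(h i i l).2, if_neg fun h' => hl h'.2.symm]
  · simp
  · intro k _ hk
    rw [integral_finsetSum _ fun l _ => (h i k l).1]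
    refine Finset.sum_eq_zero fun l _ => ?_
    rw [(h i k l).2, if_neg fun h' => hk h'.1.symm]
  · simp

theorem integral_sum_mul_sum {X Y : ∀ i, Ω i → ℝ}
    (hX : ∀ i, Integrable (X i) (P i)) (hY : ∀ i, Integrable (Y i) (P i))
    (hXY : ∀ i, Integrable (fun x => X i x * Y i x) (P i))
    (hX0 : ∀ i, ∫ x, X i x ∂(P i) = 0) :
    ∫ ω, (∑ i, X i (ω i)) * (∑ i, Y i (ω i)) ∂(Measure.pi P) = ∑ i, ∫ x, X i x * Y i x ∂(P i) := by
  classical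
  have h := integral_mul_pi hX hY hXY hX0
  simp_rw [Finset.sum_mul_sum]
  rw [integral_finsetSum _ fun i _ => integrable_finsetSum _ fun k _ => (h i k).1]
  refine Finset.sum_congr rfl fun i _ => ?_
  rw [integral_finsetSum _ fun k _ => (h i k).1, Finset.sum_eq_single i, (h i i).2]
  · simp
  · intro k _ hk
    rw [(h i k).2, if_neg hk.symm]
  · simp

end Independence

/-! ### Moments of the whitened score of one observation. -/

section ScoreMoments

variable {q : ℕ} {g : ℝ → ℝ}

/-- The even part of the score of one observation, in whitened coordinates. -/
def scoreEven (g : ℝ → ℝ) (Γ : Matrix (Fin q) (Fin q) ℝ) (x : Fin q → ℝ) : ℝ :=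
  -(Γ.trace / 2) - W g (x ⬝ᵥ x) * qf Γ x

/-- The odd part of the score of one observation, in whitened coordinates. -/
def scoreOdd (g : ℝ → ℝ) (α : Fin q → ℝ) (x : Fin q → ℝ) : ℝ :=
  -(2 * (W g (x ⬝ᵥ x) * (α ⬝ᵥ x)))

theorem scoreEven_neg (Γ : Matrix (Fin q) (Fin q) ℝ) (x : Fin q → ℝ) :
    scoreEven g Γ (-x) = scoreEven g Γ x := by
  simp [scoreEven, qf_neg_arg]

theorem scoreOdd_neg (α : Fin q → ℝ) (x : Fin q → ℝ) :
    scoreOdd g α (-x) = -scoreOdd g α x := by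
  simp [scoreOdd]

theorem measurable_scoreOdd (α : Fin q → ℝ) : Measurable (scoreOdd g α) :=
  ((((measurable_W g).comp (by unfold dotProduct; fun_prop)).mul
    (by unfold dotProduct; fun_prop)).const_mul 2).neg

theorem measurable_W_pow (g : ℝ → ℝ) (l : ℕ) : Measurable fun r => W g r ^ l :=
  (measurable_W g).pow_const l

/-- The coefficient `k` of an elliptical law. -/
def kCoeff (q : ℕ) (g : ℝ → ℝ) : ℝ := 4 * psi q g 2 1 / q

/-- The coefficient `c` of an elliptical law. -/
def cCoeff (q : ℕ) (g : ℝ → ℝ) : ℝ := 4 * psi q g 2 2 / (q * (q + 2))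

/-- The coefficient `c*` of an elliptical law. -/
def cStarCoeff (q : ℕ) (g : ℝ → ℝ) : ℝ := 8 * psi q g 3 2 / (q * (q + 2))

/-- The coefficient `ω̃` of an elliptical law. -/
def omegaCoeff (q : ℕ) (g : ℝ → ℝ) : ℝ :=
  psi q g 3 3 / (q * (q + 2) * (q + 4))

namespace IsGenerator

variable (h : IsGenerator q g)
include h

theorem integrable_W_qf (h22 : PsiFinite q g 2 2) (A : Matrix (Fin q) (Fin q) ℝ) :
    Integrable (fun x => W g (x ⬝ᵥ x) * qf A x) (stdLaw q g) := by
  have h11 := h.psiFinite_one_one h22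
  simp only [PsiFinite, pow_one] at h11
  exact integrable_qf (measurable_W g) h11 A

theorem integral_W_qf (h22 : PsiFinite q g 2 2) (A : Matrix (Fin q) (Fin q) ℝ) :
    ∫ x, W g (x ⬝ᵥ x) * qf A x ∂(stdLaw q g) = -(A.trace / 2) := by
  have h11 := h.psiFinite_one_one h22
  have hp := h.psi_one_one h22
  have hq : (0 : ℝ) < q := Nat.cast_pos.2 h.q_pos
  simp only [PsiFinite, pow_one] at h11
  simp only [psi, pow_one] at hp
  have := integral_qf h.rotationInvariant (measurable_W g) h11 A
  rw [hp] at this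
  have h2 : (q : ℝ) * (∫ x, W g (x ⬝ᵥ x) * qf A x ∂(stdLaw q g) + A.trace / 2) = 0 := by
    rw [mul_add, this]; ring
  rcases mul_eq_zero.1 h2 with h3 | h3
  · exact absurd h3 hq.ne'
  · linarith

omit h in
theorem integrable_W2_qf (h21 : PsiFinite q g 2 1) (A : Matrix (Fin q) (Fin q) ℝ) :
    Integrable (fun x => W g (x ⬝ᵥ x) ^ 2 * qf A x) (stdLaw q g) := by
  simp only [PsiFinite, pow_one] at h21
  exact integrable_qf (measurable_W_pow g 2) h21 A

theorem integral_W2_qf (h21 : PsiFinite q g 2 1) (A : Matrix (Fin q) (Fin q) ℝ) :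
    ∫ x, W g (x ⬝ᵥ x) ^ 2 * qf A x ∂(stdLaw q g) = kCoeff q g / 4 * A.trace := by
  have hq : (0 : ℝ) < q := Nat.cast_pos.2 h.q_pos
  simp only [PsiFinite, pow_one] at h21
  have := integral_qf h.rotationInvariant (measurable_W_pow g 2) h21 A
  rw [kCoeff, psi]
  simp only [pow_one]
  field_simp
  linarith

theorem integral_W2_qf_qf (h22 : PsiFinite q g 2 2) (A : Matrix (Fin q) (Fin q) ℝ)
    {B : Matrix (Fin q) (Fin q) ℝ} (hB : B.IsSymm) :
    ∫ x, W g (x ⬝ᵥ x) ^ 2 * (qf A x * qf B x) ∂(stdLaw q g)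
      = cCoeff q g / 4 * (A.trace * B.trace + 2 * (Aᵀ * B).trace) := by
  have hq : (0 : ℝ) < q := Nat.cast_pos.2 h.q_pos
  have := integral_qf_qf h.rotationInvariant (measurable_W_pow g 2) h22 A hB
  rw [(eq_div_iff (by positivity)).2 ((mul_comm _ _).trans this), cCoeff, psi]
  ring

theorem integral_W3_qf_qf (h32 : PsiFinite q g 3 2) (A : Matrix (Fin q) (Fin q) ℝ)
    {B : Matrix (Fin q) (Fin q) ℝ} (hB : B.IsSymm) :
    ∫ x, W g (x ⬝ᵥ x) ^ 3 * (qf A x * qf B x) ∂(stdLaw q g)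
      = cStarCoeff q g / 8 * (A.trace * B.trace + 2 * (Aᵀ * B).trace) := by
  have hq : (0 : ℝ) < q := Nat.cast_pos.2 h.q_pos
  have := integral_qf_qf h.rotationInvariant (measurable_W_pow g 3) h32 A hB
  rw [(eq_div_iff (by positivity)).2 ((mul_comm _ _).trans this), cStarCoeff, psi]
  ring

theorem integral_W3_qf_qf_qf (h33 : PsiFinite q g 3 3) {A B C : Matrix (Fin q) (Fin q) ℝ}
    (hA : A.IsSymm) (hB : B.IsSymm) (hC : C.IsSymm) :
    ∫ x, W g (x ⬝ᵥ x) ^ 3 * (qf A x * qf B x * qf C x) ∂(stdLaw q g)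
      = omegaCoeff q g * (A.trace * B.trace * C.trace + 2 * (A.trace * (B * C).trace
        + B.trace * (A * C).trace + C.trace * (A * B).trace) + 8 * (A * B * C).trace) := by
  have hq : (0 : ℝ) < q := Nat.cast_pos.2 h.q_pos
  have := integral_qf_qf_qf h.rotationInvariant (measurable_W_pow g 3) h33 hA hB hC
  rw [(eq_div_iff (by positivity)).2 ((mul_comm _ _).trans this), omegaCoeff, psi]
  ring

theorem memLp_scoreEven (h22 : PsiFinite q g 2 2) (Γ : Matrix (Fin q) (Fin q) ℝ) :
    MemLp (scoreEven g Γ) 2 (stdLaw q g) := by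
  have := h.isProbabilityMeasure
  refine (memLp_const (-(Γ.trace / 2))).sub ?_
  rw [memLp_two_iff_integrable_sq]
  · refine (integrable_qf_qf (measurable_W_pow g 2) h22 Γ Γ).congr
      (Filter.Eventually.of_forall fun x => by ring)
  · exact (((measurable_W g).comp (by unfold dotProduct; fun_prop)).mul
      (continuous_qf Γ).measurable).aestronglyMeasurable

omit h in
theorem memLp_scoreOdd (h21 : PsiFinite q g 2 1) (α : Fin q → ℝ) :
    MemLp (scoreOdd g α) 2 (stdLaw q g) := by
  rw [memLp_two_iff_integrable_sq (measurable_scoreOdd α).aestronglyMeasurable]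
  refine ((integrable_W2_qf h21 (vecMulVec α α)).const_mul 4).congr
    (Filter.Eventually.of_forall fun x => ?_)
  simp only [qf_vecMulVec, scoreOdd]
  ring

theorem integrable_scoreEven (h22 : PsiFinite q g 2 2) (Γ : Matrix (Fin q) (Fin q) ℝ) :
    Integrable (scoreEven g Γ) (stdLaw q g) :=
  have := h.isProbabilityMeasure
  (h.memLp_scoreEven h22 Γ).integrable one_le_two

theorem integrable_scoreOdd (h21 : PsiFinite q g 2 1) (α : Fin q → ℝ) :
    Integrable (scoreOdd g α) (stdLaw q g) :=
  have := h.isProbabilityMeasure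
  (memLp_scoreOdd h21 α).integrable one_le_two

theorem integral_eq_zero_of_odd {f : (Fin q → ℝ) → ℝ} (hf : ∀ x, f (-x) = -f x) :
    ∫ x, f x ∂(stdLaw q g) = 0 := by
  have h1 := h.measurePreserving_neg.integral_comp (MeasurableEquiv.neg _).measurableEmbedding f
  simp only [hf, integral_neg] at h1
  linarith

theorem integral_scoreOdd (α : Fin q → ℝ) : ∫ x, scoreOdd g α x ∂(stdLaw q g) = 0 :=
  h.integral_eq_zero_of_odd (scoreOdd_neg α)

theorem integral_scoreEven (h22 : PsiFinite q g 2 2) (Γ : Matrix (Fin q) (Fin q) ℝ) :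
    ∫ x, scoreEven g Γ x ∂(stdLaw q g) = 0 := by
  have := h.isProbabilityMeasure
  simp only [scoreEven]
  rw [integral_sub (integrable_const _) (h.integrable_W_qf h22 Γ), h.integral_W_qf h22]
  simp

/-- Odd times even integrates to zero by `x ↦ -x`. The odd–odd product is `4 W²` times the quadratic
form of `vecMulVec α β`, and the even–even product is a combination of the one- and two-form
moments. -/
theorem integral_score_mul_score (h21 : PsiFinite q g 2 1) (h22 : PsiFinite q g 2 2)
    (α β : Fin q → ℝ) (Γ : Matrix (Fin q) (Fin q) ℝ) {Δ : Matrix (Fin q) (Fin q) ℝ}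
    (hΓ : Γ.IsSymm) (hΔ : Δ.IsSymm) :
    ∫ x, (scoreOdd g α x + scoreEven g Γ x) * (scoreOdd g β x + scoreEven g Δ x) ∂(stdLaw q g)
      = kCoeff q g * (α ⬝ᵥ β) + cCoeff q g / 2 * (Γ * Δ).trace
        + (cCoeff q g - 1) / 4 * (Γ.trace * Δ.trace) := by
  have := h.isProbabilityMeasure
  have m1 : Integrable (fun x => scoreOdd g α x * scoreEven g Δ x) (stdLaw q g) :=
    (memLp_scoreOdd h21 α).integrable_mul (h.memLp_scoreEven h22 Δ)
  have m2 : Integrable (fun x => scoreOdd g β x * scoreEven g Γ x) (stdLaw q g) :=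
    (memLp_scoreOdd h21 β).integrable_mul (h.memLp_scoreEven h22 Γ)
  have e : ∀ x, (scoreOdd g α x + scoreEven g Γ x) * (scoreOdd g β x + scoreEven g Δ x)
      = (scoreOdd g α x * scoreEven g Δ x + scoreOdd g β x * scoreEven g Γ x)
      + (4 * (W g (x ⬝ᵥ x) ^ 2 * qf (vecMulVec α β) x)
      + (W g (x ⬝ᵥ x) ^ 2 * (qf Γ x * qf Δ x)
      + (Γ.trace / 2 * (W g (x ⬝ᵥ x) * qf Δ x)
      + (Δ.trace / 2 * (W g (x ⬝ᵥ x) * qf Γ x)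
      + Γ.trace / 2 * (Δ.trace / 2))))) := fun x => by
    simp only [scoreOdd, scoreEven, qf_vecMulVec]; ring
  have i1 := integrable_W2_qf h21 (vecMulVec α β)
  have i2 := integrable_qf_qf (measurable_W_pow g 2) h22 Γ Δ
  have i3 := h.integrable_W_qf h22 Δ
  have i4 := h.integrable_W_qf h22 Γ
  have j4 := (i4.const_mul (Δ.trace / 2)).add (integrable_const (Γ.trace / 2 * (Δ.trace / 2)))
  have j3 := (i3.const_mul (Γ.trace / 2)).add j4
  have j2 := i2.add j3
  have j1 := (i1.const_mul 4).add j2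
  simp only [e]
  rw [integral_add (by exact m1.add m2) (by exact j1), integral_add m1 m2,
    integral_add (i1.const_mul _) (by exact j2),
    integral_add i2 (by exact j3), integral_add (i3.const_mul _) (by exact j4),
    integral_add (i4.const_mul _) (integrable_const _), integral_const_mul, integral_const_mul,
    integral_const_mul, h.integral_W2_qf h21, h.integral_W2_qf_qf h22 Γ hΔ, h.integral_W_qf h22,
    h.integral_W_qf h22,
    h.integral_eq_zero_of_odd (f := fun x => scoreOdd g α x * scoreEven g Δ x)
      (fun x => by rw [scoreOdd_neg, scoreEven_neg]; ring),
    h.integral_eq_zero_of_odd (f := fun x => scoreOdd g β x * scoreEven g Γ x)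
      (fun x => by rw [scoreOdd_neg, scoreEven_neg]; ring), trace_vecMulVec, hΓ.eq]
  simp
  ring

/-- Expansion in powers of `W`. The constants `3/8` and `1/4` collect the three `W²` terms and,
through `E(W xᵀAx) = -tr A / 2`, the three `W` terms with the constant one. -/
theorem integrable_scoreEven_mul_mul (h22 : PsiFinite q g 2 2) (h33 : PsiFinite q g 3 3)
    {A B C : Matrix (Fin q) (Fin q) ℝ} (hA : A.IsSymm) (hB : B.IsSymm) (hC : C.IsSymm) :
    Integrable (fun x => scoreEven g A x * scoreEven g B x * scoreEven g C x) (stdLaw q g) ∧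
    ∫ x, scoreEven g A x * scoreEven g B x * scoreEven g C x ∂(stdLaw q g)
      = -((omegaCoeff q g + 3 / 8 * cCoeff q g - 1 / 4) * (A.trace * B.trace * C.trace)
        + (2 * omegaCoeff q g + cCoeff q g / 4) * (A.trace * (B * C).trace
          + B.trace * (A * C).trace + C.trace * (A * B).trace)
        + 8 * omegaCoeff q g * (A * B * C).trace) := by
  have := h.isProbabilityMeasure
  have i0 := integrable_qf_mul _ (measurable_W_pow g 3) h33 A B C
  have i1 := integrable_qf_qf (measurable_W_pow g 2) h22 A B
  have i2 := integrable_qf_qf (measurable_W_pow g 2) h22 A C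
  have i3 := integrable_qf_qf (measurable_W_pow g 2) h22 B C
  have i4 := h.integrable_W_qf h22 A
  have i5 := h.integrable_W_qf h22 B
  have i6 := h.integrable_W_qf h22 C
  have e : ∀ x, scoreEven g A x * scoreEven g B x * scoreEven g C x =
      (-1) * (W g (x ⬝ᵥ x) ^ 3 * (qf A x * qf B x * qf C x))
      + (-(C.trace / 2) * (W g (x ⬝ᵥ x) ^ 2 * (qf A x * qf B x))
      + (-(B.trace / 2) * (W g (x ⬝ᵥ x) ^ 2 * (qf A x * qf C x))
      + (-(A.trace / 2) * (W g (x ⬝ᵥ x) ^ 2 * (qf B x * qf C x))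
      + (-(B.trace * C.trace / 4) * (W g (x ⬝ᵥ x) * qf A x)
      + (-(A.trace * C.trace / 4) * (W g (x ⬝ᵥ x) * qf B x)
      + (-(A.trace * B.trace / 4) * (W g (x ⬝ᵥ x) * qf C x)
      + -(A.trace * B.trace * C.trace / 8))))))) := fun x => by
    simp only [scoreEven]; ring
  have j6 := (i6.const_mul (-(A.trace * B.trace / 4))).add
    (integrable_const (-(A.trace * B.trace * C.trace / 8)))
  have j5 := (i5.const_mul (-(A.trace * C.trace / 4))).add j6
  have j4 := (i4.const_mul (-(B.trace * C.trace / 4))).add j5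
  have j3 := (i3.const_mul (-(A.trace / 2))).add j4
  have j2 := (i2.const_mul (-(B.trace / 2))).add j3
  have j1 := (i1.const_mul (-(C.trace / 2))).add j2
  have j0 := (i0.const_mul (-1)).add j1
  simp only [e]
  refine ⟨by exact j0, ?_⟩
  rw [integral_add (i0.const_mul _) (by exact j1), integral_add (i1.const_mul _) (by exact j2),
    integral_add (i2.const_mul _) (by exact j3), integral_add (i3.const_mul _) (by exact j4),
    integral_add (i4.const_mul _) (by exact j5), integral_add (i5.const_mul _) (by exact j6),
    integral_add (i6.const_mul _) (integrable_const _)]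
  simp only [integral_const_mul]
  rw [h.integral_W3_qf_qf_qf h33 hA hB hC, h.integral_W2_qf_qf h22 A hB,
    h.integral_W2_qf_qf h22 A hC, h.integral_W2_qf_qf h22 B hC, h.integral_W_qf h22,
    h.integral_W_qf h22, h.integral_W_qf h22, hA.eq, hB.eq]
  simp
  ring

theorem integrable_scoreOdd_mul_mul (h21 : PsiFinite q g 2 1) (h32 : PsiFinite q g 3 2)
    (α β : Fin q → ℝ) {Γ : Matrix (Fin q) (Fin q) ℝ} (hΓ : Γ.IsSymm) :
    Integrable (fun x => scoreOdd g α x * scoreOdd g β x * scoreEven g Γ x) (stdLaw q g) ∧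
    ∫ x, scoreOdd g α x * scoreOdd g β x * scoreEven g Γ x ∂(stdLaw q g)
      = -((cStarCoeff q g + kCoeff q g) / 2 * (Γ.trace * (α ⬝ᵥ β))
        + cStarCoeff q g * (α ⬝ᵥ (Γ *ᵥ β))) := by
  have := h.isProbabilityMeasure
  have i0 := integrable_qf_qf (measurable_W_pow g 3) h32 (vecMulVec α β) Γ
  have i1 := integrable_W2_qf h21 (vecMulVec α β)
  have e : ∀ x, scoreOdd g α x * scoreOdd g β x * scoreEven g Γ x =
      (-4) * (W g (x ⬝ᵥ x) ^ 3 * (qf (vecMulVec α β) x * qf Γ x))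
      + (-2 * Γ.trace) * (W g (x ⬝ᵥ x) ^ 2 * qf (vecMulVec α β) x) := fun x => by
    simp only [scoreOdd, scoreEven, qf_vecMulVec]; ring
  simp only [e]
  refine ⟨(i0.const_mul _).add (i1.const_mul _), ?_⟩
  rw [integral_add (i0.const_mul _) (i1.const_mul _)]
  simp only [integral_const_mul]
  have t : ((vecMulVec α β)ᵀ * Γ).trace = α ⬝ᵥ (Γ *ᵥ β) := by
    rw [transpose_vecMulVec, vecMulVec_mul, trace_vecMulVec, ← mulVec_transpose, hΓ.eq,
      dotProduct_mulVec, ← mulVec_transpose, hΓ.eq, dotProduct_comm]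
  rw [h.integral_W3_qf_qf h32 _ hΓ, h.integral_W2_qf h21, t, trace_vecMulVec]
  ring

end IsGenerator

end ScoreMoments

end Elliptical

end

noncomputable section

namespace Elliptical

/-! ### Whitening: every elliptical law is an affine image of the standard one. -/

section Whitening

variable {q : ℕ}

open scoped MatrixOrder in
theorem exists_whitening {S : Matrix (Fin q) (Fin q) ℝ} (hS : S.PosDef) :
    ∃ A : Matrix (Fin q) (Fin q) ℝ, A * Aᵀ = S ∧ IsUnit A.det := by
  obtain ⟨B, hB⟩ := CStarAlgebra.nonneg_iff_eq_star_mul_self.1 hS.posSemidef.nonneg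
  refine ⟨Bᵀ, ?_, ?_⟩
  · rw [hB, transpose_transpose, star_eq_conjTranspose, conjTranspose_eq_transpose_of_trivial]
  · have h := hS.det_pos
    rw [hB, det_mul] at h
    rw [det_transpose]
    exact (right_ne_zero_of_mul h.ne').isUnit

theorem quadForm_whitening {A S : Matrix (Fin q) (Fin q) ℝ} (hA : A * Aᵀ = S)
    (hu : IsUnit A.det) (x : Fin q → ℝ) : (A *ᵥ x) ⬝ᵥ (S⁻¹ *ᵥ (A *ᵥ x)) = x ⬝ᵥ x := by
  have hu' : IsUnit Aᵀ.det := by rwa [det_transpose]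
  rw [← hA, Matrix.mul_inv_rev, mulVec_mulVec, Matrix.mul_assoc, nonsing_inv_mul _ hu,
    Matrix.mul_one, dotProduct_mulVec, ← mulVec_transpose, mulVec_mulVec,
    transpose_nonsing_inv, transpose_transpose, nonsing_inv_mul _ hu, one_mulVec]

theorem sqrt_det_whitening {A S : Matrix (Fin q) (Fin q) ℝ} (hA : A * Aᵀ = S) :
    Real.sqrt S.det = |A.det| := by
  rw [← hA, det_mul, det_transpose, ← pow_two, Real.sqrt_sq_eq_abs]

theorem density_whitening {A S : Matrix (Fin q) (Fin q) ℝ} (hA : A * Aᵀ = S)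
    (hu : IsUnit A.det) (mu : Fin q → ℝ) (g : ℝ → ℝ) (x : Fin q → ℝ) :
    density mu S g (mu + A *ᵥ x) = |A.det|⁻¹ * g (x ⬝ᵥ x) := by
  rw [density, add_sub_cancel_left, quadForm_whitening hA hu, sqrt_det_whitening hA]

theorem measurable_affine (mu : Fin q → ℝ) (A : Matrix (Fin q) (Fin q) ℝ) :
    Measurable fun x : Fin q → ℝ => mu + A *ᵥ x := by fun_prop

theorem map_affine_volume (mu : Fin q → ℝ) {A : Matrix (Fin q) (Fin q) ℝ} (hu : IsUnit A.det) :
    Measure.map (fun x : Fin q → ℝ => mu + A *ᵥ x) volume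
      = ENNReal.ofReal |A.det⁻¹| • volume := by
  have h1 := Real.map_matrix_volume_pi_eq_smul_volume_pi (M := A) hu.ne_zero
  have h2 : Measure.map (fun x : Fin q → ℝ => mu + A *ᵥ x) volume
      = Measure.map (fun y => mu + y) (Measure.map (⇑(toLin' A)) volume) := by
    rw [Measure.map_map (by fun_prop) (by
      exact (LinearMap.continuous_of_finiteDimensional _).measurable)]
    rfl
  rw [h2, h1, Measure.map_smul, map_add_left_eq_self]

theorem IsGenerator.measurable_density {g : ℝ → ℝ} (h : IsGenerator q g) (mu : Fin q → ℝ)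
    {S : Matrix (Fin q) (Fin q) ℝ} (hS : S.PosDef) : Measurable (density mu S g) := by
  refine (h.measurable_comp_dotProduct_self (f := fun y =>
    (y - mu) ⬝ᵥ (S⁻¹ *ᵥ (y - mu))) ?_ fun y => ?_).const_mul _
  · exact Continuous.measurable (by fun_prop)
  · simpa using hS.inv.posSemidef.dotProduct_mulVec_nonneg (y - mu)

/-- The Jacobian `|det A|` cancels the factor `|S|^{-1/2}` of the density, and the quadratic form in
`S⁻¹` becomes the squared norm. -/
theorem IsGenerator.law_eq_map {g : ℝ → ℝ} (h : IsGenerator q g) (mu : Fin q → ℝ)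
    {A S : Matrix (Fin q) (Fin q) ℝ} (hS : S.PosDef) (hA : A * Aᵀ = S) (hu : IsUnit A.det) :
    law mu S g = Measure.map (fun x : Fin q → ℝ => mu + A *ᵥ x) (stdLaw q g) := by
  have hm := measurable_affine mu A
  have hd := (h.measurable_density mu hS).ennreal_ofReal
  have hA0 : 0 < |A.det| := abs_pos.2 hu.ne_zero
  ext s hs
  rw [Measure.map_apply hm hs, stdLaw, law, law, withDensity_apply _ hs,
    withDensity_apply _ (hm hs)]
  have hv : (volume : Measure (Fin q → ℝ)) = ENNReal.ofReal |A.det| •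
      Measure.map (fun x : Fin q → ℝ => mu + A *ᵥ x) volume := by
    rw [map_affine_volume mu hu, smul_smul, ← ENNReal.ofReal_mul hA0.le, abs_inv,
      mul_inv_cancel₀ hA0.ne', ENNReal.ofReal_one, one_smul]
  have hdc : Measurable fun x => ENNReal.ofReal (density mu S g (mu + A *ᵥ x)) := hd.comp hm
  conv_lhs => rw [hv]
  rw [Measure.restrict_smul, lintegral_smul_measure, setLIntegral_map hs hd hm, smul_eq_mul,
    ← lintegral_const_mul _ hdc]
  refine lintegral_congr fun x => ?_
  rw [density_whitening hA hu, density_std, ← ENNReal.ofReal_mul hA0.le,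
    mul_inv_cancel_left₀ hA0.ne']

theorem IsGenerator.density_pos {g : ℝ → ℝ} (h : IsGenerator q g) (mu : Fin q → ℝ)
    {S : Matrix (Fin q) (Fin q) ℝ} (hS : S.PosDef) (y : Fin q → ℝ) : 0 < density mu S g y := by
  refine mul_pos (inv_pos.2 (Real.sqrt_pos.2 hS.det_pos)) (h.pos _ ?_)
  simpa using hS.inv.posSemidef.dotProduct_mulVec_nonneg (y - mu)

theorem IsGenerator.isProbabilityMeasure_law {g : ℝ → ℝ} (h : IsGenerator q g) (mu : Fin q → ℝ)
    {S : Matrix (Fin q) (Fin q) ℝ} (hS : S.PosDef) : IsProbabilityMeasure (law mu S g) := by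
  obtain ⟨A, hA, hu⟩ := exists_whitening hS
  have := h.isProbabilityMeasure
  rw [h.law_eq_map mu hS hA hu]
  exact Measure.isProbabilityMeasure_map (measurable_affine mu A).aemeasurable

theorem IsGenerator.integrable_density {g : ℝ → ℝ} (h : IsGenerator q g) (mu : Fin q → ℝ)
    {S : Matrix (Fin q) (Fin q) ℝ} (hS : S.PosDef) : Integrable (density mu S g) := by
  have := h.isProbabilityMeasure_law mu hS
  refine ⟨(h.measurable_density mu hS).aestronglyMeasurable, ?_⟩
  rw [hasFiniteIntegral_iff_ofReal (Filter.Eventually.of_forall fun y =>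
    (h.density_pos mu hS y).le)]
  have h1 : law mu S g Set.univ < ⊤ := measure_lt_top _ _
  rwa [law, withDensity_apply _ MeasurableSet.univ, Measure.restrict_univ] at h1

end Whitening

/-- A product measure is determined on boxes, where the integral of the product density factors by
Fubini. This puts every joint law on one fixed Lebesgue measure, as differentiation in `θ` under the
integral requires. -/
theorem pi_withDensity_ofReal {ι : Type*} [Fintype ι] {E : ι → Type*} [∀ i, MeasureSpace (E i)]
    [∀ i, SigmaFinite (volume : Measure (E i))] {ρ : ∀ i, E i → ℝ}
    (hi : ∀ i, Integrable (ρ i)) (h0 : ∀ i x, 0 ≤ ρ i x) :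
    Measure.pi (fun i => (volume : Measure (E i)).withDensity fun x => ENNReal.ofReal (ρ i x))
      = (volume : Measure (∀ i, E i)).withDensity
        fun y => ENNReal.ofReal (∏ i, ρ i (y i)) := by
  have : ∀ i, IsFiniteMeasure
      ((volume : Measure (E i)).withDensity fun x => ENNReal.ofReal (ρ i x)) := fun i =>
    isFiniteMeasure_withDensity_ofReal (hi i).2
  refine Measure.pi_eq fun s hs => ?_
  have e : (Set.univ.pi s).indicator (fun y => ∏ i, ρ i (y i))
      = fun y : ∀ i, E i => ∏ i, (s i).indicator (ρ i) (y i) := by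
    funext y
    by_cases hy : y ∈ Set.univ.pi s
    · rw [Set.indicator_of_mem hy]
      exact Finset.prod_congr rfl fun i _ => (Set.indicator_of_mem (hy i trivial) _).symm
    · rw [Set.indicator_of_notMem hy]
      simp only [Set.mem_pi, Set.mem_univ, true_implies, not_forall] at hy
      obtain ⟨i, hi⟩ := hy
      exact (Finset.prod_eq_zero (Finset.mem_univ i) (Set.indicator_of_notMem hi _)).symm
  have hI : ∀ i, Integrable ((s i).indicator (ρ i)) := fun i => (hi i).indicator (hs i)
  have hp : MeasurableSet (Set.univ.pi s) := MeasurableSet.univ_pi hs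
  have hJ : Integrable fun y : ∀ i, E i => ∏ i, (s i).indicator (ρ i) (y i) :=
    Integrable.fintype_prod_dep hI
  have hnn : ∀ i x, 0 ≤ (s i).indicator (ρ i) x := fun i x =>
    Set.indicator_nonneg (fun x _ => h0 i x) x
  have k1 : ∀ i, (volume : Measure (E i)).withDensity (fun x => ENNReal.ofReal (ρ i x)) (s i)
      = ENNReal.ofReal (∫ x, (s i).indicator (ρ i) x) := fun i => by
    rw [withDensity_apply _ (hs i), ofReal_integral_eq_lintegral_ofReal (hI i)
      (Filter.Eventually.of_forall (hnn i)), ← lintegral_indicator (hs i)]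
    refine lintegral_congr fun x => ?_
    by_cases hx : x ∈ s i <;> simp [hx]
  rw [withDensity_apply _ hp, ← lintegral_indicator hp, Finset.prod_congr rfl fun i _ => k1 i,
    ← ENNReal.ofReal_prod_of_nonneg fun i _ => integral_nonneg (hnn i),
    ← integral_fintype_prod_volume_eq_prod, ofReal_integral_eq_lintegral_ofReal hJ
      (Filter.Eventually.of_forall fun y => Finset.prod_nonneg fun i _ => hnn i _)]
  refine lintegral_congr fun y => ?_
  rw [← congrFun e y]
  by_cases hy : y ∈ Set.univ.pi s
  · rw [Set.indicator_of_mem hy, Set.indicator_of_mem hy]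
  · rw [Set.indicator_of_notMem hy, Set.indicator_of_notMem hy, ENNReal.ofReal_zero]

/-! ### The joint law and the likelihood as its Lebesgue density. -/

namespace Model

variable {n p : ℕ} (m : Model n p)

theorem isGenerator (i : Fin n) : IsGenerator (m.q i) (m.g i) :=
  ⟨m.q_pos i, m.g_pos i, m.g_diff i, m.g_normalized i⟩

theorem exp_logLik {θ : Fin p → ℝ} (hθ : θ ∈ m.Θ) (y : m.Sample) :
    Real.exp (m.logLik θ y) = ∏ i, density (m.loc i θ) (m.scale i θ) (m.g i) (y i) := by
  rw [logLik, Real.exp_sum]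
  refine Finset.prod_congr rfl fun i _ => ?_
  have hS := m.scale_posDef i θ hθ
  have hg : 0 < m.g i ((y i - m.loc i θ) ⬝ᵥ ((m.scale i θ)⁻¹ *ᵥ (y i - m.loc i θ))) :=
    m.g_pos i _ (by simpa using hS.inv.posSemidef.dotProduct_mulVec_nonneg (y i - m.loc i θ))
  rw [Real.exp_add, Real.exp_log hg, density, Real.sqrt_eq_rpow, ← Real.rpow_neg hS.det_pos.le,
    Real.rpow_def_of_pos hS.det_pos, mul_comm (Real.log _)]

theorem measurable_exp_logLik {θ : Fin p → ℝ} (hθ : θ ∈ m.Θ) :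
    Measurable fun y => Real.exp (m.logLik θ y) := by
  simp only [m.exp_logLik hθ]
  exact Finset.measurable_fun_prod _ fun i _ =>
    ((m.isGenerator i).measurable_density _ (m.scale_posDef i θ hθ)).comp (measurable_pi_apply i)

theorem jointLaw_eq_withDensity {θ : Fin p → ℝ} (hθ : θ ∈ m.Θ) :
    m.jointLaw θ = volume.withDensity fun y => ENNReal.ofReal (Real.exp (m.logLik θ y)) := by
  simp only [m.exp_logLik hθ]
  exact pi_withDensity_ofReal
    (fun i => (m.isGenerator i).integrable_density _ (m.scale_posDef i θ hθ))
    (fun i x => ((m.isGenerator i).density_pos _ (m.scale_posDef i θ hθ) x).le)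

theorem integral_jointLaw {θ : Fin p → ℝ} (hθ : θ ∈ m.Θ) (f : m.Sample → ℝ) :
    ∫ y, f y ∂(m.jointLaw θ) = ∫ y, f y * Real.exp (m.logLik θ y) := by
  rw [m.jointLaw_eq_withDensity hθ, integral_withDensity_eq_integral_toReal_smul
    (m.measurable_exp_logLik hθ).ennreal_ofReal
    (Filter.Eventually.of_forall fun x => ENNReal.ofReal_lt_top)]
  simp only [ENNReal.toReal_ofReal (Real.exp_pos _).le, smul_eq_mul, mul_comm]

theorem integrable_jointLaw {θ : Fin p → ℝ} (hθ : θ ∈ m.Θ) {f : m.Sample → ℝ} :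
    Integrable f (m.jointLaw θ) ↔ Integrable fun y => f y * Real.exp (m.logLik θ y) := by
  rw [m.jointLaw_eq_withDensity hθ, integrable_withDensity_iff_integrable_smul'
    (m.measurable_exp_logLik hθ).ennreal_ofReal
    (Filter.Eventually.of_forall fun x => ENNReal.ofReal_lt_top)]
  simp only [ENNReal.toReal_ofReal (Real.exp_pos _).le, smul_eq_mul, mul_comm]

theorem isProbabilityMeasure_jointLaw {θ : Fin p → ℝ} (hθ : θ ∈ m.Θ) :
    IsProbabilityMeasure (m.jointLaw θ) := by
  have : ∀ i, IsProbabilityMeasure (law (m.loc i θ) (m.scale i θ) (m.g i)) := fun i =>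
    (m.isGenerator i).isProbabilityMeasure_law _ (m.scale_posDef i θ hθ)
  exact inferInstanceAs (IsProbabilityMeasure (Measure.pi _))

/-- The joint law of independent standard elliptical vectors. -/
abbrev stdJointLaw : Measure m.Sample := Measure.pi fun i => stdLaw (m.q i) (m.g i)

/-- The sample with whitened coordinates `x`. -/
def unwhiten (A : ∀ i, Matrix (Fin (m.q i)) (Fin (m.q i)) ℝ) (θ : Fin p → ℝ) (x : m.Sample) :
    m.Sample := fun i => m.loc i θ + A i *ᵥ x i

theorem measurePreserving_unwhiten {θ : Fin p → ℝ} (hθ : θ ∈ m.Θ)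
    {A : ∀ i, Matrix (Fin (m.q i)) (Fin (m.q i)) ℝ} (hA : ∀ i, A i * (A i)ᵀ = m.scale i θ)
    (hu : ∀ i, IsUnit (A i).det) :
    MeasurePreserving (m.unwhiten A θ) m.stdJointLaw (m.jointLaw θ) := by
  have : ∀ i, IsProbabilityMeasure (stdLaw (m.q i) (m.g i)) := fun i =>
    (m.isGenerator i).isProbabilityMeasure
  have hm : ∀ i, Measurable fun x : Fin (m.q i) → ℝ => m.loc i θ + A i *ᵥ x := fun i =>
    measurable_affine _ _
  have hl : ∀ i, Measure.map (fun x : Fin (m.q i) → ℝ => m.loc i θ + A i *ᵥ x)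
      (stdLaw (m.q i) (m.g i)) = law (m.loc i θ) (m.scale i θ) (m.g i) := fun i =>
    ((m.isGenerator i).law_eq_map (m.loc i θ) (m.scale_posDef i θ hθ) (hA i) (hu i)).symm
  have : ∀ i, IsProbabilityMeasure (Measure.map
      (fun x : Fin (m.q i) → ℝ => m.loc i θ + A i *ᵥ x) (stdLaw (m.q i) (m.g i))) := fun i =>
    Measure.isProbabilityMeasure_map (hm i).aemeasurable
  refine ⟨measurable_pi_lambda _ fun i => (hm i).comp (measurable_pi_apply i), ?_⟩
  have h := Measure.pi_map_pi (μ := fun i => stdLaw (m.q i) (m.g i)) fun i => (hm i).aemeasurable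
  simp only [hl] at h
  exact h

end Model

end Elliptical

end

noncomputable section

namespace Elliptical

/-! ### Derivatives of determinants, inverses and traces along a curve. -/

section MatrixCalculus

variable {q : ℕ} {S : ℝ → Matrix (Fin q) (Fin q) ℝ} {S' : Matrix (Fin q) (Fin q) ℝ} {t : ℝ}

/-- Jacobi's formula: the Leibniz expansion is differentiated one column at a time, and Cramer's
rule identifies the determinant with column `i` replaced by that of `S'` as a diagonal entry of
`adjugate * S'`. -/
theorem hasDerivAt_det (h : ∀ a b, HasDerivAt (fun s => S s a b) (S' a b) t) :
    HasDerivAt (fun s => (S s).det) ((S t).adjugate * S').trace t := by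
  have h1 : HasDerivAt (fun s => (S s).det)
      (∑ σ : Equiv.Perm (Fin q), (Equiv.Perm.sign σ : ℝ) *
        ∑ i, (∏ j ∈ Finset.univ.erase i, S t (σ j) j) • S' (σ i) i) t := by
    simp only [det_apply']
    exact HasDerivAt.fun_sum fun σ _ => (HasDerivAt.fun_finsetProd fun i _ => h (σ i) i).const_mul _
  refine h1.congr_deriv ?_
  have h2 : ((S t).adjugate * S').trace = ∑ i, ((S t).updateCol i (S'.col i)).det := by
    rw [trace]
    refine Finset.sum_congr rfl fun i _ => ?_
    rw [← cramer_apply, cramer_eq_adjugate_mulVec]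
    rfl
  rw [h2]
  simp only [det_apply', Finset.mul_sum]
  rw [Finset.sum_comm]
  refine Finset.sum_congr rfl fun i _ => Finset.sum_congr rfl fun σ _ => ?_
  rw [← Finset.mul_prod_erase _ _ (Finset.mem_univ i), updateCol_self, smul_eq_mul, mul_comm (∏ j ∈ _, _)]
  congr 2
  exact Finset.prod_congr rfl fun j hj => by rw [updateCol_ne (Finset.ne_of_mem_erase hj)]

theorem hasDerivAt_log_det (h : ∀ a b, HasDerivAt (fun s => S s a b) (S' a b) t)
    (hd : (S t).det ≠ 0) :
    HasDerivAt (fun s => Real.log (S s).det) (S' * (S t)⁻¹).trace t := by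
  refine ((hasDerivAt_det h).log hd).congr_deriv ?_
  rw [Matrix.inv_def, Matrix.mul_smul, trace_smul, trace_mul_comm, Ring.inverse_eq_inv',
    smul_eq_mul, div_eq_inv_mul]

theorem hasDerivAt_mul_apply {R : ℝ → Matrix (Fin q) (Fin q) ℝ} {R' : Matrix (Fin q) (Fin q) ℝ}
    (h : ∀ a b, HasDerivAt (fun s => S s a b) (S' a b) t)
    (h' : ∀ a b, HasDerivAt (fun s => R s a b) (R' a b) t) (a b : Fin q) :
    HasDerivAt (fun s => (S s * R s) a b) ((S' * R t + S t * R') a b) t := by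
  simp only [Matrix.mul_apply, Matrix.add_apply]
  rw [← Finset.sum_add_distrib]
  exact HasDerivAt.fun_sum fun c _ => (h a c).mul (h' c b)

/-- Differentiability comes from adjugate over determinant. The value is then forced by
differentiating `S S⁻¹ = 1`, valid near `t` because the determinant stays nonzero there. -/
theorem hasDerivAt_inv_apply (h : ∀ a b, HasDerivAt (fun s => S s a b) (S' a b) t)
    (hd : (S t).det ≠ 0) (a b : Fin q) :
    HasDerivAt (fun s => (S s)⁻¹ a b) ((-((S t)⁻¹ * S' * (S t)⁻¹)) a b) t := by
  have h1 : ∀ a b, ∃ D, HasDerivAt (fun s => (S s)⁻¹ a b) D t := fun a b => by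
    have hadj : DifferentiableAt ℝ (fun s => (S s).adjugate a b) t := by
      simp only [adjugate_apply]
      -- An adjugate entry is the determinant of `S` with row `b` replaced by a constant unit
      -- vector, so this row has zero derivative.
      refine (hasDerivAt_det (S' := S'.updateRow b 0) fun c d => ?_).differentiableAt
      by_cases hc : c = b
      · subst hc; simpa using hasDerivAt_const _ _
      · simpa [updateRow_ne hc] using h c d
    have := ((hasDerivAt_det h).differentiableAt.inv hd).mul hadj
    refine ⟨_, (this.hasDerivAt).congr_of_eventuallyEq (Filter.Eventually.of_forall fun s => ?_)⟩
    simp [Matrix.inv_def, Ring.inverse_eq_inv']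
  choose D hD using h1
  have h2 : S' * (S t)⁻¹ + S t * Matrix.of D = 0 := by
    ext a b
    have h3 := hasDerivAt_mul_apply h (R' := Matrix.of D) hD a b
    refine h3.unique ((hasDerivAt_const t ((1 : Matrix (Fin q) (Fin q) ℝ) a b)).congr_of_eventuallyEq ?_)
    have hc := (hasDerivAt_det h).continuousAt.eventually_ne hd
    filter_upwards [hc] with s hs
    rw [mul_nonsing_inv _ (Ne.isUnit hs)]
  have h4 : Matrix.of D = -((S t)⁻¹ * S' * (S t)⁻¹) := by
    have h5 := congrArg (fun X => (S t)⁻¹ * X) (eq_neg_of_add_eq_zero_right h2)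
    rw [nonsing_inv_mul_cancel_left _ _ (Ne.isUnit hd)] at h5
    rw [h5, Matrix.mul_neg, Matrix.mul_assoc]
  rw [← h4]
  exact hD a b

theorem hasDerivAt_trace_mul {R : ℝ → Matrix (Fin q) (Fin q) ℝ} {R' : Matrix (Fin q) (Fin q) ℝ}
    (h : ∀ a b, HasDerivAt (fun s => S s a b) (S' a b) t)
    (h' : ∀ a b, HasDerivAt (fun s => R s a b) (R' a b) t) :
    HasDerivAt (fun s => (S s * R s).trace) (S' * R t + S t * R').trace t := by
  simp only [trace, diag_apply]
  exact HasDerivAt.fun_sum fun a _ => hasDerivAt_mul_apply h h' a a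

theorem hasDerivAt_dotProduct_mulVec {u v : ℝ → Fin q → ℝ} {u' v' : Fin q → ℝ}
    (hu : ∀ a, HasDerivAt (fun s => u s a) (u' a) t)
    (h : ∀ a b, HasDerivAt (fun s => S s a b) (S' a b) t)
    (hv : ∀ a, HasDerivAt (fun s => v s a) (v' a) t) :
    HasDerivAt (fun s => u s ⬝ᵥ (S s *ᵥ v s))
      (u' ⬝ᵥ (S t *ᵥ v t) + u t ⬝ᵥ (S' *ᵥ v t) + u t ⬝ᵥ (S t *ᵥ v')) t := by
  simp only [dotProduct, mulVec]
  rw [← Finset.sum_add_distrib, ← Finset.sum_add_distrib]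
  refine HasDerivAt.fun_sum fun a _ => ?_
  refine ((hu a).mul (HasDerivAt.fun_sum fun b _ => (h a b).mul (hv b))).congr_deriv ?_
  simp only [Finset.sum_add_distrib, Pi.mul_apply]
  ring

end MatrixCalculus

theorem hasDerivAt_pderiv {p : ℕ} {f : (Fin p → ℝ) → ℝ} {θ : Fin p → ℝ}
    (hf : DifferentiableAt ℝ f θ) (r : Fin p) :
    HasDerivAt (fun t : ℝ => f (θ + t • Pi.single r 1)) (pderiv r f θ) 0 :=
  hf.lineDifferentiableAt.hasLineDerivAt

theorem pderiv_eq_of_hasDerivAt {p : ℕ} {f : (Fin p → ℝ) → ℝ} {θ : Fin p → ℝ} {r : Fin p} {f' : ℝ}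
    (hf : HasDerivAt (fun t : ℝ => f (θ + t • Pi.single r 1)) f' 0) : pderiv r f θ = f' :=
  HasLineDerivAt.lineDeriv hf

theorem line_eventually_mem {p : ℕ} {s : Set (Fin p → ℝ)} {θ : Fin p → ℝ} (hs : s ∈ 𝓝 θ)
    (r : Fin p) : ∀ᶠ t : ℝ in 𝓝 0, θ + t • (Pi.single r 1 : Fin p → ℝ) ∈ s := by
  have hc : ContinuousAt (fun t : ℝ => θ + t • (Pi.single r 1 : Fin p → ℝ)) 0 := by fun_prop
  exact hc (by simpa using hs)

/-! ### The score and its whitened form. -/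

namespace Model

variable {n p : ℕ} (m : Model n p)

theorem hasDerivAt_loc {θ : Fin p → ℝ} (hθ : θ ∈ m.Θ) (i : Fin n) (r : Fin p) (a : Fin (m.q i)) :
    HasDerivAt (fun t : ℝ => m.loc i (θ + t • Pi.single r 1) a) (m.a i r θ a) 0 :=
  hasDerivAt_pderiv ((m.loc_diff i a).differentiableAt (m.isOpen_Θ.mem_nhds hθ)) r

theorem hasDerivAt_scale {θ : Fin p → ℝ} (hθ : θ ∈ m.Θ) (i : Fin n) (r : Fin p)
    (a b : Fin (m.q i)) :
    HasDerivAt (fun t : ℝ => m.scale i (θ + t • Pi.single r 1) a b) (m.C i r θ a b) 0 :=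
  hasDerivAt_pderiv ((m.scale_diff i a b).differentiableAt (m.isOpen_Θ.mem_nhds hθ)) r

theorem scale_isSymm {θ : Fin p → ℝ} (hθ : θ ∈ m.Θ) (i : Fin n) : (m.scale i θ).IsSymm := by
  have := (m.scale_posDef i θ hθ).isHermitian
  rwa [IsHermitian, conjTranspose_eq_transpose_of_trivial] at this

theorem C_isSymm {θ : Fin p → ℝ} (hθ : θ ∈ m.Θ) (i : Fin n) (r : Fin p) :
    (m.C i r θ).IsSymm := by
  ext a b
  refine (m.hasDerivAt_scale hθ i r b a).unique
    ((m.hasDerivAt_scale hθ i r a b).congr_of_eventuallyEq ?_)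
  filter_upwards [line_eventually_mem (m.isOpen_Θ.mem_nhds hθ) r] with t ht
  exact (m.scale_isSymm ht i).apply _ _

/-- The contribution of the observation `i` to the score. -/
def scoreTerm (i : Fin n) (r : Fin p) (θ : Fin p → ℝ) (y : Fin (m.q i) → ℝ) : ℝ :=
  -(m.tr i r θ / 2) - W (m.g i) ((y - m.loc i θ) ⬝ᵥ ((m.scale i θ)⁻¹ *ᵥ (y - m.loc i θ))) *
    (2 * (m.a i r θ ⬝ᵥ ((m.scale i θ)⁻¹ *ᵥ (y - m.loc i θ))) +
      qf (m.C i r θ) ((m.scale i θ)⁻¹ *ᵥ (y - m.loc i θ)))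

theorem measurable_scoreTerm (i : Fin n) (r : Fin p) (θ : Fin p → ℝ) :
    Measurable (m.scoreTerm i r θ) := by
  refine Measurable.const_sub (Measurable.mul ((measurable_W _).comp ?_) ?_) _
  · exact Continuous.measurable (by fun_prop)
  · refine Continuous.measurable (Continuous.add (by fun_prop) ?_)
    exact (continuous_qf _).comp (by fun_prop)

/-- The condition `y_i ≠ μ_i` makes `u_i` positive, the range where `g_i` is assumed differentiable.
The excluded points are null by `ae_ne_loc`. -/
theorem U_eq_sum {θ : Fin p → ℝ} (hθ : θ ∈ m.Θ) (r : Fin p) {y : m.Sample}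
    (hy : ∀ i, y i ≠ m.loc i θ) : m.U r θ y = ∑ i, m.scoreTerm i r θ (y i) := by
  refine pderiv_eq_of_hasDerivAt ?_
  simp only [logLik]
  refine HasDerivAt.fun_sum fun i _ => ?_
  have hS := m.scale_posDef i θ hθ
  have hP := m.scale_isSymm hθ i
  have hd : (m.scale i (θ + (0 : ℝ) • Pi.single r 1)).det ≠ 0 := by simpa using hS.det_pos.ne'
  have hz : ∀ a, HasDerivAt (fun t : ℝ => (y i - m.loc i (θ + t • Pi.single r 1)) a)
      ((-m.a i r θ) a) 0 := fun a => by
    simpa using (m.hasDerivAt_loc hθ i r a).const_sub (y i a)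
  have hu := hasDerivAt_dotProduct_mulVec hz
    (hasDerivAt_inv_apply (m.hasDerivAt_scale hθ i r) hd) hz
  have hpos : 0 < (y i - m.loc i θ) ⬝ᵥ ((m.scale i θ)⁻¹ *ᵥ (y i - m.loc i θ)) := by
    simpa using hS.inv.dotProduct_mulVec_pos (sub_ne_zero.2 (hy i))
  have hg := ((m.isGenerator i).hasDerivAt (u := (y i - m.loc i (θ + (0 : ℝ) • Pi.single r 1)) ⬝ᵥ
    ((m.scale i (θ + (0 : ℝ) • Pi.single r 1))⁻¹ *ᵥ
      (y i - m.loc i (θ + (0 : ℝ) • Pi.single r 1)))) (by simpa using hpos)).comp 0 hu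
  have hl := hg.log (by
    have := (m.g_pos i _ hpos.le).ne'
    simpa using this)
  have hdet := (hasDerivAt_log_det (m.hasDerivAt_scale hθ i r) hd).const_mul (-(1 / 2))
  refine (hdet.add hl).congr_deriv ?_
  simp only [Function.comp_apply, zero_smul, add_zero]
  have hgp := (m.g_pos i _ hpos.le).ne'
  rw [scoreTerm, tr]
  set z := y i - m.loc i θ
  set P := (m.scale i θ)⁻¹
  have hPs : Pᵀ = P := by rw [transpose_nonsing_inv, hP.eq]
  have e1 : z ⬝ᵥ (P *ᵥ (-m.a i r θ)) = -(m.a i r θ ⬝ᵥ (P *ᵥ z)) := by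
    rw [mulVec_neg, dotProduct_neg, dotProduct_mulVec, ← mulVec_transpose, hPs, dotProduct_comm]
  have e2 : z ⬝ᵥ (-(P * m.C i r θ * P) *ᵥ z) = -qf (m.C i r θ) (P *ᵥ z) := by
    rw [qf, neg_mulVec, dotProduct_neg, ← mulVec_mulVec, ← mulVec_mulVec, dotProduct_mulVec,
      ← mulVec_transpose, hPs]
  rw [e1, e2, neg_dotProduct]
  field_simp
  ring

theorem ae_ne_loc (θ : Fin p → ℝ) :
    ∀ᵐ y ∂(volume : Measure m.Sample), ∀ i, y i ≠ m.loc i θ := by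
  rw [ae_all_iff]
  intro i
  have : Nonempty (Fin (m.q i)) := ⟨⟨0, m.q_pos i⟩⟩
  have h := (Measure.quasiMeasurePreserving_eval
    (fun i => (volume : Measure (Fin (m.q i) → ℝ))) i).ae (p := fun x => x ≠ m.loc i θ)
    (Measure.ae_ne _ _)
  exact h

theorem ae_U_eq_sum {θ : Fin p → ℝ} (hθ : θ ∈ m.Θ) :
    ∀ᵐ y ∂(volume : Measure m.Sample), ∀ r, m.U r θ y = ∑ i, m.scoreTerm i r θ (y i) := by
  filter_upwards [m.ae_ne_loc θ] with y hy r
  exact m.U_eq_sum hθ r hy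

/-- A directional derivative taken separately for each `y` has no evident measurability in `y`; the
almost everywhere formula for the score supplies it. -/
theorem aestronglyMeasurable_U {θ : Fin p → ℝ} (hθ : θ ∈ m.Θ) (r : Fin p) :
    AEStronglyMeasurable (m.U r θ) volume := by
  have hm : Measurable fun y : m.Sample => ∑ i, m.scoreTerm i r θ (y i) :=
    Finset.measurable_fun_sum _ fun i _ =>
      (m.measurable_scoreTerm i r θ).comp (measurable_pi_apply i)
  refine hm.aestronglyMeasurable.congr ?_
  filter_upwards [m.ae_U_eq_sum hθ] with y hy
  exact (hy r).symm

/-- The whitened derivative of the location. -/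
def whiteLoc (A : ∀ i, Matrix (Fin (m.q i)) (Fin (m.q i)) ℝ) (i : Fin n) (r : Fin p)
    (θ : Fin p → ℝ) : Fin (m.q i) → ℝ := (A i)⁻¹ *ᵥ m.a i r θ

/-- The whitened derivative of the scale matrix. -/
def whiteScale (A : ∀ i, Matrix (Fin (m.q i)) (Fin (m.q i)) ℝ) (i : Fin n) (r : Fin p)
    (θ : Fin p → ℝ) : Matrix (Fin (m.q i)) (Fin (m.q i)) ℝ :=
  (A i)⁻¹ * m.C i r θ * ((A i)⁻¹)ᵀ

section White

variable {m} {θ : Fin p → ℝ} {A : ∀ i, Matrix (Fin (m.q i)) (Fin (m.q i)) ℝ}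

theorem inv_scale_eq (hA : ∀ i, A i * (A i)ᵀ = m.scale i θ) (i : Fin n) :
    (m.scale i θ)⁻¹ = ((A i)⁻¹)ᵀ * (A i)⁻¹ := by
  rw [← hA i, Matrix.mul_inv_rev, transpose_nonsing_inv]

theorem whiteScale_isSymm (hθ : θ ∈ m.Θ) (i : Fin n) (r : Fin p) :
    (m.whiteScale A i r θ).IsSymm := by
  rw [IsSymm, whiteScale, transpose_mul, transpose_mul, transpose_transpose,
    (m.C_isSymm hθ i r).eq, Matrix.mul_assoc]

theorem trace_whiteScale (hA : ∀ i, A i * (A i)ᵀ = m.scale i θ) (i : Fin n) (r : Fin p) :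
    (m.whiteScale A i r θ).trace = m.tr i r θ := by
  rw [whiteScale, tr, inv_scale_eq hA, trace_mul_comm, ← Matrix.mul_assoc, trace_mul_comm]

theorem scoreTerm_unwhiten (hA : ∀ i, A i * (A i)ᵀ = m.scale i θ)
    (hu : ∀ i, IsUnit (A i).det) (x : m.Sample) (i : Fin n) (r : Fin p) :
    m.scoreTerm i r θ (m.unwhiten A θ x i)
      = scoreOdd (m.g i) (m.whiteLoc A i r θ) (x i)
        + scoreEven (m.g i) (m.whiteScale A i r θ) (x i) := by
  have e0 : m.unwhiten A θ x i - m.loc i θ = A i *ᵥ x i := add_sub_cancel_left _ _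
  have e1 : (m.scale i θ)⁻¹ *ᵥ (A i *ᵥ x i) = ((A i)⁻¹)ᵀ *ᵥ x i := by
    rw [inv_scale_eq hA, mulVec_mulVec, Matrix.mul_assoc, nonsing_inv_mul _ (hu i),
      Matrix.mul_one]
  have e2 : m.a i r θ ⬝ᵥ (((A i)⁻¹)ᵀ *ᵥ x i) = m.whiteLoc A i r θ ⬝ᵥ x i := by
    rw [whiteLoc, dotProduct_mulVec, vecMul_transpose]
  have e3 : qf (m.C i r θ) (((A i)⁻¹)ᵀ *ᵥ x i) = qf (m.whiteScale A i r θ) (x i) := by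
    rw [qf, qf, whiteScale, ← mulVec_mulVec, ← mulVec_mulVec, dotProduct_mulVec (x i),
      ← mulVec_transpose]
  rw [scoreTerm, e0, quadForm_whitening (hA i) (hu i), e1, e2, e3, scoreOdd, scoreEven,
    trace_whiteScale hA]
  ring

end White

end Model

end Elliptical

end

noncomputable section

namespace Elliptical

/-! ### The Fisher information and the third moment of the score. -/

namespace Model

variable {n p : ℕ} (m : Model n p)

/-- The precision matrix `Σ_i⁻¹`. -/
abbrev prec (i : Fin n) (θ : Fin p → ℝ) : Matrix (Fin (m.q i)) (Fin (m.q i)) ℝ := (m.scale i θ)⁻¹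

/-- `a_{i(r)}ᵀ Σ_i⁻¹ a_{i(s)}`. -/
def locDot (i : Fin n) (r s : Fin p) (θ : Fin p → ℝ) : ℝ :=
  m.a i r θ ⬝ᵥ (m.prec i θ *ᵥ m.a i s θ)

/-- `a_{i(r)}ᵀ Σ_i⁻¹ C_{i(t)} Σ_i⁻¹ a_{i(s)}`. -/
def locScaleDot (i : Fin n) (r t s : Fin p) (θ : Fin p → ℝ) : ℝ :=
  m.a i r θ ⬝ᵥ ((m.prec i θ * m.C i t θ * m.prec i θ) *ᵥ m.a i s θ)

/-- `tr(C_{i(r)} Σ_i⁻¹ C_{i(s)} Σ_i⁻¹)`. -/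
def tr₂ (i : Fin n) (r s : Fin p) (θ : Fin p → ℝ) : ℝ :=
  (m.C i r θ * m.prec i θ * (m.C i s θ * m.prec i θ)).trace

/-- `tr(C_{i(r)} Σ_i⁻¹ C_{i(s)} Σ_i⁻¹ C_{i(t)} Σ_i⁻¹)`. -/
def tr₃ (i : Fin n) (r s t : Fin p) (θ : Fin p → ℝ) : ℝ :=
  (m.C i r θ * m.prec i θ * (m.C i s θ * m.prec i θ) * (m.C i t θ * m.prec i θ)).trace

/-- The contribution of the observation `i` to the Fisher information. -/
def infoTerm (i : Fin n) (r s : Fin p) (θ : Fin p → ℝ) : ℝ :=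
  m.k₁ i * m.locDot i r s θ + m.c i / 2 * m.tr₂ i r s θ
    + (m.c i - 1) / 4 * (m.tr i r θ * m.tr i s θ)

/-- The contribution of the observation `i` to `E(U_r U_s U_t)`. -/
def cubicTerm (i : Fin n) (r s t : Fin p) (θ : Fin p → ℝ) : ℝ :=
  -((m.omega i + 3 / 8 * m.c i - 1 / 4) * (m.tr i r θ * m.tr i s θ * m.tr i t θ)
    + (2 * m.omega i + m.c i / 4) * (m.tr i r θ * m.tr₂ i s t θ + m.tr i s θ * m.tr₂ i r t θ
      + m.tr i t θ * m.tr₂ i r s θ)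
    + 8 * m.omega i * m.tr₃ i r s t θ
    + (m.cStar i + m.k₁ i) / 2 * (m.tr i t θ * m.locDot i r s θ + m.tr i s θ * m.locDot i r t θ
      + m.tr i r θ * m.locDot i s t θ)
    + m.cStar i * (m.locScaleDot i r t s θ + m.locScaleDot i r s t θ + m.locScaleDot i s r t θ))

section White

variable {m} {θ : Fin p → ℝ} {A : ∀ i, Matrix (Fin (m.q i)) (Fin (m.q i)) ℝ}

theorem whiteLoc_dotProduct (hA : ∀ i, A i * (A i)ᵀ = m.scale i θ) (i : Fin n) (r s : Fin p) :
    m.whiteLoc A i r θ ⬝ᵥ m.whiteLoc A i s θ = m.locDot i r s θ := by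
  rw [locDot, prec, inv_scale_eq hA, ← mulVec_mulVec, dotProduct_mulVec, vecMul_transpose]
  rfl

theorem whiteLoc_whiteScale_dotProduct (hA : ∀ i, A i * (A i)ᵀ = m.scale i θ) (i : Fin n)
    (r t s : Fin p) :
    m.whiteLoc A i r θ ⬝ᵥ (m.whiteScale A i t θ *ᵥ m.whiteLoc A i s θ)
      = m.locScaleDot i r t s θ := by
  rw [locScaleDot, prec, inv_scale_eq hA, whiteLoc, whiteLoc, whiteScale, mulVec_mulVec]
  simp only [Matrix.mul_assoc]
  rw [← mulVec_mulVec (m.a i s θ) ((A i)⁻¹)ᵀ, dotProduct_mulVec (m.a i r θ), vecMul_transpose]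

theorem trace_whiteScale_mul (hA : ∀ i, A i * (A i)ᵀ = m.scale i θ) (i : Fin n) (r s : Fin p) :
    (m.whiteScale A i r θ * m.whiteScale A i s θ).trace = m.tr₂ i r s θ := by
  rw [tr₂, prec, inv_scale_eq hA, whiteScale, whiteScale]
  simp only [Matrix.mul_assoc]
  rw [trace_mul_comm]
  simp only [Matrix.mul_assoc]

theorem trace_whiteScale_mul_mul (hA : ∀ i, A i * (A i)ᵀ = m.scale i θ) (i : Fin n)
    (r s t : Fin p) :
    (m.whiteScale A i r θ * m.whiteScale A i s θ * m.whiteScale A i t θ).trace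
      = m.tr₃ i r s t θ := by
  rw [tr₃, prec, inv_scale_eq hA, whiteScale, whiteScale, whiteScale]
  simp only [Matrix.mul_assoc]
  rw [trace_mul_comm]
  simp only [Matrix.mul_assoc]

end White

theorem jointLaw_absolutelyContinuous {θ : Fin p → ℝ} (hθ : θ ∈ m.Θ) :
    m.jointLaw θ ≪ volume := by
  rw [m.jointLaw_eq_withDensity hθ]
  exact withDensity_absolutelyContinuous _ _

theorem exists_whitening_scale {θ : Fin p → ℝ} (hθ : θ ∈ m.Θ) :
    ∃ A : ∀ i, Matrix (Fin (m.q i)) (Fin (m.q i)) ℝ,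
      (∀ i, A i * (A i)ᵀ = m.scale i θ) ∧ ∀ i, IsUnit (A i).det := by
  choose A hA using fun i => exists_whitening (m.scale_posDef i θ hθ)
  exact ⟨A, fun i => (hA i).1, fun i => (hA i).2⟩

theorem measurable_score {θ : Fin p → ℝ} (r : Fin p) :
    Measurable fun y : m.Sample => ∑ i, m.scoreTerm i r θ (y i) :=
  Finset.measurable_fun_sum _ fun i _ =>
    (m.measurable_scoreTerm i r θ).comp (measurable_pi_apply i)

/-- Proved at every point of `Θ`, not only at the regular one, so that it can later be
differentiated in `θ`. -/
theorem fisher_eq (h21 : ∀ i, PsiFinite (m.q i) (m.g i) 2 1)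
    (h22 : ∀ i, PsiFinite (m.q i) (m.g i) 2 2) {θ : Fin p → ℝ} (hθ : θ ∈ m.Θ) (r s : Fin p) :
    m.fisher θ r s = ∑ i, m.infoTerm i r s θ := by
  obtain ⟨A, hA, hu⟩ := m.exists_whitening_scale hθ
  have hG := m.isGenerator
  have : ∀ i, IsProbabilityMeasure (stdLaw (m.q i) (m.g i)) := fun i =>
    (hG i).isProbabilityMeasure
  have hmp := m.measurePreserving_unwhiten hθ hA hu
  have h1 : m.fisher θ r s = ∫ x, (∑ i, (scoreOdd (m.g i) (m.whiteLoc A i r θ) (x i)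
        + scoreEven (m.g i) (m.whiteScale A i r θ) (x i)))
      * (∑ i, (scoreOdd (m.g i) (m.whiteLoc A i s θ) (x i)
        + scoreEven (m.g i) (m.whiteScale A i s θ) (x i))) ∂m.stdJointLaw := by
    have e : m.fisher θ r s = ∫ y, (∑ i, m.scoreTerm i r θ (y i)) *
        (∑ i, m.scoreTerm i s θ (y i)) ∂(m.jointLaw θ) := by
      refine integral_congr_ae ?_
      filter_upwards [(m.jointLaw_absolutelyContinuous hθ).ae_le (m.ae_U_eq_sum hθ)] with y hy
      rw [hy, hy]
    rw [e, ← hmp.map_eq, integral_map hmp.measurable.aemeasurable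
      (by exact ((m.measurable_score r).mul (m.measurable_score s)).aestronglyMeasurable)]
    simp only [scoreTerm_unwhiten hA hu]
  have hL : ∀ r i, MemLp (fun x => scoreOdd (m.g i) (m.whiteLoc A i r θ) x
      + scoreEven (m.g i) (m.whiteScale A i r θ) x) 2 (stdLaw (m.q i) (m.g i)) := fun r i =>
    (IsGenerator.memLp_scoreOdd (h21 i) _).add ((hG i).memLp_scoreEven (h22 i) _)
  rw [h1]
  refine (integral_sum_mul_sum
    (X := fun i x => scoreOdd (m.g i) (m.whiteLoc A i r θ) x
      + scoreEven (m.g i) (m.whiteScale A i r θ) x)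
    (Y := fun i x => scoreOdd (m.g i) (m.whiteLoc A i s θ) x
      + scoreEven (m.g i) (m.whiteScale A i s θ) x)
    (fun i => (hL r i).integrable one_le_two)
    (fun i => (hL s i).integrable one_le_two)
    (fun i => (hL r i).integrable_mul (hL s i))
    (fun i => by
      rw [integral_add ((hG i).integrable_scoreOdd (h21 i) _)
        ((hG i).integrable_scoreEven (h22 i) _), (hG i).integral_scoreOdd,
        (hG i).integral_scoreEven (h22 i), add_zero])).trans ?_
  refine Finset.sum_congr rfl fun i _ => ?_
  rw [(hG i).integral_score_mul_score (h21 i) (h22 i) _ _ _ (whiteScale_isSymm hθ i r)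
    (whiteScale_isSymm hθ i s), whiteLoc_dotProduct hA, trace_whiteScale_mul hA,
    trace_whiteScale hA, trace_whiteScale hA]
  rfl

/-- The assumed moments do not directly control a product of three odd parts, which is of order
`|W|³ r^{3/2}`. Integrability of the whole product is therefore a hypothesis, supplied by
regularity, and parity is applied to the whole product instead of term by term. -/
theorem integral_U_mul_U_mul_U (h21 : ∀ i, PsiFinite (m.q i) (m.g i) 2 1)
    (h22 : ∀ i, PsiFinite (m.q i) (m.g i) 2 2) (h32 : ∀ i, PsiFinite (m.q i) (m.g i) 3 2)
    (h33 : ∀ i, PsiFinite (m.q i) (m.g i) 3 3) {θ : Fin p → ℝ} (hθ : θ ∈ m.Θ) (r s t : Fin p)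
    (hi : Integrable (fun y => m.U r θ y * m.U s θ y * m.U t θ y) (m.jointLaw θ)) :
    ∫ y, m.U r θ y * m.U s θ y * m.U t θ y ∂(m.jointLaw θ) = ∑ i, m.cubicTerm i r s t θ := by
  obtain ⟨A, hA, hu⟩ := m.exists_whitening_scale hθ
  have hG := m.isGenerator
  have : ∀ i, IsProbabilityMeasure (stdLaw (m.q i) (m.g i)) := fun i =>
    (hG i).isProbabilityMeasure
  have hmp := m.measurePreserving_unwhiten hθ hA hu
  set O : Fin p → m.Sample → ℝ := fun r x =>
    ∑ i, scoreOdd (m.g i) (m.whiteLoc A i r θ) (x i) with hO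
  set E : Fin p → m.Sample → ℝ := fun r x =>
    ∑ i, scoreEven (m.g i) (m.whiteScale A i r θ) (x i) with hE
  set f : m.Sample → ℝ := fun x => (O r x + E r x) * (O s x + E s x) * (O t x + E t x) with hf
  have hae : (fun y => m.U r θ y * m.U s θ y * m.U t θ y) =ᵐ[m.jointLaw θ] fun y =>
      (∑ i, m.scoreTerm i r θ (y i)) * (∑ i, m.scoreTerm i s θ (y i)) *
        ∑ i, m.scoreTerm i t θ (y i) := by
    filter_upwards [(m.jointLaw_absolutelyContinuous hθ).ae_le (m.ae_U_eq_sum hθ)] with y hy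
    rw [hy, hy, hy]
  have hcomp : ∀ x, (fun y : m.Sample => (∑ i, m.scoreTerm i r θ (y i)) *
      (∑ i, m.scoreTerm i s θ (y i)) * ∑ i, m.scoreTerm i t θ (y i)) (m.unwhiten A θ x) = f x :=
    fun x => by simp only [scoreTerm_unwhiten hA hu, Finset.sum_add_distrib, hf, hO, hE]
  have hms : AEStronglyMeasurable (fun y : m.Sample => (∑ i, m.scoreTerm i r θ (y i)) *
      (∑ i, m.scoreTerm i s θ (y i)) * ∑ i, m.scoreTerm i t θ (y i)) (m.jointLaw θ) :=
    (((m.measurable_score r).mul (m.measurable_score s)).mul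
      (m.measurable_score t)).aestronglyMeasurable
  have h1 : ∫ y, m.U r θ y * m.U s θ y * m.U t θ y ∂(m.jointLaw θ) = ∫ x, f x ∂m.stdJointLaw := by
    rw [integral_congr_ae hae, ← hmp.map_eq, integral_map hmp.measurable.aemeasurable
      (by rw [hmp.map_eq]; exact hms)]
    exact integral_congr_ae (Filter.Eventually.of_forall hcomp)
  have hfi : Integrable f m.stdJointLaw :=
    ((hmp.integrable_comp hms).2 (hi.congr hae)).congr (Filter.Eventually.of_forall hcomp)
  have hneg : MeasurePreserving (fun (x : m.Sample) i => -x i) m.stdJointLaw m.stdJointLaw :=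
    measurePreserving_pi _ _ fun i => (hG i).measurePreserving_neg
  have hOn : ∀ r x, O r (fun i => -x i) = -O r x := fun r x => by
    simp only [hO, scoreOdd_neg, Finset.sum_neg_distrib]
  have hEn : ∀ r x, E r (fun i => -x i) = E r x := fun r x => by
    simp only [hE, scoreEven_neg]
  have hfn : Integrable (fun x => f fun i => -x i) m.stdJointLaw :=
    (hneg.integrable_comp hfi.aestronglyMeasurable).2 hfi
  have hfe : ∫ x, f (fun i => -x i) ∂m.stdJointLaw = ∫ x, f x ∂m.stdJointLaw := by
    conv_rhs => rw [← hneg.map_eq]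
    rw [integral_map hneg.measurable.aemeasurable
      (by rw [hneg.map_eq]; exact hfi.aestronglyMeasurable)]
  have lO : ∀ r i, MemLp (scoreOdd (m.g i) (m.whiteLoc A i r θ)) 2 (stdLaw (m.q i) (m.g i)) :=
    fun r i => IsGenerator.memLp_scoreOdd (h21 i) _
  have lE : ∀ r i, MemLp (scoreEven (m.g i) (m.whiteScale A i r θ)) 2
    (stdLaw (m.q i) (m.g i)) := fun r i => (hG i).memLp_scoreEven (h22 i) _
  have iO := fun r i => (lO r i).integrable one_le_two
  have iE := fun r i => (lE r i).integrable one_le_two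
  have zO : ∀ r i, ∫ x, scoreOdd (m.g i) (m.whiteLoc A i r θ) x ∂(stdLaw (m.q i) (m.g i)) = 0 :=
    fun r i => (hG i).integral_scoreOdd _
  have zE : ∀ r i, ∫ x, scoreEven (m.g i) (m.whiteScale A i r θ) x ∂(stdLaw (m.q i) (m.g i)) = 0 :=
    fun r i => (hG i).integral_scoreEven (h22 i) _
  have hsym : ∀ r i, (m.whiteScale A i r θ).IsSymm := fun r i => whiteScale_isSymm hθ i r
  have tE := fun i => (hG i).integrable_scoreEven_mul_mul (h22 i) (h33 i) (hsym r i) (hsym s i)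
    (hsym t i)
  have tO := fun r s t i => (hG i).integrable_scoreOdd_mul_mul (h21 i) (h32 i)
    (m.whiteLoc A i r θ) (m.whiteLoc A i s θ) (hsym t i)
  have kE := integral_sum_mul_sum_mul_sum (iE r) (iE s) (iE t)
    (fun i => (lE r i).integrable_mul (lE s i)) (fun i => (lE r i).integrable_mul (lE t i))
    (fun i => (lE s i).integrable_mul (lE t i)) (fun i => (tE i).1) (zE r) (zE s) (zE t)
  have kO := fun r s t => integral_sum_mul_sum_mul_sum (iO r) (iO s) (iE t)
    (fun i => (lO r i).integrable_mul (lO s i)) (fun i => (lO r i).integrable_mul (lE t i))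
    (fun i => (lO s i).integrable_mul (lE t i)) (fun i => (tO r s t i).1) (zO r) (zO s) (zE t)
  have key : ∫ x, f x ∂m.stdJointLaw = ∫ x, E r x * E s x * E t x ∂m.stdJointLaw
      + (∫ x, O r x * O s x * E t x ∂m.stdJointLaw + (∫ x, O r x * O t x * E s x ∂m.stdJointLaw
        + ∫ x, O s x * O t x * E r x ∂m.stdJointLaw)) := by
    -- Adding the reflected integrand cancels the terms odd in the whole sample pointwise, before
    -- any integral is split; each surviving term is integrable by `kE` or `kO`.
    have e2 : ∫ x, (f x + f fun i => -x i) ∂m.stdJointLaw = 2 * ∫ x, f x ∂m.stdJointLaw := by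
      rw [integral_add hfi hfn, hfe]; ring
    have e3 : ∀ x, (f x + f fun i => -x i) = 2 * (E r x * E s x * E t x
        + (O r x * O s x * E t x + (O r x * O t x * E s x + O s x * O t x * E r x))) := fun x => by
      simp only [hf, hOn, hEn]; ring
    simp only [e3, integral_const_mul] at e2
    have j1 := (kO r t s).1.add (kO s t r).1
    have j2 := (kO r s t).1.add j1
    rw [integral_add kE.1 (by exact j2), integral_add (kO r s t).1 (by exact j1),
      integral_add (kO r t s).1 (kO s t r).1] at e2
    linarith
  rw [h1, key]
  have v1 : ∫ x, E r x * E s x * E t x ∂m.stdJointLaw = _ := kE.2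
  have v2 : ∀ r s t, ∫ x, O r x * O s x * E t x ∂m.stdJointLaw = _ := fun r s t => (kO r s t).2
  rw [v1, v2, v2, v2, ← Finset.sum_add_distrib, ← Finset.sum_add_distrib, ← Finset.sum_add_distrib]
  refine Finset.sum_congr rfl fun i _ => ?_
  rw [(tE i).2, (tO r s t i).2, (tO r t s i).2, (tO s t r i).2]
  simp only [whiteLoc_dotProduct hA, whiteLoc_whiteScale_dotProduct hA, trace_whiteScale_mul hA,
    trace_whiteScale_mul_mul hA, trace_whiteScale hA]
  rw [cubicTerm]
  change -((m.omega i + 3 / 8 * m.c i - 1 / 4) * _ + (2 * m.omega i + m.c i / 4) * _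
    + 8 * m.omega i * _) + (-((m.cStar i + m.k₁ i) / 2 * _ + m.cStar i * _)
    + (-((m.cStar i + m.k₁ i) / 2 * _ + m.cStar i * _)
    + -((m.cStar i + m.k₁ i) / 2 * _ + m.cStar i * _))) = _
  ring

end Model

end Elliptical

end

noncomputable section

namespace Elliptical

/-! ### Partial derivatives and differentiation under the integral. -/

section LineDerivatives

variable {p : ℕ}

theorem hasDerivAt_line_shift {f : (Fin p → ℝ) → ℝ} {θ : Fin p → ℝ} {r : Fin p} {t f' : ℝ}
    (h : HasDerivAt (fun s : ℝ => f (θ + t • Pi.single r 1 + s • Pi.single r 1)) f' 0) :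
    HasDerivAt (fun s : ℝ => f (θ + s • Pi.single r 1)) f' t := by
  have h1 : HasDerivAt (fun s : ℝ => f (θ + t • Pi.single r 1 + s • Pi.single r 1)) f' (t - t) := by
    rwa [sub_self]
  refine (h1.comp_sub_const t t).congr_of_eventuallyEq (Filter.Eventually.of_forall fun s => ?_)
  simp only [add_assoc, ← add_smul, add_sub_cancel]

theorem contDiffAt_pderiv {k : ℕ} {f : (Fin p → ℝ) → ℝ} {θ : Fin p → ℝ}
    (hf : ContDiffAt ℝ (k + 1 : ℕ) f θ) (r : Fin p) : ContDiffAt ℝ k (pderiv r f) θ := by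
  have h1 : ContDiffAt ℝ k (fun ϑ => fderiv ℝ f ϑ (Pi.single r 1)) θ :=
    (hf.fderiv_right (m := k) (by norm_cast)).clm_apply contDiffAt_const
  refine h1.congr_of_eventuallyEq ?_
  filter_upwards [hf.eventually (by simp)] with ϑ hϑ
  exact (hϑ.differentiableAt (by simp)).lineDeriv_eq_fderiv

theorem pderiv_comm {f : (Fin p → ℝ) → ℝ} {θ : Fin p → ℝ} (hf : ContDiffAt ℝ 2 f θ)
    (r s : Fin p) : pderiv s (pderiv r f) θ = pderiv r (pderiv s f) θ := by
  have e : ∀ r, pderiv r f =ᶠ[𝓝 θ] fun ϑ => fderiv ℝ f ϑ (Pi.single r 1) := fun r => by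
    filter_upwards [hf.eventually (by simp)] with ϑ hϑ
    exact (hϑ.differentiableAt (by simp)).lineDeriv_eq_fderiv
  have hd : DifferentiableAt ℝ (fderiv ℝ f) θ :=
    (hf.fderiv_right (m := 1) (by norm_num)).differentiableAt (by simp)
  have h2 : ∀ r s, pderiv s (pderiv r f) θ = fderiv ℝ (fderiv ℝ f) θ (Pi.single s 1)
      (Pi.single r 1) := fun r s => by
    rw [pderiv, (e r).lineDeriv_eq, DifferentiableAt.lineDeriv_eq_fderiv (by fun_prop),
      fderiv_clm_apply hd (by fun_prop)]
    simp
  rw [h2, h2]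
  exact (hf.isSymmSndFDerivAt (by simp)) _ _

/-- Dominated differentiation along a coordinate line. Measurability of `f'` need not be assumed: it
is an almost everywhere limit of difference quotients. -/
theorem hasDerivAt_integral_line {Ω : Type*} [MeasurableSpace Ω] {μ : Measure Ω}
    {V : Set (Fin p → ℝ)} (hV : IsOpen V) (r : Fin p) {f f' : (Fin p → ℝ) → Ω → ℝ} {G : Ω → ℝ}
    (hG : Integrable G μ) (hmeas : ∀ θ ∈ V, AEStronglyMeasurable (f θ) μ)
    (hd : ∀ᵐ y ∂μ, ∀ θ ∈ V,
      HasDerivAt (fun t : ℝ => f (θ + t • Pi.single r 1) y) (f' θ y) 0)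
    (hb : ∀ᵐ y ∂μ, ∀ θ ∈ V, |f' θ y| ≤ G y) {θ : Fin p → ℝ} (hθ : θ ∈ V)
    (hint : Integrable (f θ) μ) :
    Integrable (f' θ) μ ∧
      HasDerivAt (fun t : ℝ => ∫ y, f (θ + t • Pi.single r 1) y ∂μ) (∫ y, f' θ y ∂μ) 0 := by
  classical
  have hs := line_eventually_mem (hV.mem_nhds hθ) r
  have hmeas' : AEStronglyMeasurable (f' θ) μ := by
    -- The quotients are set to zero when the shifted point leaves `V`, where measurability of `f`
    -- is unknown; this does not affect the limit.
    refine aestronglyMeasurable_of_tendsto_ae (𝓝[≠] (0 : ℝ))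
      (f := fun t y => if θ + t • Pi.single r 1 ∈ V then
        t⁻¹ • (f (θ + t • Pi.single r 1) y - f θ y) else 0) (fun t => ?_) ?_
    · by_cases ht : θ + t • (Pi.single r 1 : Fin p → ℝ) ∈ V
      · simp only [ht, if_true]
        exact AEStronglyMeasurable.const_smul ((hmeas _ ht).sub (hmeas _ hθ)) (t⁻¹ : ℝ)
      · simp only [ht, if_false]
        exact aestronglyMeasurable_const
    · filter_upwards [hd] with y hy
      have h1 := hasDerivAt_iff_tendsto_slope_zero.1 (hy θ hθ)
      simp only [zero_add, zero_smul, add_zero] at h1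
      refine h1.congr' ?_
      filter_upwards [nhdsWithin_le_nhds hs] with t ht
      rw [if_pos ht]
  have h := hasDerivAt_integral_of_dominated_loc_of_deriv_le (μ := μ) (x₀ := (0 : ℝ))
    (s := {t : ℝ | θ + t • Pi.single r 1 ∈ V}) (F := fun t y => f (θ + t • Pi.single r 1) y)
    (F' := fun t y => f' (θ + t • Pi.single r 1) y) (bound := G) hs
    (hs.mono fun t ht => hmeas _ ht) (by simpa using hint) (by simpa using hmeas')
    (hb.mono fun y hy t ht => hy _ ht) hG
    (hd.mono fun y hy t ht => hasDerivAt_line_shift (f := fun ϑ => f ϑ y) (hy _ ht))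
  simpa using h

end LineDerivatives

/-! ### Bartlett identities. -/

namespace Model

variable {n p : ℕ} (m : Model n p)

/-- The third moment `E(U_r U_s U_t)` of the score. -/
def cubic (r s t : Fin p) (θ : Fin p → ℝ) : ℝ :=
  ∫ y, m.U r θ y * m.U s θ y * m.U t θ y ∂(m.jointLaw θ)

section Pointwise

variable {m} {θ : Fin p → ℝ} {y : m.Sample} (h : ContDiffAt ℝ 3 (fun ϑ => m.logLik ϑ y) θ)
include h

theorem contDiffAt_U (r : Fin p) : ContDiffAt ℝ 2 (fun ϑ => m.U r ϑ y) θ :=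
  contDiffAt_pderiv (k := 2) (by exact_mod_cast h) r

theorem contDiffAt_U₂ (r s : Fin p) : ContDiffAt ℝ 1 (fun ϑ => m.U₂ r s ϑ y) θ := by
  have := contDiffAt_pderiv (k := 1) (by exact_mod_cast contDiffAt_U h r) s
  exact_mod_cast this

theorem U₂_comm (r s : Fin p) : m.U₂ r s θ y = m.U₂ s r θ y :=
  pderiv_comm (h.of_le (by norm_num)) r s

theorem hasDerivAt_exp_logLik (r : Fin p) :
    HasDerivAt (fun t : ℝ => Real.exp (m.logLik (θ + t • Pi.single r 1) y))
      (m.U r θ y * Real.exp (m.logLik θ y)) 0 := by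
  have h1 := (hasDerivAt_pderiv (h.differentiableAt (by simp)) r).exp
  simp only [zero_smul, add_zero] at h1
  exact h1.congr_deriv (mul_comm _ _)

theorem hasDerivAt_U (r s : Fin p) :
    HasDerivAt (fun t : ℝ => m.U r (θ + t • Pi.single s 1) y) (m.U₂ r s θ y) 0 :=
  hasDerivAt_pderiv ((contDiffAt_U h r).differentiableAt (by simp)) s

theorem hasDerivAt_U₂ (r s t : Fin p) :
    HasDerivAt (fun τ : ℝ => m.U₂ r t (θ + τ • Pi.single s 1) y) (m.U₃ r s t θ y) 0 :=
  hasDerivAt_pderiv ((contDiffAt_U₂ h r t).differentiableAt (by simp)) s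

end Pointwise

/-- All follow from differentiating integrals against `L = e^ℓ` on a neighbourhood `V`: `∫ L = 1`
gives `E U_r = 0`, this gives `E(∂_s U_r + U_r U_s) = 0`, and a further derivative gives the
third-order identity. The derivative of `κ_{r,t}` is obtained likewise, and the last symmetry is
that of the mixed second derivatives of `ℓ`. -/
theorem regular_identities {θ : Fin p → ℝ} (hθ : θ ∈ m.Θ) (hreg : m.IsRegularAt θ) :
    (∀ r s t, Integrable (fun y => m.U r θ y * m.U s θ y * m.U t θ y) (m.jointLaw θ)) ∧
    (∀ r s t, HasDerivAt (fun τ : ℝ => m.fisher (θ + τ • Pi.single s 1) r t)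
      (m.kappa₂₁ r s t θ + m.kappa₂₁ t s r θ + m.cubic r t s θ) 0) ∧
    (∀ r s t, m.kappa₃ r s t θ + m.kappa₂₁ r s t θ + m.kappa₂₁ t s r θ + m.kappa₂₁ r t s θ
      + m.cubic r t s θ = 0) ∧
    ∀ r s t, m.kappa₂₁ r s t θ = m.kappa₂₁ s r t θ := by
  obtain ⟨N, hN, G, hG, hae⟩ := hreg
  obtain ⟨V, hVN, hV, hθV⟩ := mem_nhds_iff.1 (Filter.inter_mem hN (m.isOpen_Θ.mem_nhds hθ))
  have hVΘ : ∀ ϑ ∈ V, ϑ ∈ m.Θ := fun ϑ h => (hVN h).2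
  set L : (Fin p → ℝ) → m.Sample → ℝ := fun ϑ y => Real.exp (m.logLik ϑ y) with hL
  have hL0 : ∀ ϑ y, |L ϑ y| = L ϑ y := fun ϑ y => abs_of_pos (Real.exp_pos _)
  have hreg : ∀ᵐ y ∂(volume : Measure m.Sample), ∀ ϑ ∈ V,
      ContDiffAt ℝ 3 (fun ϑ => m.logLik ϑ y) ϑ ∧ ∀ r s t : Fin p,
        |m.U r ϑ y * L ϑ y| ≤ G y ∧ |m.U₂ r s ϑ y * L ϑ y| ≤ G y ∧
        |m.U r ϑ y * m.U s ϑ y * L ϑ y| ≤ G y ∧ |m.U₃ r s t ϑ y * L ϑ y| ≤ G y ∧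
        |m.U₂ r s ϑ y * m.U t ϑ y * L ϑ y| ≤ G y ∧
        |m.U r ϑ y * m.U s ϑ y * m.U t ϑ y * L ϑ y| ≤ G y := by
    filter_upwards [hae] with y hy ϑ hϑ
    refine ⟨(hy ϑ (hVN hϑ).1).1, fun r s t => ?_⟩
    obtain ⟨h1, h2, h3, h4, h5, h6⟩ := (hy ϑ (hVN hϑ).1).2 r s t
    refine ⟨?_, ?_, ?_, ?_, ?_, ?_⟩ <;> rw [abs_mul, hL0] <;> assumption
  have hLm : ∀ ϑ ∈ V, AEStronglyMeasurable (L ϑ) volume := fun ϑ h =>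
    (m.measurable_exp_logLik (hVΘ ϑ h)).aestronglyMeasurable
  have hLi : ∀ ϑ ∈ V, Integrable (L ϑ) volume ∧ ∫ y, L ϑ y = 1 := fun ϑ h => by
    have := m.isProbabilityMeasure_jointLaw (hVΘ ϑ h)
    have h1 := (m.integrable_jointLaw (hVΘ ϑ h) (f := fun _ => 1)).1 (integrable_const _)
    have h2 := m.integral_jointLaw (hVΘ ϑ h) (fun _ => 1)
    simp only [one_mul] at h1 h2
    exact ⟨h1, by rw [← h2]; simp⟩
  have hUm : ∀ r, ∀ ϑ ∈ V, AEStronglyMeasurable (m.U r ϑ) volume := fun r ϑ h =>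
    m.aestronglyMeasurable_U (hVΘ ϑ h) r
  have zero_of : ∀ {f : (Fin p → ℝ) → m.Sample → ℝ} {c d : ℝ} {r : Fin p} {ϑ : Fin p → ℝ},
      ϑ ∈ V → (∀ ϑ ∈ V, ∫ y, f ϑ y = c) →
      HasDerivAt (fun t : ℝ => ∫ y, f (ϑ + t • Pi.single r 1) y) d 0 → d = 0 :=
    fun {f c d r ϑ} hϑ hc hd => hd.unique ((hasDerivAt_const (0 : ℝ) c).congr_of_eventuallyEq
      ((line_eventually_mem (hV.mem_nhds hϑ) r).mono fun t ht => hc _ ht))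
  have hUL : ∀ r, ∀ ϑ ∈ V, Integrable (fun y => m.U r ϑ y * L ϑ y) volume ∧
      ∫ y, m.U r ϑ y * L ϑ y = 0 := fun r ϑ hϑ => by
    have h := hasDerivAt_integral_line hV r (f := L) (f' := fun ϑ y => m.U r ϑ y * L ϑ y) hG hLm
      (hreg.mono fun y hy ϑ hϑ => hasDerivAt_exp_logLik (hy ϑ hϑ).1 r)
      (hreg.mono fun y hy ϑ hϑ => ((hy ϑ hϑ).2 r r r).1) hϑ (hLi ϑ hϑ).1
    exact ⟨h.1, zero_of hϑ (fun ϑ h => (hLi ϑ h).2) h.2⟩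
  have hBart : ∀ r s, ∀ ϑ ∈ V, Integrable (fun y => (m.U₂ r s ϑ y + m.U r ϑ y * m.U s ϑ y) * L ϑ y)
      volume ∧ ∫ y, (m.U₂ r s ϑ y + m.U r ϑ y * m.U s ϑ y) * L ϑ y = 0 := fun r s ϑ hϑ => by
    have h := hasDerivAt_integral_line hV s (f := fun ϑ y => m.U r ϑ y * L ϑ y)
      (f' := fun ϑ y => (m.U₂ r s ϑ y + m.U r ϑ y * m.U s ϑ y) * L ϑ y) (hG.const_mul 2)
      (fun ϑ h => (hUL r ϑ h).1.aestronglyMeasurable)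
      (hreg.mono fun y hy ϑ hϑ => by
        refine ((hasDerivAt_U (hy ϑ hϑ).1 r s).mul
          (hasDerivAt_exp_logLik (hy ϑ hϑ).1 s)).congr_deriv ?_
        simp only [zero_smul, add_zero, hL]; ring)
      (hreg.mono fun y hy ϑ hϑ => by
        obtain ⟨-, h2, h3, -⟩ := (hy ϑ hϑ).2 r s s
        rw [add_mul]
        exact (abs_add_le _ _).trans (by linarith)) hϑ (hUL r ϑ hϑ).1
    exact ⟨h.1, zero_of hϑ (fun ϑ h => (hUL r ϑ h).2) h.2⟩
  have hUUL : ∀ r s, ∀ ϑ ∈ V, Integrable (fun y => m.U r ϑ y * m.U s ϑ y * L ϑ y) volume :=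
    fun r s ϑ hϑ => hG.mono' (((hUm r ϑ hϑ).mul (hUm s ϑ hϑ)).mul (hLm ϑ hϑ))
      (hreg.mono fun y hy => ((hy ϑ hϑ).2 r s s).2.2.1)
  -- Subtraction from the Bartlett integrand avoids a separate proof that `U₂` is measurable.
  have hU₂L : ∀ r s, ∀ ϑ ∈ V, Integrable (fun y => m.U₂ r s ϑ y * L ϑ y) volume :=
    fun r s ϑ hϑ => ((hBart r s ϑ hϑ).1.sub (hUUL r s ϑ hϑ)).congr
      (Filter.Eventually.of_forall fun y => by simp only [Pi.sub_apply]; ring)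
  have hU₂UL : ∀ r s t, ∀ ϑ ∈ V, Integrable (fun y => m.U₂ r s ϑ y * m.U t ϑ y * L ϑ y) volume :=
    fun r s t ϑ hϑ => by
      refine hG.mono' ?_ (hreg.mono fun y hy => ((hy ϑ hϑ).2 r s t).2.2.2.2.1)
      exact ((hU₂L r s ϑ hϑ).aestronglyMeasurable.mul (hUm t ϑ hϑ)).congr
        (Filter.Eventually.of_forall fun y => by simp only [Pi.mul_apply]; ring)
  have hUUUL : ∀ r s t, ∀ ϑ ∈ V,
      Integrable (fun y => m.U r ϑ y * m.U s ϑ y * m.U t ϑ y * L ϑ y) volume :=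
    fun r s t ϑ hϑ => hG.mono' ((((hUm r ϑ hϑ).mul (hUm s ϑ hϑ)).mul (hUm t ϑ hϑ)).mul (hLm ϑ hϑ))
      (hreg.mono fun y hy => ((hy ϑ hϑ).2 r s t).2.2.2.2.2)
  have hk21 : ∀ r s t, m.kappa₂₁ r s t θ = ∫ y, m.U₂ r s θ y * m.U t θ y * L θ y := fun r s t =>
    m.integral_jointLaw hθ _
  have hcub : ∀ r s t, m.cubic r s t θ = ∫ y, m.U r θ y * m.U s θ y * m.U t θ y * L θ y :=
    fun r s t => m.integral_jointLaw hθ _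
  have hk3 : ∀ r s t, m.kappa₃ r s t θ = ∫ y, m.U₃ r s t θ y * L θ y := fun r s t =>
    m.integral_jointLaw hθ _
  refine ⟨fun r s t => (m.integrable_jointLaw hθ).2 (hUUUL r s t θ hθV), fun r s t => ?_,
    fun r s t => ?_, fun r s t => ?_⟩
  · have h := hasDerivAt_integral_line hV s (f := fun ϑ y => m.U r ϑ y * m.U t ϑ y * L ϑ y)
      (f' := fun ϑ y => m.U₂ r s ϑ y * m.U t ϑ y * L ϑ y + m.U₂ t s ϑ y * m.U r ϑ y * L ϑ y
        + m.U r ϑ y * m.U t ϑ y * m.U s ϑ y * L ϑ y) (hG.const_mul 3)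
      (fun ϑ h => (hUUL r t ϑ h).aestronglyMeasurable)
      (hreg.mono fun y hy ϑ hϑ => by
        refine (((hasDerivAt_U (hy ϑ hϑ).1 r s).mul (hasDerivAt_U (hy ϑ hϑ).1 t s)).mul
          (hasDerivAt_exp_logLik (hy ϑ hϑ).1 s)).congr_deriv ?_
        simp only [zero_smul, add_zero, hL, Pi.mul_apply]; ring)
      (hreg.mono fun y hy ϑ hϑ => by
        have h1 := ((hy ϑ hϑ).2 r s t).2.2.2.2.1
        have h2 := ((hy ϑ hϑ).2 t s r).2.2.2.2.1
        have h3 := ((hy ϑ hϑ).2 r t s).2.2.2.2.2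
        exact (abs_add_three _ _ _).trans (by linarith)) hθV (hUUL r t θ hθV)
    rw [hk21, hk21, hcub, ← integral_add (hU₂UL r s t θ hθV) (hU₂UL t s r θ hθV),
      ← integral_add (by exact (hU₂UL r s t θ hθV).add (hU₂UL t s r θ hθV)) (hUUUL r t s θ hθV)]
    refine h.2.congr_of_eventuallyEq ?_
    filter_upwards [line_eventually_mem (hV.mem_nhds hθV) s] with τ hτ
    exact m.integral_jointLaw (hVΘ _ hτ) _
  -- The second Bartlett identity holds throughout `V`, so the derivative of its left side is zero.
  -- That derivative has five terms, each bounded by `G`, whence the bound `5 G`.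
  · have h := hasDerivAt_integral_line hV s
      (f := fun ϑ y => (m.U₂ r t ϑ y + m.U r ϑ y * m.U t ϑ y) * L ϑ y)
      (f' := fun ϑ y => m.U₃ r s t ϑ y * L ϑ y + (m.U₂ r s ϑ y * m.U t ϑ y * L ϑ y
        + (m.U₂ t s ϑ y * m.U r ϑ y * L ϑ y + (m.U₂ r t ϑ y * m.U s ϑ y * L ϑ y
        + m.U r ϑ y * m.U t ϑ y * m.U s ϑ y * L ϑ y)))) (hG.const_mul 5)
      (fun ϑ h => (hBart r t ϑ h).1.aestronglyMeasurable)
      (hreg.mono fun y hy ϑ hϑ => by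
        refine (((hasDerivAt_U₂ (hy ϑ hϑ).1 r s t).add ((hasDerivAt_U (hy ϑ hϑ).1 r s).mul
          (hasDerivAt_U (hy ϑ hϑ).1 t s))).mul
          (hasDerivAt_exp_logLik (hy ϑ hϑ).1 s)).congr_deriv ?_
        simp only [zero_smul, add_zero, hL, Pi.mul_apply, Pi.add_apply]; ring)
      (hreg.mono fun y hy ϑ hϑ => by
        have h0 := ((hy ϑ hϑ).2 r s t).2.2.2.1
        have h1 := ((hy ϑ hϑ).2 r s t).2.2.2.2.1
        have h2 := ((hy ϑ hϑ).2 t s r).2.2.2.2.1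
        have h3 := ((hy ϑ hϑ).2 r t s).2.2.2.2.1
        have h4 := ((hy ϑ hϑ).2 r t s).2.2.2.2.2
        refine (abs_add_le _ _).trans ?_
        refine (add_le_add_right ((abs_add_le _ _).trans
          (add_le_add_right ((abs_add_le _ _).trans
            (add_le_add_right (abs_add_le _ _) _)) _)) _).trans ?_
        linarith) hθV (hBart r t θ hθV).1
    have h0 := zero_of hθV (fun ϑ h => (hBart r t ϑ h).2) h.2
    have j1 := (hU₂UL r t s θ hθV).add (hUUUL r t s θ hθV)
    have j2 := (hU₂UL t s r θ hθV).add j1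
    have j3 := (hU₂UL r s t θ hθV).add j2
    have hU₃L : Integrable (fun y => m.U₃ r s t θ y * L θ y) volume :=
      (h.1.sub j3).congr (Filter.Eventually.of_forall fun y => by
        simp only [Pi.sub_apply, Pi.add_apply]; ring)
    rw [integral_add hU₃L (by exact j3), integral_add (hU₂UL r s t θ hθV) (by exact j2),
      integral_add (hU₂UL t s r θ hθV) (by exact j1),
      integral_add (hU₂UL r t s θ hθV) (hUUUL r t s θ hθV)] at h0
    rw [hk3, hk21, hk21, hk21, hcub]
    linarith
  · rw [hk21, hk21]
    refine integral_congr_ae (hreg.mono fun y hy => ?_)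
    simp only
    rw [U₂_comm (hy θ hθV).1]

end Model

end Elliptical

end

/-! ### Second derivatives of the parameters and the derivative of the information. -/

noncomputable section

namespace Elliptical

/-- Twice differentiability, without continuity of the second derivatives, is enough: the Fréchet
derivative is a finite combination of the differentiable partial derivatives, hence itself
differentiable, and a second Fréchet derivative is symmetric. -/
theorem pderiv_comm_of_differentiableOn {p : ℕ} {f : (Fin p → ℝ) → ℝ} {s : Set (Fin p → ℝ)}
    (hs : IsOpen s) (hf : DifferentiableOn ℝ f s) (hf' : ∀ r, DifferentiableOn ℝ (pderiv r f) s)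
    {θ : Fin p → ℝ} (hθ : θ ∈ s) (i j : Fin p) :
    pderiv j (pderiv i f) θ = pderiv i (pderiv j f) θ := by
  have hfd : ∀ ϑ ∈ s, DifferentiableAt ℝ f ϑ := fun ϑ h => hf.differentiableAt (hs.mem_nhds h)
  have hpd : ∀ r, ∀ ϑ ∈ s, pderiv r f ϑ = fderiv ℝ f ϑ (Pi.single r 1) := fun r ϑ h =>
    (hfd ϑ h).lineDeriv_eq_fderiv
  have e : ∀ ϑ ∈ s, fderiv ℝ f ϑ = ∑ r, pderiv r f ϑ • ContinuousLinearMap.proj (R := ℝ) r :=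
    fun ϑ h => by
      ext x
      rw [_root_.sum_apply]
      conv_lhs => rw [← Finset.univ_sum_single x, map_sum]
      refine Finset.sum_congr rfl fun r _ => ?_
      rw [hpd r ϑ h]
      have : Pi.single r (x r) = x r • (Pi.single r 1 : Fin p → ℝ) := by
        rw [← Pi.single_smul, smul_eq_mul, mul_one]
      rw [this, map_smul, smul_eq_mul, mul_comm]
      rfl
  have hd : DifferentiableAt ℝ (fderiv ℝ f) θ := by
    have h1 : DifferentiableAt ℝ
        (fun ϑ => ∑ r, pderiv r f ϑ • ContinuousLinearMap.proj (R := ℝ) (φ := fun _ => ℝ) r) θ :=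
      DifferentiableAt.fun_sum fun r _ =>
        ((hf' r).differentiableAt (hs.mem_nhds hθ)).smul_const _
    refine h1.congr_of_eventuallyEq ?_
    filter_upwards [hs.mem_nhds hθ] with ϑ h using e ϑ h
  have hsym := second_derivative_symmetric_of_eventually (f := f) (f' := fderiv ℝ f) (x := θ)
    (by filter_upwards [hs.mem_nhds hθ] with ϑ h using (hfd ϑ h).hasFDerivAt) hd.hasFDerivAt
  have h2 : ∀ i j, pderiv j (pderiv i f) θ = fderiv ℝ (fderiv ℝ f) θ (Pi.single j 1)
      (Pi.single i 1) := fun i j => by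
    have he : pderiv i f =ᶠ[𝓝 θ] fun ϑ => fderiv ℝ f ϑ (Pi.single i 1) := by
      filter_upwards [hs.mem_nhds hθ] with ϑ h using hpd i ϑ h
    rw [pderiv, he.lineDeriv_eq, DifferentiableAt.lineDeriv_eq_fderiv (by fun_prop),
      fderiv_clm_apply hd (by fun_prop)]
    simp
  rw [h2, h2, hsym]

namespace Model

variable {n p : ℕ} (m : Model n p)

/-- The second derivative `∂²μ_i/∂θ_r∂θ_s`. -/
def a₂ (i : Fin n) (r s : Fin p) (θ : Fin p → ℝ) : Fin (m.q i) → ℝ := fun k =>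
  pderiv s (fun ϑ => m.a i r ϑ k) θ

/-- The second derivative `∂²Σ_i/∂θ_r∂θ_s`. -/
def C₂ (i : Fin n) (r s : Fin p) (θ : Fin p → ℝ) : Matrix (Fin (m.q i)) (Fin (m.q i)) ℝ :=
  Matrix.of fun k l => pderiv s (fun ϑ => m.C i r ϑ k l) θ

/-- The information form of the observation `i` on directions in the location-scale space. -/
def infoForm (i : Fin n) (θ : Fin p → ℝ) (u : Fin (m.q i) → ℝ)
    (X : Matrix (Fin (m.q i)) (Fin (m.q i)) ℝ) (v : Fin (m.q i) → ℝ)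
    (Y : Matrix (Fin (m.q i)) (Fin (m.q i)) ℝ) : ℝ :=
  m.k₁ i * (u ⬝ᵥ (m.prec i θ *ᵥ v)) + m.c i / 2 * (X * m.prec i θ * (Y * m.prec i θ)).trace
    + (m.c i - 1) / 4 * ((X * m.prec i θ).trace * (Y * m.prec i θ).trace)

theorem infoTerm_eq_infoForm (i : Fin n) (r s : Fin p) (θ : Fin p → ℝ) :
    m.infoTerm i r s θ = m.infoForm i θ (m.a i r θ) (m.C i r θ) (m.a i s θ) (m.C i s θ) := rfl

/-- The derivative in the direction `s` of the information form at fixed directions `r`, `t`. -/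
def infoFormDeriv (i : Fin n) (r t s : Fin p) (θ : Fin p → ℝ) : ℝ :=
  -(m.k₁ i * m.locScaleDot i r s t θ + m.c i / 2 * (m.tr₃ i r s t θ + m.tr₃ i r t s θ)
    + (m.c i - 1) / 4 * (m.tr₂ i r s θ * m.tr i t θ + m.tr i r θ * m.tr₂ i t s θ))

section Calculus

variable {m} {θ : Fin p → ℝ} (hθ : θ ∈ m.Θ)
include hθ

theorem a₂_comm (i : Fin n) (r s : Fin p) : m.a₂ i r s θ = m.a₂ i s r θ :=
  funext fun k => pderiv_comm_of_differentiableOn m.isOpen_Θ (m.loc_diff i k) (m.loc_diff₂ i k) hθ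
    r s

theorem C₂_comm (i : Fin n) (r s : Fin p) : m.C₂ i r s θ = m.C₂ i s r θ :=
  Matrix.ext fun k l => pderiv_comm_of_differentiableOn m.isOpen_Θ (m.scale_diff i k l)
    (m.scale_diff₂ i k l) hθ r s

theorem hasDerivAt_a (i : Fin n) (r s : Fin p) (k : Fin (m.q i)) :
    HasDerivAt (fun t : ℝ => m.a i r (θ + t • Pi.single s 1) k) (m.a₂ i r s θ k) 0 :=
  hasDerivAt_pderiv ((m.loc_diff₂ i k r).differentiableAt (m.isOpen_Θ.mem_nhds hθ)) s

theorem hasDerivAt_C (i : Fin n) (r s : Fin p) (k l : Fin (m.q i)) :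
    HasDerivAt (fun t : ℝ => m.C i r (θ + t • Pi.single s 1) k l) (m.C₂ i r s θ k l) 0 :=
  hasDerivAt_pderiv ((m.scale_diff₂ i k l r).differentiableAt (m.isOpen_Θ.mem_nhds hθ)) s

theorem prec_isSymm (i : Fin n) : (m.prec i θ).IsSymm := by
  rw [IsSymm, transpose_nonsing_inv, (m.scale_isSymm hθ i).eq]

theorem isUnit_det_scale (i : Fin n) : IsUnit (m.scale i θ).det :=
  (m.scale_posDef i θ hθ).det_pos.ne'.isUnit

theorem locDot_comm (i : Fin n) (r s : Fin p) : m.locDot i r s θ = m.locDot i s r θ := by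
  rw [locDot, dotProduct_mulVec, ← mulVec_transpose, (prec_isSymm hθ i).eq, dotProduct_comm]
  rfl

theorem locScaleDot_comm (i : Fin n) (r t s : Fin p) :
    m.locScaleDot i r t s θ = m.locScaleDot i s t r θ := by
  rw [locScaleDot, dotProduct_mulVec, ← mulVec_transpose, transpose_mul, transpose_mul,
    (prec_isSymm hθ i).eq, (m.C_isSymm hθ i t).eq, dotProduct_comm, ← Matrix.mul_assoc]
  rfl

omit hθ in
theorem tr₂_comm (i : Fin n) (r s : Fin p) : m.tr₂ i r s θ = m.tr₂ i s r θ := trace_mul_comm _ _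

omit hθ in
theorem tr₃_rotate (i : Fin n) (r s t : Fin p) : m.tr₃ i r s t θ = m.tr₃ i t r s θ :=
  trace_mul_cycle _ _ _

/-- A trace is unchanged by transposition, which reverses the order of the symmetric factors.
Together with rotation this makes `tr₃` fully symmetric. -/
theorem tr₃_swap (i : Fin n) (r s t : Fin p) : m.tr₃ i r s t θ = m.tr₃ i r t s θ := by
  rw [tr₃, ← trace_transpose]
  simp only [transpose_mul, (m.C_isSymm hθ i r).eq, (m.C_isSymm hθ i s).eq,
    (m.C_isSymm hθ i t).eq, (prec_isSymm hθ i).eq, tr₃]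
  generalize m.C i r θ = R
  generalize m.C i s θ = S
  generalize m.C i t θ = T
  generalize m.prec i θ = P
  calc (P * T * (P * S * (P * R))).trace = (P * (T * P * S * P * R)).trace := by
        simp only [Matrix.mul_assoc]
    _ = (T * P * S * P * (R * P)).trace := by rw [trace_mul_comm]; simp only [Matrix.mul_assoc]
    _ = _ := by rw [trace_mul_comm]; simp only [Matrix.mul_assoc]

theorem infoForm_comm (i : Fin n) (u v : Fin (m.q i) → ℝ)
    (X Y : Matrix (Fin (m.q i)) (Fin (m.q i)) ℝ) :
    m.infoForm i θ u X v Y = m.infoForm i θ v Y u X := by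
  have h1 : u ⬝ᵥ (m.prec i θ *ᵥ v) = v ⬝ᵥ (m.prec i θ *ᵥ u) := by
    rw [dotProduct_mulVec, ← mulVec_transpose, (prec_isSymm hθ i).eq, dotProduct_comm]
  rw [infoForm, infoForm, h1, trace_mul_comm]
  ring

theorem hasDerivAt_prec (i : Fin n) (s : Fin p) (a b : Fin (m.q i)) :
    HasDerivAt (fun t : ℝ => m.prec i (θ + t • Pi.single s 1) a b)
      ((-(m.prec i θ * m.C i s θ * m.prec i θ)) a b) 0 := by
  have h := hasDerivAt_inv_apply (m.hasDerivAt_scale hθ i s)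
    (by simpa using (isUnit_det_scale hθ i).ne_zero) a b
  simpa using h

theorem hasDerivAt_C_mul_prec (i : Fin n) (r s : Fin p) (a b : Fin (m.q i)) :
    HasDerivAt (fun t : ℝ => (m.C i r (θ + t • Pi.single s 1)
        * m.prec i (θ + t • Pi.single s 1)) a b)
      ((m.C₂ i r s θ * m.prec i θ - m.C i r θ * m.prec i θ * (m.C i s θ * m.prec i θ)) a b) 0 := by
  have h := hasDerivAt_mul_apply (hasDerivAt_C hθ i r s) (hasDerivAt_prec hθ i s) a b
  refine h.congr_deriv ?_
  simp only [zero_smul, add_zero, Matrix.mul_neg, ← sub_eq_add_neg, Matrix.mul_assoc]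

theorem hasDerivAt_tr (i : Fin n) (r s : Fin p) :
    HasDerivAt (fun t : ℝ => m.tr i r (θ + t • Pi.single s 1))
      ((m.C₂ i r s θ * m.prec i θ).trace - m.tr₂ i r s θ) 0 := by
  refine (HasDerivAt.fun_sum (u := Finset.univ) fun a _ =>
    hasDerivAt_C_mul_prec hθ i r s a a).congr_deriv ?_
  rw [tr₂, ← trace_sub]
  rfl

theorem hasDerivAt_infoTerm (i : Fin n) (r t s : Fin p) :
    HasDerivAt (fun τ : ℝ => m.infoTerm i r t (θ + τ • Pi.single s 1))
      (m.infoForm i θ (m.a₂ i r s θ) (m.C₂ i r s θ) (m.a i t θ) (m.C i t θ)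
        + m.infoForm i θ (m.a i r θ) (m.C i r θ) (m.a₂ i t s θ) (m.C₂ i t s θ)
        + m.infoFormDeriv i r t s θ) 0 := by
  have h1 := hasDerivAt_dotProduct_mulVec (hasDerivAt_a hθ i r s) (hasDerivAt_prec hθ i s)
    (hasDerivAt_a hθ i t s)
  have h2 := hasDerivAt_trace_mul (hasDerivAt_C_mul_prec hθ i r s) (hasDerivAt_C_mul_prec hθ i t s)
  have h3 := (hasDerivAt_tr hθ i r s).mul (hasDerivAt_tr hθ i t s)
  refine (((h1.const_mul (m.k₁ i)).add (h2.const_mul (m.c i / 2))).add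
    (h3.const_mul ((m.c i - 1) / 4))).congr_deriv ?_
  simp only [zero_smul, add_zero, infoForm, infoFormDeriv, neg_mulVec, dotProduct_neg,
    Matrix.sub_mul, Matrix.mul_sub, trace_add, trace_sub]
  have e : (m.C i r θ * m.prec i θ * (m.C i t θ * m.prec i θ * (m.C i s θ * m.prec i θ))).trace
      = m.tr₃ i r t s θ := by rw [tr₃]; simp only [Matrix.mul_assoc]
  rw [e]
  simp only [locScaleDot, tr₃, tr]
  ring

end Calculus

/-- The value of `(H_i F_{ij})ᵀ B_{i(r)} (H_i F_{is})`. -/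
def scoreForm (i : Fin n) (j r s : Fin p) (θ : Fin p → ℝ) : ℝ :=
  -(1 / 2) * (m.eta₁ i * m.locScaleDot i j r s θ + m.eta₁ i * m.locScaleDot i j s r θ
      + m.eta₂ i * m.locScaleDot i r j s θ
      + (m.c i - 1) / 2 * (m.tr i j θ * (m.tr₂ i r s θ + 1 / 2 * (m.tr i r θ * m.tr i s θ))))
  - 1 / 4 * (m.eta₁ i * (m.tr i r θ * m.locDot i j s θ + m.locDot i j r θ * m.tr i s θ
        + m.tr i j θ * m.locDot i r s θ)
      + (m.c i + 8 * m.omega i) / 2 * (m.tr₂ i j r θ * m.tr i s θ + m.tr i j θ * m.tr₂ i r s θ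
        + 4 * m.tr₃ i j r s θ
        + m.tr i r θ * (m.tr₂ i j s θ + 1 / 2 * (m.tr i j θ * m.tr i s θ))))

/-- The algebraic core: it is where the coefficients of `B_{i(r)}` must be exactly as they are. Once
`tr₃` is recognized as fully symmetric and the other contractions are put in a common order, both
sides are the same polynomial in the remaining traces and products. -/
theorem scoreForm_add_comm {θ : Fin p → ℝ} (hθ : θ ∈ m.Θ) (i : Fin n) (j s t : Fin p) :
    m.infoFormDeriv i j t s θ + m.infoFormDeriv i j s t θ - m.infoFormDeriv i s t j θ
      + m.cubicTerm i j s t θ = m.scoreForm i j s t θ + m.scoreForm i j t s θ := by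
  have e₁ : m.tr₃ i j t s θ = m.tr₃ i j s t θ := tr₃_swap hθ i j t s
  have e₂ : m.tr₃ i s t j θ = m.tr₃ i j s t θ := m.tr₃_rotate i s t j
  have e₃ : m.tr₃ i s j t θ = m.tr₃ i j s t θ := (tr₃_swap hθ i s j t).trans e₂
  simp only [infoFormDeriv, cubicTerm, scoreForm, eta₁, eta₂, e₁, e₂, e₃, m.tr₂_comm i s j,
    m.tr₂_comm i t j, m.tr₂_comm i t s, locDot_comm hθ i t s, locScaleDot_comm hθ i t j s]
  ring

end Model

end Elliptical

end

/-! ### Block matrices, positive definiteness and the weights. -/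

noncomputable section

namespace Elliptical

theorem transpose_mul_blockDiagonal'_mul {ι α β : Type*} [Fintype ι] [DecidableEq ι]
    {R : ι → Type*} [∀ i, Fintype (R i)] (D : ∀ i, Matrix (R i) (R i) ℝ)
    (A : Matrix (Σ i, R i) α ℝ) (B : Matrix (Σ i, R i) β ℝ) (a : α) (b : β) :
    (Aᵀ * blockDiagonal' D * B) a b
      = ∑ i, ((A.submatrix (Sigma.mk i) id)ᵀ * D i * B.submatrix (Sigma.mk i) id) a b := by
  simp only [mul_apply, Fintype.sum_sigma]
  refine Finset.sum_congr rfl fun i _ => Finset.sum_congr rfl fun k _ => ?_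
  congr 1
  rw [Finset.sum_eq_single i]
  · simp
  · intro j _ hj
    exact Finset.sum_eq_zero fun l _ => by rw [blockDiagonal'_apply_ne _ _ _ hj, mul_zero]
  · simp

theorem posDef_blockDiagonal' {ι : Type*} [Fintype ι] [DecidableEq ι]
    {R : ι → Type*} [∀ i, Fintype (R i)] {D : ∀ i, Matrix (R i) (R i) ℝ}
    (hD : ∀ i, (D i).PosDef) : (blockDiagonal' D).PosDef := by
  refine PosDef.of_dotProduct_mulVec_pos ?_ fun x hx => ?_
  · rw [IsHermitian, blockDiagonal'_conjTranspose]
    exact congrArg _ (funext fun i => (hD i).isHermitian)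
  have e : star x ⬝ᵥ (blockDiagonal' D *ᵥ x)
      = ∑ i, (fun k => x ⟨i, k⟩) ⬝ᵥ (D i *ᵥ fun k => x ⟨i, k⟩) := by
    have h := transpose_mul_blockDiagonal'_mul D (replicateCol Unit x) (replicateCol Unit x) () ()
    simp only [star_trivial, dotProduct, mulVec, Finset.mul_sum, Finset.sum_mul, mul_apply,
      transpose_apply, replicateCol_apply, submatrix_apply, id] at h ⊢
    rw [Finset.sum_comm]
    convert h using 2 with i _ i _
    · exact Finset.sum_congr rfl fun k _ => by ring
    · rw [Finset.sum_comm]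
      exact Finset.sum_congr rfl fun k _ => Finset.sum_congr rfl fun l _ => by ring
  rw [e]
  have hi : ∃ i, (fun k => x ⟨i, k⟩) ≠ 0 := by
    by_contra! h
    exact hx (funext fun k => congrFun (h k.1) k.2)
  obtain ⟨i, hi⟩ := hi
  refine Finset.sum_pos' (fun j _ => ?_) ⟨i, Finset.mem_univ _, ?_⟩
  · simpa using (hD j).posSemidef.dotProduct_mulVec_nonneg (fun k => x ⟨j, k⟩)
  · simpa using (hD i).dotProduct_mulVec_pos hi

theorem transpose_mul_mul_apply {R α β : Type*} [Fintype R] (A : Matrix R α ℝ) (X : Matrix R R ℝ)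
    (B : Matrix R β ℝ) (a : α) (b : β) : (Aᵀ * X * B) a b = A.col a ⬝ᵥ (X *ᵥ B.col b) := by
  rw [Matrix.mul_assoc]
  rfl

theorem kronCol_mulVec {q : ℕ} (S X : Matrix (Fin q) (Fin q) ℝ) (a v : Fin q → ℝ) :
    vec X ⬝ᵥ (Model.kronCol S a *ᵥ v) = a ⬝ᵥ (X *ᵥ (S *ᵥ v)) := by
  simp only [dotProduct, mulVec, Model.kronCol, Fintype.sum_prod_type, vec_eq_uncurry,
    Function.uncurry_apply_pair, of_apply, Finset.mul_sum]
  rw [Finset.sum_comm]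
  refine Finset.sum_congr rfl fun k _ => Finset.sum_congr rfl fun j _ =>
    Finset.sum_congr rfl fun l _ => by ring

theorem kronRow_mulVec_vec {q : ℕ} (S Y : Matrix (Fin q) (Fin q) ℝ) (a : Fin q → ℝ) :
    Model.kronRow S a *ᵥ vec Y = S *ᵥ (Yᵀ *ᵥ a) := by
  ext l
  simp only [dotProduct, mulVec, Model.kronRow, Fintype.sum_prod_type, vec_eq_uncurry,
    Function.uncurry_apply_pair, of_apply, Finset.mul_sum, transpose_apply]
  exact Finset.sum_congr rfl fun j _ => Finset.sum_congr rfl fun k _ => by ring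

/-- Block matrices of the shape of `M_i` are positive definite. -/
theorem posDef_fromBlocks_kronecker {q : ℕ} {S : Matrix (Fin q) (Fin q) ℝ} (hS : S.PosDef)
    (hq : 0 < q) {k c : ℝ} (hk : 0 < k) (hc : (q : ℝ) < c * (q + 2)) :
    (fromBlocks (k • S) 0 0 ((2 * c) • (S ⊗ₖ S)) +
      (c - 1) • fromBlocks 0 0 0 (vecMulVec (vec S) (vec S)) :
      Matrix (Model.Row q) (Model.Row q) ℝ).PosDef := by
  have hsym : Sᵀ = S := hS.isHermitian
  have hN : (S ⊗ₖ S).PosDef := hS.kronecker hS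
  have hq' : (0 : ℝ) < q := by exact_mod_cast hq
  have hc0 : 0 < c := by
    by_contra! h
    nlinarith
  refine PosDef.of_dotProduct_mulVec_pos ?_ fun x hx => ?_
  · rw [IsHermitian, conjTranspose_eq_transpose_of_trivial, transpose_add, transpose_smul,
      fromBlocks_transpose, fromBlocks_transpose, transpose_smul, transpose_smul,
      ← kroneckerMap_transpose, transpose_vecMulVec, hsym]
    simp
  obtain ⟨u, v, rfl⟩ : ∃ u v, x = Sum.elim u v := ⟨_, _, (Sum.elim_comp_inl_inr x).symm⟩
  have e : star (Sum.elim u v) ⬝ᵥ ((fromBlocks (k • S) 0 0 ((2 * c) • (S ⊗ₖ S)) +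
      (c - 1) • fromBlocks 0 0 0 (vecMulVec (vec S) (vec S)) :
      Matrix (Model.Row q) (Model.Row q) ℝ) *ᵥ Sum.elim u v)
      = k * (u ⬝ᵥ (S *ᵥ u)) + (2 * c * (v ⬝ᵥ ((S ⊗ₖ S) *ᵥ v))
        + (c - 1) * (vec S ⬝ᵥ v) ^ 2) := by
    simp only [star_trivial, add_mulVec, smul_mulVec, fromBlocks_mulVec, dotProduct_add,
      dotProduct_smul, Sum.elim_comp_inl, Sum.elim_comp_inr, zero_mulVec, zero_add, add_zero,
      sumElim_dotProduct_sumElim, smul_eq_mul, vecMulVec_mulVec, op_smul_eq_smul,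
      dotProduct_zero, dotProduct_comm v (vec S)]
    ring
  rw [e]
  have hu : ∀ u, 0 ≤ u ⬝ᵥ (S *ᵥ u) := fun u => by
    simpa using hS.posSemidef.dotProduct_mulVec_nonneg u
  have hv : ∀ v, 0 ≤ v ⬝ᵥ ((S ⊗ₖ S) *ᵥ v) := fun v => by
    simpa using hN.posSemidef.dotProduct_mulVec_nonneg v
  have hdet : IsUnit S.det := hS.det_pos.ne'.isUnit
  have hw : (S ⊗ₖ S) *ᵥ vec S⁻¹ = vec S := by
    rw [kronecker_mulVec_vec, mul_nonsing_inv _ hdet, Matrix.one_mul, hsym]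
  have hw' : ∀ v, vec S⁻¹ ⬝ᵥ ((S ⊗ₖ S) *ᵥ v) = vec S ⬝ᵥ v := fun v => by
    rw [dotProduct_mulVec, ← mulVec_transpose, ← kroneckerMap_transpose, hsym, hw]
  have hww : vec S⁻¹ ⬝ᵥ vec S = q := by
    rw [vec_dotProduct_vec, transpose_nonsing_inv, hsym, nonsing_inv_mul _ hdet]
    simp
  -- Cauchy–Schwarz for the inner product defined by `S ⊗ S`, against `vec S⁻¹`: this vector is sent
  -- to `vec S` and has squared length `q`. The proof expands the form at `v` minus its projection.
  have hcs : (vec S ⬝ᵥ v) ^ 2 ≤ q * (v ⬝ᵥ ((S ⊗ₖ S) *ᵥ v)) := by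
    have h := hv (v - ((vec S ⬝ᵥ v) / q) • vec S⁻¹)
    simp only [mulVec_sub, mulVec_smul, hw, sub_dotProduct, dotProduct_sub, smul_dotProduct,
      dotProduct_smul, hw', hww, smul_eq_mul, dotProduct_comm v (vec S)] at h
    have e : (q : ℝ) * (v ⬝ᵥ ((S ⊗ₖ S) *ᵥ v) - (vec S ⬝ᵥ v) / q * (vec S ⬝ᵥ v)
        - ((vec S ⬝ᵥ v) / q * (vec S ⬝ᵥ v) - (vec S ⬝ᵥ v) / q * ((vec S ⬝ᵥ v) / q * q)))
        = q * (v ⬝ᵥ ((S ⊗ₖ S) *ᵥ v)) - (vec S ⬝ᵥ v) ^ 2 := by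
      field_simp
      ring
    nlinarith [mul_nonneg hq'.le h]
  have hV : 0 ≤ (2 * c * (v ⬝ᵥ ((S ⊗ₖ S) *ᵥ v)) + (c - 1) * (vec S ⬝ᵥ v) ^ 2) ∧
      (v ≠ 0 → 0 < (2 * c * (v ⬝ᵥ ((S ⊗ₖ S) *ᵥ v)) + (c - 1) * (vec S ⬝ᵥ v) ^ 2)) := by
    have hpos : v ≠ 0 → 0 < v ⬝ᵥ ((S ⊗ₖ S) *ᵥ v) := fun h => by
      simpa using hN.dotProduct_mulVec_pos h
    -- For `c ≥ 1` the rank-one term is nonnegative and is dropped. For `c ≤ 1` it is bounded below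
    -- by `hcs`, leaving `2c + (c - 1)q = c(q + 2) - q`.
    have hle : ∃ d > 0, d * (v ⬝ᵥ ((S ⊗ₖ S) *ᵥ v))
        ≤ 2 * c * (v ⬝ᵥ ((S ⊗ₖ S) *ᵥ v)) + (c - 1) * (vec S ⬝ᵥ v) ^ 2 := by
      rcases le_total 1 c with h | h
      · exact ⟨2 * c, by positivity,
          le_add_of_nonneg_right (mul_nonneg (sub_nonneg.2 h) (sq_nonneg _))⟩
      · refine ⟨c * (q + 2) - q, sub_pos.2 hc, ?_⟩
        nlinarith [mul_le_mul_of_nonneg_left hcs (sub_nonneg.2 h)]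
    obtain ⟨d, hd, hle⟩ := hle
    exact ⟨(mul_nonneg hd.le (hv v)).trans hle, fun h => (mul_pos hd (hpos h)).trans_le hle⟩
  by_cases hv0 : v = 0
  · have hu0 : u ≠ 0 := by
      rintro rfl
      exact hx (by rw [hv0]; ext (_ | _) <;> rfl)
    have : 0 < u ⬝ᵥ (S *ᵥ u) := by simpa using hS.dotProduct_mulVec_pos hu0
    exact add_pos_of_pos_of_nonneg (mul_pos hk this) hV.1
  · exact add_pos_of_nonneg_of_pos (mul_nonneg hk.le (hu u)) (hV.2 hv0)

namespace Model

variable {n p : ℕ} {m : Model n p} {θ : Fin p → ℝ} (hθ : θ ∈ m.Θ)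

/-- The condition `c(q + 2) > q` reads `4ψ_(2,2) > q²`. -/
theorem posDef_Mblock (h21 : ∀ i, PsiFinite (m.q i) (m.g i) 2 1)
    (h22 : ∀ i, PsiFinite (m.q i) (m.g i) 2 2) (hθ : θ ∈ m.Θ) (i : Fin n) :
    (m.Mblock i θ).PosDef := by
  have hq : (0 : ℝ) < m.q i := by exact_mod_cast m.q_pos i
  refine posDef_fromBlocks_kronecker (m.scale_posDef i θ hθ) (m.q_pos i) ?_ ?_
  · have := (m.isGenerator i).psi_two_one_pos (h22 i) (h21 i)
    exact div_pos (by linarith) hq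
  · have := (m.isGenerator i).psi_two_two_gt (h22 i)
    rw [c, div_mul_eq_mul_div, lt_div_iff₀ (by positivity)]
    nlinarith

include hθ

theorem Hblock_eq (i : Fin n) : m.Hblock i θ
    = fromBlocks (m.prec i θ) 0 0 ((1 / 2 : ℝ) • (m.prec i θ ⊗ₖ m.prec i θ)) := by
  refine inv_eq_right_inv ?_
  have h := mul_nonsing_inv _ (isUnit_det_scale hθ i)
  rw [fromBlocks_multiply, smul_mul_smul_comm, ← mul_kronecker_mul, h, one_kronecker_one]
  simp

theorem Hblock_isSymm (i : Fin n) : (m.Hblock i θ)ᵀ = m.Hblock i θ := by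
  rw [Hblock_eq hθ, fromBlocks_transpose, transpose_smul, ← kroneckerMap_transpose,
    (prec_isSymm hθ i).eq]
  simp

theorem isUnit_Hblock (i : Fin n) : IsUnit (m.Hblock i θ).det := by
  refine isUnit_nonsing_inv_det _ ?_
  have h := isUnit_det_scale hθ i
  rw [det_fromBlocks_zero₂₁, det_smul, det_kronecker]
  exact h.mul ((isUnit_iff_ne_zero.2 (by positivity)).mul ((h.pow _).mul (h.pow _)))

theorem Hblock_mulVec (i : Fin n) (u : Fin (m.q i) → ℝ)
    (X : Matrix (Fin (m.q i)) (Fin (m.q i)) ℝ) : m.Hblock i θ *ᵥ Sum.elim u (vec X)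
      = Sum.elim (m.prec i θ *ᵥ u) (vec ((1 / 2 : ℝ) • (m.prec i θ * X * m.prec i θ))) := by
  rw [Hblock_eq hθ, fromBlocks_mulVec]
  simp only [Sum.elim_comp_inl, Sum.elim_comp_inr, zero_mulVec, zero_add, add_zero, smul_mulVec,
    kronecker_mulVec_vec, (prec_isSymm hθ i).eq, vec_smul]

omit hθ in
theorem dotProduct_Mblock_mulVec (i : Fin n) (u v : Fin (m.q i) → ℝ)
    (X Y : Matrix (Fin (m.q i)) (Fin (m.q i)) ℝ) :
    Sum.elim u (vec X) ⬝ᵥ (m.Mblock i θ *ᵥ Sum.elim v (vec Y))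
      = m.k₁ i * (u ⬝ᵥ (m.scale i θ *ᵥ v))
        + 2 * m.c i * (Xᵀ * (m.scale i θ * Y * (m.scale i θ)ᵀ)).trace
        + (m.c i - 1) * ((Xᵀ * m.scale i θ).trace * ((m.scale i θ)ᵀ * Y).trace) := by
  simp only [Mblock, add_mulVec, smul_mulVec, fromBlocks_mulVec, dotProduct_add,
      dotProduct_smul, Sum.elim_comp_inl, Sum.elim_comp_inr, zero_mulVec, zero_add, add_zero,
      sumElim_dotProduct_sumElim, smul_eq_mul, vecMulVec_mulVec, op_smul_eq_smul,
      dotProduct_zero, kronecker_mulVec_vec, vec_dotProduct_vec]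
  ring

/-- The factor `½` in each `H_i` turns the coefficients `2c` and `c - 1` of `M_i` into `c/2` and `(c
- 1)/4`, the coefficients of the information. -/
theorem infoForm_eq (i : Fin n) (u v : Fin (m.q i) → ℝ)
    (X Y : Matrix (Fin (m.q i)) (Fin (m.q i)) ℝ) (hX : X.IsSymm) :
    (m.Hblock i θ *ᵥ Sum.elim u (vec X)) ⬝ᵥ
      (m.Mblock i θ *ᵥ (m.Hblock i θ *ᵥ Sum.elim v (vec Y))) = m.infoForm i θ u X v Y := by
  rw [Hblock_mulVec hθ, Hblock_mulVec hθ, dotProduct_Mblock_mulVec, infoForm]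
  have h := isUnit_det_scale hθ i
  have hP := (prec_isSymm hθ i).eq
  have h1 : m.scale i θ * m.prec i θ = 1 := mul_nonsing_inv _ h
  have h2 : m.prec i θ * m.scale i θ = 1 := nonsing_inv_mul _ h
  have e1 : (m.prec i θ *ᵥ u) ⬝ᵥ (m.scale i θ *ᵥ (m.prec i θ *ᵥ v)) = u ⬝ᵥ (m.prec i θ *ᵥ v) := by
    rw [mulVec_mulVec, h1, one_mulVec, dotProduct_comm, dotProduct_mulVec, ← mulVec_transpose, hP,
      dotProduct_comm]
  have e2 : m.prec i θ * X * m.prec i θ * (m.scale i θ * (m.prec i θ * Y * m.prec i θ)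
      * m.scale i θ) = m.prec i θ * (X * m.prec i θ * Y) := by
    rw [show m.scale i θ * (m.prec i θ * Y * m.prec i θ) * m.scale i θ
      = m.scale i θ * m.prec i θ * Y * (m.prec i θ * m.scale i θ) by simp only [Matrix.mul_assoc],
      h1, h2]
    simp only [Matrix.mul_assoc, Matrix.one_mul, Matrix.mul_one]
  have e3 : ∀ Z : Matrix (Fin (m.q i)) (Fin (m.q i)) ℝ,
      (m.prec i θ * Z * m.prec i θ * m.scale i θ).trace = (Z * m.prec i θ).trace := fun Z => by
    rw [Matrix.mul_assoc, h2, Matrix.mul_one, trace_mul_comm]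
  have e4 : (m.scale i θ * (m.prec i θ * Y * m.prec i θ)).trace = (Y * m.prec i θ).trace := by
    rw [trace_mul_comm, e3]
  simp only [transpose_smul, transpose_mul, hP, hX.eq, (m.scale_isSymm hθ i).eq, Matrix.smul_mul,
    Matrix.mul_smul, trace_smul, smul_eq_mul, ← Matrix.mul_assoc (m.prec i θ) X, e1, e2, e3, e4]
  rw [trace_mul_comm (m.prec i θ)]
  simp only [Matrix.mul_assoc]
  ring

end Model

end Elliptical

end

/-! ### The regression form of the bias. -/

noncomputable section

namespace Elliptical

namespace Model

variable {n p : ℕ} {m : Model n p} {θ : Fin p → ℝ}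

theorem dotProduct_Bblock_mulVec (i : Fin n) (r : Fin p) (u v : Fin (m.q i) → ℝ)
    (X Y : Matrix (Fin (m.q i)) (Fin (m.q i)) ℝ) :
    Sum.elim u (vec X) ⬝ᵥ (m.Bblock i r θ *ᵥ Sum.elim v (vec Y))
      = -(1 / 2) * (m.eta₁ i * (u ⬝ᵥ (m.C i r θ *ᵥ v))
          + 2 * m.eta₁ i * (u ⬝ᵥ (m.scale i θ *ᵥ (Yᵀ *ᵥ m.a i r θ)))
          + 2 * m.eta₂ i * (m.a i r θ ⬝ᵥ (X *ᵥ (m.scale i θ *ᵥ v)))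
          + 2 * (m.c i - 1) * ((Xᵀ * m.scale i θ).trace * (((m.C i r θ)ᵀ * Y).trace
            + 1 / 2 * m.tr i r θ * ((m.scale i θ)ᵀ * Y).trace)))
        - 1 / 4 * (m.eta₁ i * m.tr i r θ * (u ⬝ᵥ (m.scale i θ *ᵥ v))
          + 2 * m.eta₁ i * ((u ⬝ᵥ m.a i r θ) * ((m.scale i θ)ᵀ * Y).trace)
          + 2 * m.eta₁ i * ((Xᵀ * m.scale i θ).trace * (m.a i r θ ⬝ᵥ v))
          + 2 * (m.c i + 8 * m.omega i) * ((Xᵀ * m.C i r θ).trace * ((m.scale i θ)ᵀ * Y).trace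
            + (Xᵀ * m.scale i θ).trace * ((m.C i r θ)ᵀ * Y).trace
            + 4 * (Xᵀ * (m.C i r θ * Y * (m.scale i θ)ᵀ)).trace
            + m.tr i r θ * ((Xᵀ * (m.scale i θ * Y * (m.scale i θ)ᵀ)).trace
              + 1 / 2 * ((Xᵀ * m.scale i θ).trace * ((m.scale i θ)ᵀ * Y).trace)))) := by
  simp only [Bblock, S₁, S₂, add_mulVec, sub_mulVec, neg_mulVec, smul_mulVec, fromBlocks_mulVec,
    dotProduct_add, dotProduct_sub, dotProduct_neg, dotProduct_smul, Sum.elim_comp_inl,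
    Sum.elim_comp_inr, sumElim_dotProduct_sumElim, smul_eq_mul, vecMulVec_mulVec,
    op_smul_eq_smul, kronecker_mulVec_vec, vec_dotProduct_vec, kronCol_mulVec,
    kronRow_mulVec_vec]
  ring

theorem scoreForm_eq (hθ : θ ∈ m.Θ) (i : Fin n) (j r s : Fin p) :
    (m.Hblock i θ *ᵥ Sum.elim (m.a i j θ) (vec (m.C i j θ))) ⬝ᵥ
      (m.Bblock i r θ *ᵥ (m.Hblock i θ *ᵥ Sum.elim (m.a i s θ) (vec (m.C i s θ))))
      = m.scoreForm i j r s θ := by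
  rw [Hblock_mulVec hθ, Hblock_mulVec hθ, dotProduct_Bblock_mulVec]
  have h := isUnit_det_scale hθ i
  have hP := (prec_isSymm hθ i).eq
  have hS := (m.scale_isSymm hθ i).eq
  have hC := fun r => (m.C_isSymm hθ i r).eq
  have h1 : m.scale i θ * m.prec i θ = 1 := mul_nonsing_inv _ h
  have h2 : m.prec i θ * m.scale i θ = 1 := nonsing_inv_mul _ h
  have hd : ∀ u v : Fin (m.q i) → ℝ, (m.prec i θ *ᵥ u) ⬝ᵥ v = u ⬝ᵥ (m.prec i θ *ᵥ v) :=
    fun u v => by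
      rw [dotProduct_comm, dotProduct_mulVec, ← mulVec_transpose, hP, dotProduct_comm]
  have h1' : ∀ Z, m.scale i θ * (m.prec i θ * Z) = Z := fun Z => by
    rw [← Matrix.mul_assoc, h1, Matrix.one_mul]
  have c1 : ∀ A, (m.prec i θ * A).trace = (A * m.prec i θ).trace := fun A => trace_mul_comm _ _
  have c2 : ∀ A B, (m.prec i θ * (A * (m.prec i θ * B))).trace
      = (A * (m.prec i θ * (B * m.prec i θ))).trace := fun A B => by
    rw [c1]; simp only [Matrix.mul_assoc]
  have ht : ∀ r, m.tr i r θ = (m.C i r θ * m.prec i θ).trace := fun r => rfl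
  simp only [transpose_smul, transpose_mul, hP, hS, hC, Matrix.smul_mul, Matrix.mul_smul,
    trace_smul, smul_eq_mul, smul_mulVec, dotProduct_smul, mulVec_smul, hd, mulVec_mulVec,
    Matrix.mul_assoc, h1', h1, h2, Matrix.mul_one, c2, c1, scoreForm, locDot,
    locScaleDot, tr₂, tr₃, ht]
  ring

/-- The weights `H_i M_iᵀ H_i` of the observation `i`. -/
def weight (m : Model n p) (i : Fin n) (θ : Fin p → ℝ) :
    Matrix (Row (m.q i)) (Row (m.q i)) ℝ :=
  m.Hblock i θ * (m.Mblock i θ)ᵀ * m.Hblock i θ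

theorem Htilde_eq_blockDiagonal' (m : Model n p) (θ : Fin p → ℝ) :
    m.Htilde θ = blockDiagonal' fun i => m.weight i θ := by
  simp only [Htilde, H, M, ← blockDiagonal'_mul, weight]

theorem Mblock_isSymm (hθ : θ ∈ m.Θ) (i : Fin n) : (m.Mblock i θ)ᵀ = m.Mblock i θ := by
  rw [Mblock, transpose_add, transpose_smul, fromBlocks_transpose, fromBlocks_transpose,
    transpose_smul, transpose_smul, ← kroneckerMap_transpose, transpose_vecMulVec,
    (m.scale_isSymm hθ i).eq]
  simp

theorem posDef_Htilde (h21 : ∀ i, PsiFinite (m.q i) (m.g i) 2 1)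
    (h22 : ∀ i, PsiFinite (m.q i) (m.g i) 2 2) (hθ : θ ∈ m.Θ) : (m.Htilde θ).PosDef := by
  rw [Htilde_eq_blockDiagonal']
  refine posDef_blockDiagonal' fun i => ?_
  have hH := Hblock_isSymm hθ i
  have h := (posDef_Mblock h21 h22 hθ i).conjTranspose_mul_mul_same (B := m.Hblock i θ)
    (mulVec_injective_of_isUnit ((isUnit_iff_isUnit_det _).2 (isUnit_Hblock hθ i)))
  rwa [conjTranspose_eq_transpose_of_trivial, hH, ← Mblock_isSymm hθ] at h

theorem col_dotProduct_weight_mulVec (hθ : θ ∈ m.Θ) (i : Fin n) (r : Fin p)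
    (v : Fin (m.q i) → ℝ) (Y : Matrix (Fin (m.q i)) (Fin (m.q i)) ℝ) :
    (m.Fblock i θ).col r ⬝ᵥ (m.weight i θ *ᵥ Sum.elim v (vec Y))
      = m.infoForm i θ (m.a i r θ) (m.C i r θ) v Y := by
  rw [← infoForm_eq hθ _ _ _ _ _ (m.C_isSymm hθ i r), weight, Mblock_isSymm hθ,
    ← mulVec_mulVec, ← mulVec_mulVec, dotProduct_mulVec, ← mulVec_transpose, Hblock_isSymm hθ]
  rfl

theorem transpose_mul_Htilde_mul_apply (hθ : θ ∈ m.Θ) (r s : Fin p) :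
    ((m.F θ)ᵀ * m.Htilde θ * m.F θ) r s = ∑ i, m.infoTerm i r s θ := by
  rw [Htilde_eq_blockDiagonal', transpose_mul_blockDiagonal'_mul]
  refine Finset.sum_congr rfl fun i _ => ?_
  rw [transpose_mul_mul_apply, infoTerm_eq_infoForm, ← col_dotProduct_weight_mulVec hθ]
  rfl

/-- With `M_i` symmetric, the product `H M H H⁻¹ M⁻¹` collapses to `H`; this is why `Φ` carries the
factor `H⁻¹M⁻¹`. -/
theorem weight_mul_PhiBlock (h21 : ∀ i, PsiFinite (m.q i) (m.g i) 2 1)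
    (h22 : ∀ i, PsiFinite (m.q i) (m.g i) 2 2) (hθ : θ ∈ m.Θ) (i : Fin n) (r : Fin p) :
    m.weight i θ * m.PhiBlock i r θ = (-(1 / 2) : ℝ) • (m.Hblock i θ * m.Bblock i r θ
      * m.Hblock i θ * m.Fblock i θ + m.weight i θ * m.dFblock i r θ) := by
  have hH := mul_nonsing_inv _ (isUnit_Hblock hθ i)
  have hM := mul_nonsing_inv _ (posDef_Mblock h21 h22 hθ i).det_pos.ne'.isUnit
  rw [PhiBlock, Matrix.mul_neg, Matrix.mul_smul, Matrix.mul_add, ← neg_smul]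
  congr 2
  simp only [weight, Mblock_isSymm hθ, Matrix.mul_assoc]
  rw [← Matrix.mul_assoc (m.Hblock i θ) (m.Hblock i θ)⁻¹, hH, Matrix.one_mul,
    ← Matrix.mul_assoc (m.Mblock i θ) (m.Mblock i θ)⁻¹, hM, Matrix.one_mul]

theorem dFblock_col (i : Fin n) (r s : Fin p) :
    (m.dFblock i r θ).col s = Sum.elim (m.a₂ i s r θ) (vec (m.C₂ i s r θ)) := by
  ext (k | k) <;> rfl

theorem transpose_mul_Htilde_mul_Phi_apply (h21 : ∀ i, PsiFinite (m.q i) (m.g i) 2 1)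
    (h22 : ∀ i, PsiFinite (m.q i) (m.g i) 2 2) (hθ : θ ∈ m.Θ) (j s t : Fin p) :
    ((m.F θ)ᵀ * m.Htilde θ * m.Phi θ) j (s, t) = ∑ i, -(1 / 2) * (m.scoreForm i j s t θ
      + m.infoForm i θ (m.a i j θ) (m.C i j θ) (m.a₂ i t s θ) (m.C₂ i t s θ)) := by
  rw [Htilde_eq_blockDiagonal', transpose_mul_blockDiagonal'_mul]
  refine Finset.sum_congr rfl fun i _ => ?_
  have h : (((m.F θ).submatrix (Sigma.mk i) id)ᵀ * m.weight i θ
      * (m.Phi θ).submatrix (Sigma.mk i) id) j (s, t)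
      = ((m.Fblock i θ)ᵀ * (m.weight i θ * m.PhiBlock i s θ)) j t := by
    rw [← Matrix.mul_assoc]
    rfl
  rw [h, weight_mul_PhiBlock h21 h22 hθ, Matrix.mul_smul, Matrix.mul_add, Matrix.smul_apply,
    Matrix.add_apply, smul_eq_mul, ← Matrix.mul_assoc _ (m.weight i θ), transpose_mul_mul_apply _ (m.weight i θ),
    dFblock_col, col_dotProduct_weight_mulVec hθ, ← scoreForm_eq hθ]
  congr 2
  rw [Matrix.mul_assoc _ (m.Hblock i θ) (m.Fblock i θ), Matrix.mul_assoc (m.Hblock i θ),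
    ← Matrix.mul_assoc (m.Fblock i θ)ᵀ, ← Matrix.mul_assoc]
  nth_rw 1 [← Hblock_isSymm hθ i]
  rw [← transpose_mul, transpose_mul_mul_apply]
  rfl

theorem fisher_eq_transpose_mul_Htilde_mul (h21 : ∀ i, PsiFinite (m.q i) (m.g i) 2 1)
    (h22 : ∀ i, PsiFinite (m.q i) (m.g i) 2 2) (hθ : θ ∈ m.Θ) :
    m.fisher θ = (m.F θ)ᵀ * m.Htilde θ * m.F θ := by
  ext r s
  rw [m.fisher_eq h21 h22 hθ, transpose_mul_Htilde_mul_apply hθ]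

/-- Rank `p` makes the `p` columns of `F` independent, so `F` is injective and a positive definite
form pulls back to one. -/
theorem posDef_transpose_mul_Htilde_mul (h21 : ∀ i, PsiFinite (m.q i) (m.g i) 2 1)
    (h22 : ∀ i, PsiFinite (m.q i) (m.g i) 2 2) (hθ : θ ∈ m.Θ) (hrank : (m.F θ).rank = p) :
    ((m.F θ)ᵀ * m.Htilde θ * m.F θ).PosDef := by
  refine (posDef_Htilde h21 h22 hθ).conjTranspose_mul_mul_same (B := m.F θ) ?_
  rw [mulVec_injective_iff, linearIndependent_iff_card_eq_finrank_span, Fintype.card_fin,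
    Set.finrank, ← rank_eq_finrank_span_cols, hrank]

/-- The Cox–Snell coefficients and the entries of `Fᵀ H̃ Φ` have the same symmetrization. -/
theorem coxSnell_symmetrized (h21 : ∀ i, PsiFinite (m.q i) (m.g i) 2 1)
    (h22 : ∀ i, PsiFinite (m.q i) (m.g i) 2 2) (h32 : ∀ i, PsiFinite (m.q i) (m.g i) 3 2)
    (h33 : ∀ i, PsiFinite (m.q i) (m.g i) 3 3) (hθ : θ ∈ m.Θ) (hreg : m.IsRegularAt θ)
    (j s t : Fin p) :
    (1 / 2 * m.kappa₃ j s t θ + m.kappa₂₁ j s t θ)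
        + (1 / 2 * m.kappa₃ j t s θ + m.kappa₂₁ j t s θ)
      = ((m.F θ)ᵀ * m.Htilde θ * m.Phi θ) j (s, t)
        + ((m.F θ)ᵀ * m.Htilde θ * m.Phi θ) j (t, s) := by
  obtain ⟨hi, hd, hk, hs⟩ := m.regular_identities hθ hreg
  have hD : ∀ r s t, m.kappa₂₁ r s t θ + m.kappa₂₁ t s r θ + m.cubic r t s θ
      = ∑ i, (m.infoForm i θ (m.a₂ i r s θ) (m.C₂ i r s θ) (m.a i t θ) (m.C i t θ)
        + m.infoForm i θ (m.a i r θ) (m.C i r θ) (m.a₂ i t s θ) (m.C₂ i t s θ)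
        + m.infoFormDeriv i r t s θ) := fun r s t => by
    refine (hd r s t).unique ((HasDerivAt.fun_sum (u := Finset.univ) fun i _ =>
      hasDerivAt_infoTerm hθ i r t s).congr_of_eventuallyEq ?_)
    filter_upwards [line_eventually_mem (m.isOpen_Θ.mem_nhds hθ) s] with τ hτ
    exact m.fisher_eq h21 h22 hτ r t
  have hc : m.cubic j s t θ = ∑ i, m.cubicTerm i j s t θ :=
    m.integral_U_mul_U_mul_U h21 h22 h32 h33 hθ j s t (hi j s t)
  -- The left side is `-½(∂_s κ_{j,t} + ∂_t κ_{j,s} - ∂_j κ_{s,t} + E(U_j U_s U_t))`. Second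
  -- derivatives taken in `(j, s)` or `(j, t)` cancel by symmetry, and those in `(s, t)` are the
  -- ones `Φ` contains through `∂F_i/∂θ_r`.
  have hsum : -(1 / 2) * ((∑ i, (m.infoForm i θ (m.a₂ i j s θ) (m.C₂ i j s θ) (m.a i t θ)
          (m.C i t θ) + m.infoForm i θ (m.a i j θ) (m.C i j θ) (m.a₂ i t s θ) (m.C₂ i t s θ)
          + m.infoFormDeriv i j t s θ))
        + (∑ i, (m.infoForm i θ (m.a₂ i j t θ) (m.C₂ i j t θ) (m.a i s θ)
          (m.C i s θ) + m.infoForm i θ (m.a i j θ) (m.C i j θ) (m.a₂ i s t θ) (m.C₂ i s t θ)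
          + m.infoFormDeriv i j s t θ))
        - (∑ i, (m.infoForm i θ (m.a₂ i s j θ) (m.C₂ i s j θ) (m.a i t θ)
          (m.C i t θ) + m.infoForm i θ (m.a i s θ) (m.C i s θ) (m.a₂ i t j θ) (m.C₂ i t j θ)
          + m.infoFormDeriv i s t j θ))
        + ∑ i, m.cubicTerm i j s t θ)
      = ((m.F θ)ᵀ * m.Htilde θ * m.Phi θ) j (s, t)
        + ((m.F θ)ᵀ * m.Htilde θ * m.Phi θ) j (t, s) := by
    rw [transpose_mul_Htilde_mul_Phi_apply h21 h22 hθ,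
      transpose_mul_Htilde_mul_Phi_apply h21 h22 hθ, ← Finset.sum_add_distrib,
      ← Finset.sum_add_distrib, ← Finset.sum_sub_distrib, ← Finset.sum_add_distrib,
      Finset.mul_sum]
    refine Finset.sum_congr rfl fun i _ => ?_
    rw [a₂_comm hθ i s j, C₂_comm hθ i s j, a₂_comm hθ i t j, C₂_comm hθ i t j,
      infoForm_comm hθ i (m.a₂ i j t θ)]
    linear_combination (-1 / 2 : ℝ) * scoreForm_add_comm m hθ i j s t
  have c₁ : m.cubic j t s θ = m.cubic j s t θ := integral_congr_ae <| .of_forall fun y => by ring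
  have c₂ : m.cubic s t j θ = m.cubic j s t θ := integral_congr_ae <| .of_forall fun y => by ring
  rw [← hsum, ← hD, ← hD, ← hD, ← hc]
  linear_combination 1 / 2 * hk j s t + 1 / 2 * hk j t s - 1 / 2 * hs s j t - 1 / 2 * hs t j s
    - 1 / 2 * c₂

theorem bias_eq (h21 : ∀ i, PsiFinite (m.q i) (m.g i) 2 1)
    (h22 : ∀ i, PsiFinite (m.q i) (m.g i) 2 2) (h32 : ∀ i, PsiFinite (m.q i) (m.g i) 3 2)
    (h33 : ∀ i, PsiFinite (m.q i) (m.g i) 3 3) (hθ : θ ∈ m.Θ) (hreg : m.IsRegularAt θ) :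
    m.bias θ = (((m.F θ)ᵀ * m.Htilde θ * m.F θ)⁻¹ * (m.F θ)ᵀ * m.Htilde θ) *ᵥ m.xi θ := by
  have hK := fisher_eq_transpose_mul_Htilde_mul h21 h22 hθ
  have hKs : ((m.fisher θ)⁻¹)ᵀ = (m.fisher θ)⁻¹ := by
    rw [transpose_nonsing_inv]
    congr 1
    ext r s
    exact integral_congr_ae <| .of_forall fun y => mul_comm _ _
  have hKs' : ∀ s t, (m.fisher θ)⁻¹ s t = (m.fisher θ)⁻¹ t s := fun s t =>
    congrFun (congrFun hKs t) s
  rw [xi, ← hK, mulVec_mulVec, Matrix.mul_assoc _ (m.F θ)ᵀ, Matrix.mul_assoc (m.fisher θ)⁻¹,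
    ← mulVec_mulVec]
  ext j
  rw [bias, mulVec, dotProduct]
  refine Finset.sum_congr rfl fun r _ => ?_
  simp only [mulVec, dotProduct, Fintype.sum_prod_type, vec_eq_uncurry,
    Function.uncurry_apply_pair, Finset.mul_sum]
  -- Against the symmetric `K⁻¹` a coefficient array and its symmetrization give the same sum up to
  -- the factor two, so agreement after symmetrization is enough.
  have symm_sum : ∀ f : Fin p → Fin p → ℝ, ∑ s, ∑ t, (m.fisher θ)⁻¹ j r * ((m.fisher θ)⁻¹ s t
      * (f s t + f t s)) = 2 * ∑ s, ∑ t, (m.fisher θ)⁻¹ j r * ((m.fisher θ)⁻¹ s t * f s t) :=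
    fun f => by
      simp only [mul_add, Finset.sum_add_distrib, two_mul]
      congr 1
      rw [Finset.sum_comm]
      simp only [hKs']
  have e := symm_sum fun s t => ((m.F θ)ᵀ * m.Htilde θ * m.Phi θ) r (s, t)
  simp only [← coxSnell_symmetrized h21 h22 h32 h33 hθ hreg] at e
  rw [symm_sum fun s t => 1 / 2 * m.kappa₃ r s t θ + m.kappa₂₁ r s t θ] at e
  have e' := mul_left_cancel₀ two_ne_zero e
  simp only [← mul_assoc] at e' ⊢
  rw [e']
  refine Finset.sum_congr rfl fun s _ => Finset.sum_congr rfl fun t _ => ?_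
  -- Column stacking puts the entry `(t, s)` of `K⁻¹` at the index `(s, t)`; symmetry reconciles the
  -- two.
  rw [hKs' t s]
  ring

/-- Weighted least squares: the solution of the normal equations is the unique minimizer. -/
theorem wss_lt {b₀ : Fin p → ℝ} (hH : (m.Htilde θ).PosDef)
    (hK : ((m.F θ)ᵀ * m.Htilde θ * m.F θ).PosDef)
    (hb₀ : b₀ = (((m.F θ)ᵀ * m.Htilde θ * m.F θ)⁻¹ * (m.F θ)ᵀ * m.Htilde θ) *ᵥ m.xi θ)
    {b : Fin p → ℝ} (hb : b ≠ b₀) : m.wss θ b₀ < m.wss θ b := by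
  have hT : (m.Htilde θ)ᵀ = m.Htilde θ := hH.isHermitian
  -- The normal equations: the residual is `H̃`-orthogonal to the column space of `F`. Any other `b`
  -- therefore adds exactly the positive form `(b - b₀)ᵀ Fᵀ H̃ F (b - b₀)`.
  have hn : ((m.F θ)ᵀ * m.Htilde θ) *ᵥ (m.xi θ - m.F θ *ᵥ b₀) = 0 := by
    rw [mulVec_sub, mulVec_mulVec, hb₀, mulVec_mulVec, Matrix.mul_assoc _ (m.F θ)ᵀ,
      ← Matrix.mul_assoc _ _⁻¹, mul_nonsing_inv _ hK.det_pos.ne'.isUnit, Matrix.one_mul, sub_self]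
  have hpos := hK.dotProduct_mulVec_pos (sub_ne_zero.2 hb)
  set e := m.xi θ - m.F θ *ᵥ b₀ with he
  have hsub : m.xi θ - m.F θ *ᵥ b = e - m.F θ *ᵥ (b - b₀) := by
    rw [he, mulVec_sub]
    abel
  have h1 : (m.F θ *ᵥ (b - b₀)) ⬝ᵥ (m.Htilde θ *ᵥ e) = 0 := by
    rw [← vecMul_transpose, ← dotProduct_mulVec, mulVec_mulVec, hn, dotProduct_zero]
  have h2 : e ⬝ᵥ (m.Htilde θ *ᵥ (m.F θ *ᵥ (b - b₀))) = 0 := by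
    rw [dotProduct_mulVec, ← mulVec_transpose, hT, dotProduct_comm, h1]
  have h3 : (m.F θ *ᵥ (b - b₀)) ⬝ᵥ (m.Htilde θ *ᵥ (m.F θ *ᵥ (b - b₀)))
      = star (b - b₀) ⬝ᵥ (((m.F θ)ᵀ * m.Htilde θ * m.F θ) *ᵥ (b - b₀)) := by
    nth_rw 1 [← vecMul_transpose]
    rw [← dotProduct_mulVec, mulVec_mulVec, mulVec_mulVec, star_trivial, Matrix.mul_assoc]
  clear_value e
  rw [wss, wss, ← he, hsub]
  generalize m.F θ *ᵥ (b - b₀) = d at *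
  rw [mulVec_sub, sub_dotProduct, dotProduct_sub, dotProduct_sub, h1, h2,
    h3]
  linarith

end Model

end Elliptical

end

theorem theorem3p1 {n p : ℕ} (m : Elliptical.Model n p)
    (hpsi₂₁ : ∀ i, Elliptical.PsiFinite (m.q i) (m.g i) 2 1)
    (hpsi₂₂ : ∀ i, Elliptical.PsiFinite (m.q i) (m.g i) 2 2)
    (hpsi₃₂ : ∀ i, Elliptical.PsiFinite (m.q i) (m.g i) 3 2)
    (hpsi₃₃ : ∀ i, Elliptical.PsiFinite (m.q i) (m.g i) 3 3)
    (θ : Fin p → ℝ) (hθ : θ ∈ m.Θ)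
    (hreg : m.IsRegularAt θ)
    (hrank : (m.F θ).rank = p) :
    (∀ i, IsUnit (m.Mblock i θ).det) ∧
    (m.Htilde θ).PosDef ∧
    ((m.F θ)ᵀ * m.Htilde θ * m.F θ).PosDef ∧
    m.bias θ =
      (((m.F θ)ᵀ * m.Htilde θ * m.F θ)⁻¹ * (m.F θ)ᵀ * m.Htilde θ) *ᵥ m.xi θ ∧
    (∀ b : Fin p → ℝ, b ≠ m.bias θ → m.wss θ (m.bias θ) < m.wss θ b) := by
  have hH := Elliptical.Model.posDef_Htilde hpsi₂₁ hpsi₂₂ hθ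
  have hK := Elliptical.Model.posDef_transpose_mul_Htilde_mul hpsi₂₁ hpsi₂₂ hθ hrank
  have hb := Elliptical.Model.bias_eq hpsi₂₁ hpsi₂₂ hpsi₃₂ hpsi₃₃ hθ hreg
  exact ⟨fun i => (Elliptical.Model.posDef_Mblock hpsi₂₁ hpsi₂₂ hθ i).det_pos.ne'.isUnit, hH, hK,
    hb, fun b h => Elliptical.Model.wss_lt hH hK hb h⟩
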